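/- A \emph{self-contained $k$-witness problem} $\Pi$ is given by instances, each consisting of a universe $U$ of $n$ elements, a parameter $k$, and a set of witnesses, each of which is a subset of $U$ with exactly $k$ elements. A \emph{deterministic decision oracle} for an instance answers, for a set $X\subseteq U$, whether some witness is entirely contained in $X$. An algorithm \emph{solves the decision version} of $\Pi$ if, for every instance and every $X\subseteq U$, it computes this answer. \textbf{Theorem.} Let $\Pi$ be a self-contained $k$-witness problem, and let $0<\delta\le\frac12$ and $M\in\mathbb N$ with $M\ge 1$. Then there is a randomised algorithm which, on every instance of $\Pi$ with $n\ge 2$, makes (for all outcomes of its random choices) at most $2^{O(k)}\log^2 n\cdot M\cdot\log(\delta^{-1})$ calls to a deterministic decision oracle for $\Pi$, and 1. if the number of witnesses in the instance is at most $M$, outputs with probability at least $1-\delta$ the exact number of witnesses in the instance; 2. if the number of witnesses in the instance is strictly greater than $M$, always outputs "More than $M$". Moreover, if there is a deterministic algorithm solving the decision version of $\Pi$ in time $g(k)\cdot n^{O(1)}$ for some function $g$, then, when this algorithm is used to answer the oracle calls, the expected running time of the randomised algorithm is at most $2^{O(k)}\cdot g(k)\cdot n^{O(1)}\cdot M\cdot\log(\delta^{-1})$.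 The randomised algorithm and the constant in the bound on the number of oracle calls do not depend on $\Pi$, and the algorithm receives $n$, $k$, $M$ and $\lceil\log_2(\delta^{-1})\rceil$ as input; the implied constants in the bound on the running time depend only on the exponent of $n$ in the running time of the decision algorithm. Running times are step counts on a random access machine with unit-cost addition, subtraction, indirect addressing and, for the randomised algorithm, uniform random choice of an integer from $\{0,\dots,m\}$. -/

import Mathlib

open scoped ENNReal

noncomputable section

namespace WitnessCounting

/-! ### Self-contained `k`-witness problems -/

/-- A self-contained `k`-witness problem.  An instance `I` has a universe of `univSize I` elements
(numbered `0, 1, …`), a parameter `k = param I`, and a set of witnesses, each consisting of exactly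
`k` elements of the universe.  `code I` is the description of the instance that is handed to an
algorithm for the problem. -/
structure WitnessProblem where
  Inst : Type
  univSize : Inst → ℕ
  param : Inst → ℕ
  witnesses : (I : Inst) → Finset (Finset (Fin (univSize I)))
  card_witness : ∀ I, ∀ W ∈ witnesses I, W.card = param I
  code : Inst → List ℕ

/-- The decision question for the instance `I` and the subset `X` of its universe: is some witness
of `I` entirely contained in `X`? -/
def WitnessProblem.YesOn (P : WitnessProblem) (I : P.Inst) (X : Finset (Fin (P.univSize I))) :
    Prop :=
  ∃ W ∈ P.witnesses I, W ⊆ X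

open Classical in
/-- The deterministic decision oracle: `1` if some witness is contained in `X`, and `0` otherwise. -/
def WitnessProblem.oracle (P : WitnessProblem) (I : P.Inst) (X : Finset (Fin (P.univSize I))) : ℕ :=
  if P.YesOn I X then 1 else 0

/-! ### Programs for a random access machine with step counting

The machine has cells `0, 1, 2, …` holding natural numbers, and only additive arithmetic
(uniform cost).  `E` is the type of the additional elementary instructions. -/

/-- Programs.  Below, `[a]` is the content of the cell `a`. -/
inductive Prog (E : Type) : Type
  /-- `[r] := c` -/
  | const (r c : ℕ) : Prog E
  /-- `[r] := [a] + [b]` -/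
  | add (r a b : ℕ) : Prog E
  /-- `[r] := max ([a] - [b]) 0` -/
  | sub (r a b : ℕ) : Prog E
  /-- `[r] := [[a]]` -/
  | load (r a : ℕ) : Prog E
  /-- `[[a]] := [b]` -/
  | store (a b : ℕ) : Prog E
  /-- an additional elementary instruction -/
  | ext (e : E) : Prog E
  /-- first `p`, then `q` -/
  | seq (p q : Prog E) : Prog E
  /-- if `[r] ≠ 0` then `p` else `q` -/
  | cond (r : ℕ) (p q : Prog E) : Prog E
  /-- while `[r] ≠ 0` do `p` -/
  | loop (r : ℕ) (p : Prog E) : Prog E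

/-- Memory, the number of steps made so far, and the list of queries made so far
(the latest one first). -/
structure Config (L : Type) where
  mem : ℕ → ℕ
  steps : ℕ
  queries : List L

/-- One step that does not change the memory. -/
def Config.tick {L : Type} (s : Config L) : Config L :=
  { s with steps := s.steps + 1 }

/-- One step that writes `v` into the cell `r`. -/
def Config.write {L : Type} (s : Config L) (r v : ℕ) : Config L :=
  { s with mem := Function.update s.mem r v, steps := s.steps + 1 }

/-- The result of running a program with recursion depth at most `fuel`: the distribution of the
final configuration, with `none` for runs that exceed the depth.  `h` gives the effect of the
additional instructions. -/
def exec {E L : Type} (h : E → Config L → PMF (Config L)) :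
    ℕ → Prog E → Config L → PMF (Option (Config L))
  | 0, _, _ => PMF.pure none
  | _ + 1, .const r c, s => PMF.pure (some (s.write r c))
  | _ + 1, .add r a b, s => PMF.pure (some (s.write r (s.mem a + s.mem b)))
  | _ + 1, .sub r a b, s => PMF.pure (some (s.write r (s.mem a - s.mem b)))
  | _ + 1, .load r a, s => PMF.pure (some (s.write r (s.mem (s.mem a))))
  | _ + 1, .store a b, s => PMF.pure (some (s.write (s.mem a) (s.mem b)))
  | _ + 1, .ext e, s => (h e s).map some
  | fuel + 1, .seq p q, s =>
      (exec h fuel p s).bind fun o => o.elim (PMF.pure none) (exec h fuel q)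
  | fuel + 1, .cond r p q, s =>
      if s.mem r ≠ 0 then exec h fuel p s.tick else exec h fuel q s.tick
  | fuel + 1, .loop r p, s =>
      if s.mem r ≠ 0 then
        (exec h fuel p s.tick).bind fun o => o.elim (PMF.pure none) (exec h fuel (.loop r p))
      else PMF.pure (some s.tick)

/-- Started in the configuration `s`, the program halts for all random choices, and the final
configuration has distribution `μ`. -/
def HasOutcome {E L : Type} (h : E → Config L → PMF (Config L)) (p : Prog E) (s : Config L)
    (μ : PMF (Config L)) : Prop :=
  ∃ fuel, exec h fuel p s = μ.map some

/-! ### Deterministic decision algorithms -/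

/-- The additional instruction of a decision algorithm: read the description of the instance. -/
inductive ReadOp : Type
  /-- `[r] :=` the entry with number `[a]` of the description (`0` if there is none) -/
  | read (r a : ℕ) : ReadOp

/-- The effect of a `read` instruction, for an instance with the description `c`. -/
def readStep (c : List ℕ) : ReadOp → Config Empty → PMF (Config Empty)
  | .read r a, s => PMF.pure (s.write r (c.getD (s.mem a) 0))

/-- The initial configuration of a decision algorithm: cells `0, 1, 2` hold `n`, `k` and the length
of the description, and cells `3, …, n + 2` hold the indicator function of `X`. -/
def decisionStart (P : WitnessProblem) (I : P.Inst) (X : Finset (Fin (P.univSize I))) :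
    Config Empty where
  mem a :=
    if a = 0 then P.univSize I
    else if a = 1 then P.param I
    else if a = 2 then (P.code I).length
    else if ∃ i ∈ X, a = i.val + 3 then 1 else 0
  steps := 0
  queries := []

/-- The (deterministic) program `D` solves the decision version of `P`, leaving the answer `1` or
`0` in cell `0`; for the instance `I` and the subset `X` it makes exactly `time I X` steps. -/
def Decides (P : WitnessProblem) (D : Prog ReadOp)
    (time : (I : P.Inst) → Finset (Fin (P.univSize I)) → ℕ) : Prop :=
  ∀ I X, ∃ s : Config Empty,
    HasOutcome (readStep (P.code I)) D (decisionStart P I X) (PMF.pure s) ∧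
      s.mem 0 = P.oracle I X ∧ s.steps = time I X

/-! ### Randomised algorithms with a decision oracle -/

/-- The additional instructions of a randomised algorithm with a decision oracle. -/
inductive OracleOp : Type
  /-- `[r] :=` an element of `{0, …, [a]}`, chosen uniformly and independently of the past -/
  | rand (r a : ℕ) : OracleOp
  /-- `[r] :=` the answer of the oracle to the set `X` of all `i < n` with `[[a] + i] ≠ 0` -/
  | query (r a : ℕ) : OracleOp

/-- The set, a subset of `{0, …, n - 1}`, whose indicator function is stored from cell `b` on. -/
def storedSet (n : ℕ) (mem : ℕ → ℕ) (b : ℕ) : Finset (Fin n) :=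
  Finset.univ.filter fun i => mem (b + i.val) ≠ 0

/-- The effect of the additional instructions, for the oracle of the instance `I`.  Passing the
argument of a query takes `n` steps; the time that a procedure answering the query needs is not
included here but added in `expectedTime`. -/
def oracleStep (P : WitnessProblem) (I : P.Inst) :
    OracleOp → Config (Finset (Fin (P.univSize I))) → PMF (Config (Finset (Fin (P.univSize I))))
  | .rand r a, s =>
      (PMF.uniformOfFintype (Fin (s.mem a + 1))).map fun x => s.write r x.val
  | .query r a, s =>
      let X := storedSet (P.univSize I) s.mem (s.mem a)
      PMF.pure
        { mem := Function.update s.mem r (P.oracle I X)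
          steps := s.steps + (1 + P.univSize I)
          queries := X :: s.queries }

/-- The initial configuration of a counting algorithm: cells `0, 1, 2, 3` hold `n`, `k`, `M` and
`⌈log₂ (1/δ)⌉`, and all others hold `0`.  Apart from `n` and `k` the algorithm learns about the
instance only through its queries. -/
def countStart (P : WitnessProblem) (I : P.Inst) (M : ℕ) (δ : ℝ) :
    Config (Finset (Fin (P.univSize I))) where
  mem a :=
    if a = 0 then P.univSize I
    else if a = 1 then P.param I
    else if a = 2 then M
    else if a = 3 then ⌈Real.logb 2 (1 / δ)⌉₊
    else 0
  steps := 0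
  queries := []

/-- The output of a counting algorithm: `none` stands for "More than `M`". -/
def Config.output {L : Type} (s : Config L) : Option ℕ :=
  if s.mem 0 = 0 then none else some (s.mem 1)

/-- The expected total running time, when the final configuration has distribution `μ` and a query
`X` is answered by a procedure that takes `time X` steps. -/
def expectedTime {L : Type} (μ : PMF (Config L)) (time : L → ℕ) : ℝ≥0∞ :=
  ∑' s, μ s * ((s.steps + (s.queries.map time).sum : ℕ) : ℝ≥0∞)

end WitnessCounting

end

open scoped ENNReal

noncomputable section

namespace WitnessCounting

/-! ### Running programs -/

section Exec

variable {E L : Type} {h : E → Config L → PMF (Config L)}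

/-! Give every element of the universe a random label below `2 ^ L`, where `4 * n ^ 2 ≤ 2 ^ L`, and
cut the label range into dyadic blocks. A candidate at level `j` is a sorted `k`-tuple of blocks of
width `2 ^ j`, repetitions allowed. It is good if the elements with labels in its blocks contain a
witness, which one oracle call decides. The search starts with `k` copies of the whole range; a good
tuple is replaced by the `2 ^ k` tuples obtained by halving all its blocks, and every other tuple is
dropped. For distinct labels, the increasing list of labels of a witness lies in exactly one tuple
of each level, and that tuple is good, so no witness is lost. At width one a good tuple covers `k`
labels by `k` values, hence is the label list of exactly one witness. A completed search with
distinct labels therefore counts exactly (`leafCount_eq`, `leafCount_root`).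

The cost depends on the number of good tuples per level. Among `B = 2 ^ (L - j)` blocks, a tuple
with `d` different blocks covers a given witness with probability `(d / B) ^ k`. At most `B.choose d
* 2 ^ k` sorted tuples have `d` different blocks, and `d ^ k * B.choose d ≤ 4 ^ k * B ^ k`. Summing
over `d`, the expected number of good tuples on any level is at most `16 ^ k` times the number of
witnesses (`sum_goodCount_le`). Each good tuple pays for one splitting tree with fewer than `2 ^ (k
+ 1)` nodes (`treeSize_le`). If there are at most `M` witnesses, then by Markov's inequality the
search exceeds `budget` with probability at most `1/4` (`card_treeSize_gt`), and labels collide with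
probability at most `1/4` (`card_not_injective_le`). So a run fails with probability at most `1/2`,
and all of `⌈log₂ (1/δ)⌉` independent runs fail with probability at most `δ`.

A run reports a result only if its search ended and its labels are distinct, so a reported number is
always right; comparing it with `M` makes "More than `M`" certain when it has to be. The budget
bounds queries and time for every random choice, not only on average.

The rest verifies a concrete program. The labels of all runs are drawn in one loop, so that
everything else is deterministic and is treated by weakest preconditions. -/

theorem bind_congr_support {α β : Type} (μ : PMF α) {f g : α → PMF β}
    (hfg : ∀ a ∈ μ.support, f a = g a) : μ.bind f = μ.bind g := by
  ext b
  simp only [PMF.bind_apply]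
  refine tsum_congr fun a => ?_
  by_cases ha : μ a = 0
  · simp [ha]
  · rw [hfg a ((PMF.mem_support_iff _ _).2 ha)]

/-- More fuel only affects runs that would exhaust it; if there are none, the distribution is
already final. -/
theorem exec_succ (fuel : ℕ) (p : Prog E) (s : Config L)
    (hn : none ∉ (exec h fuel p s).support) : exec h (fuel + 1) p s = exec h fuel p s := by
  induction fuel generalizing p s with
  | zero => simp [exec] at hn
  | succ f ih =>
    -- Both `seq` and a further round of `loop` reduce to this composition.
    have key : ∀ (p q : Prog E) (s : Config L),
        none ∉ ((exec h f p s).bind fun o => o.elim (PMF.pure none) (exec h f q)).support →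
        ((exec h (f + 1) p s).bind fun o => o.elim (PMF.pure none) (exec h (f + 1) q)) =
          (exec h f p s).bind fun o => o.elim (PMF.pure none) (exec h f q) := by
      intro p q s hn
      simp only [PMF.mem_support_bind_iff, not_exists, not_and] at hn
      rw [ih p s fun h0 => hn none h0 (by simp)]
      refine bind_congr_support _ fun o ho => ?_
      cases o with
      | none => rfl
      | some s' => exact ih q s' (hn (some s') ho)
    cases p with
    | seq p q => exact key p q s hn
    | cond r p q =>
      simp only [exec] at hn ⊢
      split_ifs with hr
      · rw [if_pos hr] at hn; exact ih _ _ hn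
      · rw [if_neg hr] at hn; exact ih _ _ hn
    | loop r p =>
      rw [exec] at hn ⊢
      rw [exec]
      split_ifs with hr
      · rw [if_pos hr] at hn; exact key _ _ _ hn
      · rfl
    | _ => rfl

theorem exec_mono {f f' : ℕ} (hf : f ≤ f') {p : Prog E} {s : Config L} {μ : PMF (Config L)}
    (he : exec h f p s = μ.map some) : exec h f' p s = μ.map some := by
  induction f', hf using Nat.le_induction with
  | base => exact he
  | succ n _ ih =>
    rw [exec_succ, ih]
    rw [ih]
    simp

/-- Sequential composition, when the outcome of the first program depends on a random element of
a finite type. -/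
theorem HasOutcome.bind {G : Type} [Finite G] {ρ : PMF G} {F : G → Config L}
    {ν : G → PMF (Config L)} {p q : Prog E} {s : Config L} (hp : HasOutcome h p s (ρ.map F))
    (hq : ∀ g, HasOutcome h q (F g) (ν g)) :
    ∃ f, (exec h f p s).bind (fun o => o.elim (PMF.pure none) (exec h f q)) =
      (ρ.bind ν).map some := by
  cases nonempty_fintype G
  obtain ⟨f₀, hf₀⟩ := hp
  choose f hf using hq
  -- Finiteness of `G` provides one fuel that suffices for every outcome of the first program.
  refine ⟨max f₀ (Finset.univ.sup f), ?_⟩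
  rw [exec_mono (le_max_left _ _) hf₀, PMF.map_comp, PMF.bind_map, PMF.map_bind]
  congr 1
  funext g
  exact exec_mono ((Finset.le_sup (f := f) (Finset.mem_univ g)).trans (le_max_right _ _)) (hf g)

theorem HasOutcome.seq {G : Type} [Finite G] {ρ : PMF G} {F : G → Config L}
    {ν : G → PMF (Config L)} {p q : Prog E} {s : Config L} (hp : HasOutcome h p s (ρ.map F))
    (hq : ∀ g, HasOutcome h q (F g) (ν g)) : HasOutcome h (.seq p q) s (ρ.bind ν) := by
  obtain ⟨f, hf⟩ := HasOutcome.bind hp hq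
  exact ⟨f + 1, hf⟩

theorem HasOutcome.loop {G : Type} [Finite G] {ρ : PMF G} {F : G → Config L}
    {ν : G → PMF (Config L)} {p : Prog E} {r : ℕ} {s : Config L} (hr : s.mem r ≠ 0)
    (hp : HasOutcome h p s.tick (ρ.map F))
    (hq : ∀ g, HasOutcome h (.loop r p) (F g) (ν g)) : HasOutcome h (.loop r p) s (ρ.bind ν) := by
  obtain ⟨f, hf⟩ := HasOutcome.bind hp hq
  exact ⟨f + 1, by rw [exec, if_pos hr]; exact hf⟩

theorem HasOutcome.loop_done {p : Prog E} {r : ℕ} {s : Config L} (hr : s.mem r = 0) :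
    HasOutcome h (.loop r p) s (PMF.pure s.tick) :=
  ⟨1, by rw [exec, if_neg (not_not.2 hr), PMF.pure_map]⟩

theorem HasOutcome.cond_pos {p q : Prog E} {r : ℕ} {s : Config L} {μ : PMF (Config L)}
    (hr : s.mem r ≠ 0) (hp : HasOutcome h p s.tick μ) : HasOutcome h (.cond r p q) s μ := by
  obtain ⟨f, hf⟩ := hp
  exact ⟨f + 1, by rw [exec, if_pos hr]; exact hf⟩

theorem HasOutcome.cond_neg {p q : Prog E} {r : ℕ} {s : Config L} {μ : PMF (Config L)}
    (hr : s.mem r = 0) (hq : HasOutcome h q s.tick μ) : HasOutcome h (.cond r p q) s μ := by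
  obtain ⟨f, hf⟩ := hq
  exact ⟨f + 1, by rw [exec, if_neg (not_not.2 hr)]; exact hf⟩

theorem pure_eq_map_unit (s : Config L) :
    (PMF.pure s : PMF (Config L)) = (PMF.pure ()).map fun _ => s := by
  rw [PMF.pure_map]

theorem HasOutcome.seq_pure {p q : Prog E} {s s' : Config L} {μ : PMF (Config L)}
    (hp : HasOutcome h p s (PMF.pure s')) (hq : HasOutcome h q s' μ) :
    HasOutcome h (.seq p q) s μ := by
  rw [pure_eq_map_unit] at hp
  have := HasOutcome.seq (ν := fun _ => μ) hp fun _ => hq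
  rwa [PMF.pure_bind] at this

theorem HasOutcome.loop_pure {p : Prog E} {r : ℕ} {s s' : Config L} {μ : PMF (Config L)}
    (hr : s.mem r ≠ 0) (hp : HasOutcome h p s.tick (PMF.pure s'))
    (hq : HasOutcome h (.loop r p) s' μ) : HasOutcome h (.loop r p) s μ := by
  rw [pure_eq_map_unit] at hp
  have := HasOutcome.loop (ν := fun _ => μ) hr hp fun _ => hq
  rwa [PMF.pure_bind] at this

/-- Every program whose additional instructions take time takes time. -/
theorem exec_steps_lt (hh : ∀ e s, ∀ s' ∈ (h e s).support, s.steps < s'.steps)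
    (f : ℕ) (p : Prog E) (s s' : Config L) (hs : some s' ∈ (exec h f p s).support) :
    s.steps < s'.steps := by
  induction f generalizing p s s' with
  | zero => simp [exec] at hs
  | succ f ih =>
    have key : ∀ (p q : Prog E) (s s' : Config L),
        some s' ∈ ((exec h f p s).bind fun o => o.elim (PMF.pure none) (exec h f q)).support →
        s.steps < s'.steps := by
      intro p q s s' hs
      simp only [PMF.mem_support_bind_iff] at hs
      obtain ⟨o, ho, hs⟩ := hs
      cases o with
      | none => simp at hs
      | some t => exact (ih _ _ _ ho).trans (ih _ _ _ hs)
    have tick : s.steps < s.tick.steps := Nat.lt_succ_self _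
    cases p with
    | seq p q => exact key p q s s' hs
    | cond r p q =>
      rw [exec] at hs
      split_ifs at hs <;> exact tick.trans (ih _ _ _ hs)
    | loop r p =>
      rw [exec] at hs
      split_ifs at hs
      · exact tick.trans (key _ _ _ _ hs)
      · simp at hs; rw [hs]; exact tick
    | ext e =>
      rw [exec] at hs
      simp only [PMF.support_map, Set.mem_image, Option.some.injEq, exists_eq_right] at hs
      exact hh _ _ _ hs
    | _ =>
      simp [exec] at hs
      rw [hs]
      exact Nat.lt_succ_self _

/-- Forces `g k ≥ 1` in the final estimate, so that the steps of the counting program itself, which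
carry no factor `g`, are absorbed. -/
theorem Decides.time_pos {P : WitnessProblem} {D : Prog ReadOp}
    {time : (I : P.Inst) → Finset (Fin (P.univSize I)) → ℕ} (hD : Decides P D time)
    (I : P.Inst) (X : Finset (Fin (P.univSize I))) : 0 < time I X := by
  obtain ⟨s, ⟨f, hf⟩, -, hs⟩ := hD I X
  rw [← hs]
  have := exec_steps_lt (h := readStep (P.code I)) (f := f) (p := D) (s := decisionStart P I X)
    (s' := s) (fun e s s' hs' => ?_) (by rw [hf]; simp)
  · exact this
  · cases e
    simp [readStep] at hs'
    rw [hs']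
    exact Nat.lt_succ_self _

end Exec

/-! ### Weakest preconditions of programs without random choices -/

section WP

variable {P : WitnessProblem} {I : P.Inst}

/-- The program halts without random choices in a configuration satisfying `Q`. -/
def WP (P : WitnessProblem) (I : P.Inst) (p : Prog OracleOp)
    (Q : Config (Finset (Fin (P.univSize I))) → Prop)
    (s : Config (Finset (Fin (P.univSize I)))) : Prop :=
  ∃ s', HasOutcome (oracleStep P I) p s (PMF.pure s') ∧ Q s'

variable {Q : Config (Finset (Fin (P.univSize I))) → Prop}
  {s : Config (Finset (Fin (P.univSize I)))} {p q : Prog OracleOp} {r a b c : ℕ}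
  {m : ℕ → ℕ} {t : ℕ} {l : List (Finset (Fin (P.univSize I)))}

/-- Give a name to the current memory. -/
theorem WP.rename (hp : ∀ m', (∀ c, m' c = m c) → WP P I p Q ⟨m', t, l⟩) : WP P I p Q ⟨m, t, l⟩ :=
  hp m fun _ => rfl

theorem WP.const (hQ : Q ⟨Function.update m r c, t + 1, l⟩) : WP P I (.const r c) Q ⟨m, t, l⟩ :=
  ⟨_, ⟨1, by rw [PMF.pure_map]; rfl⟩, hQ⟩

/-- The new value is passed on as a variable with an equation, not as a term: memories after many
instructions stay small and the equations become hypotheses. -/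
theorem WP.add (hQ : ∀ v, v = m a + m b → Q ⟨Function.update m r v, t + 1, l⟩) :
    WP P I (.add r a b) Q ⟨m, t, l⟩ :=
  ⟨_, ⟨1, by rw [PMF.pure_map]; rfl⟩, hQ _ rfl⟩

theorem WP.sub (hQ : ∀ v, v = m a - m b → Q ⟨Function.update m r v, t + 1, l⟩) :
    WP P I (.sub r a b) Q ⟨m, t, l⟩ :=
  ⟨_, ⟨1, by rw [PMF.pure_map]; rfl⟩, hQ _ rfl⟩

theorem WP.load (hQ : ∀ d v, d = m a → v = m d → Q ⟨Function.update m r v, t + 1, l⟩) :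
    WP P I (.load r a) Q ⟨m, t, l⟩ :=
  ⟨_, ⟨1, by rw [PMF.pure_map]; rfl⟩, hQ _ _ rfl rfl⟩

theorem WP.store (hQ : ∀ d v, d = m a → v = m b → Q ⟨Function.update m d v, t + 1, l⟩) :
    WP P I (.store a b) Q ⟨m, t, l⟩ :=
  ⟨_, ⟨1, by rw [PMF.pure_map]; rfl⟩, hQ _ _ rfl rfl⟩

theorem WP.query (hQ : ∀ v X, X = storedSet (P.univSize I) m (m a) → v = P.oracle I X →
      Q ⟨Function.update m r v, t + (1 + P.univSize I), X :: l⟩) :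
    WP P I (.ext (.query r a)) Q ⟨m, t, l⟩ :=
  ⟨_, ⟨1, by simp only [exec, oracleStep]⟩, hQ _ _ rfl rfl⟩

theorem WP.seq (hp : WP P I p (WP P I q Q) s) : WP P I (.seq p q) Q s :=
  let ⟨_, h₁, s₂, h₂, hQ⟩ := hp
  ⟨s₂, h₁.seq_pure h₂, hQ⟩

theorem WP.cond (hp : m r ≠ 0 → WP P I p Q ⟨m, t + 1, l⟩)
    (hq : m r = 0 → WP P I q Q ⟨m, t + 1, l⟩) : WP P I (.cond r p q) Q ⟨m, t, l⟩ := by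
  by_cases hr : m r = 0
  · obtain ⟨s', h, hQ⟩ := hq hr
    exact ⟨s', h.cond_neg hr, hQ⟩
  · obtain ⟨s', h, hQ⟩ := hp hr
    exact ⟨s', h.cond_pos hr, hQ⟩

/-- The loop rule: `N` is the number of iterations still to be made at the beginning. -/
theorem WP.loop (Inv : ℕ → Config (Finset (Fin (P.univSize I))) → Prop) (N : ℕ)
    (hr : ∀ i s, Inv i s → i + s.mem r = N)
    (hInv : ∀ i m t l, i < N → Inv i ⟨m, t, l⟩ → WP P I p (Inv (i + 1)) ⟨m, t + 1, l⟩)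
    (h0 : Inv 0 s) (hQ : ∀ m t l, Inv N ⟨m, t, l⟩ → Q ⟨m, t + 1, l⟩) :
    WP P I (.loop r p) Q s := by
  have key : ∀ d i s, i + d = N → Inv i s → WP P I (.loop r p) Q s := by
    intro d
    induction d with
    | zero =>
      intro i s hi hs
      have h := hr i s hs
      obtain rfl : i = N := by omega
      exact ⟨s.tick, HasOutcome.loop_done (by omega), hQ _ _ _ hs⟩
    | succ d ih =>
      intro i s hi hs
      have h := hr i s hs
      obtain ⟨s', h₁, h₂⟩ := hInv i s.mem s.steps s.queries (by omega) hs
      obtain ⟨s'', h₃, h₄⟩ := ih (i + 1) s' (by omega) h₂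
      exact ⟨s'', HasOutcome.loop_pure (by omega) h₁ h₃, h₄⟩
  exact key N 0 s (by omega) h0

/-- The outcome of a program without random choices. -/
theorem WP.exists_outcome (hp : WP P I p Q s) :
    ∃ s', HasOutcome (oracleStep P I) p s (PMF.pure s') ∧ Q s' :=
  hp

attribute [irreducible] WP

end WP

/-! ### The search tree

A node of the search consists of a level `j`, a tuple `a` and a number `i` of coordinates.  It stands
for the box of all tuples `t` for which `t x - a x` lies in `[0, 2 ^ j)` for the first `i` coordinates
and in `[0, 2 ^ (j + 1))` for the others. -/

structure Node (k : ℕ) where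
  i : ℕ
  j : ℕ
  a : Fin k → ℕ

/-- Increase the coordinate with number `i` by `w`. -/
def bump {k : ℕ} (a : Fin k → ℕ) (i w : ℕ) : Fin k → ℕ :=
  fun x => if x.val = i then a x + w else a x

open Classical in
/-- One step of the search, on a stack of nodes and a counter. -/
def searchStep {k : ℕ} (good : ℕ → (Fin k → ℕ) → Prop) :
    List (Node k) × ℕ → List (Node k) × ℕ
  | ([], c) => ([], c)
  | (v :: st, c) =>
    -- Halving a single coordinate costs no query; a tuple is queried only when all `k` coordinates
    -- have been halved. The order is tested there too, because partly halved tuples may be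
    -- unsorted.
    if v.i < k then (⟨v.i + 1, v.j, bump v.a v.i (2 ^ v.j)⟩ :: ⟨v.i + 1, v.j, v.a⟩ :: st, c)
    else if good v.j v.a then if v.j = 0 then (st, c + 1) else (⟨0, v.j - 1, v.a⟩ :: st, c)
    else (st, c)

open Classical in
/-- The number of nodes below a node with `r` coordinates still to be split. -/
def treeSize {k : ℕ} (good : ℕ → (Fin k → ℕ) → Prop) : ℕ → ℕ → (Fin k → ℕ) → ℕ
  -- With `r + 1` coordinates left, the next one to be halved has number `k - (r + 1)`.
  | j, r + 1, a => 1 + treeSize good j r a + treeSize good j r (bump a (k - (r + 1)) (2 ^ j))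
  | 0, 0, _ => 1
  | j + 1, 0, a => if good (j + 1) a then 1 + treeSize good j k a else 1
termination_by j r => (j, r)

open Classical in
/-- The number of good leaves below a node. -/
def leafCount {k : ℕ} (good : ℕ → (Fin k → ℕ) → Prop) : ℕ → ℕ → (Fin k → ℕ) → ℕ
  | j, r + 1, a => leafCount good j r a + leafCount good j r (bump a (k - (r + 1)) (2 ^ j))
  | 0, 0, a => if good 0 a then 1 else 0
  | j + 1, 0, a => if good (j + 1) a then leafCount good j k a else 0
termination_by j r => (j, r)

section Search

variable {k : ℕ} (good : ℕ → (Fin k → ℕ) → Prop)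

def stackSize (st : List (Node k)) : ℕ :=
  (st.map fun v => treeSize good v.j (k - v.i) v.a).sum

def stackCount (st : List (Node k)) : ℕ :=
  (st.map fun v => leafCount good v.j (k - v.i) v.a).sum

/-- `stackSize` is a potential that each step lowers by exactly one, since a popped node accounts
for itself and its children are pushed. The counter plus `stackCount` is invariant. -/
theorem searchStep_spec (v : Node k) (st : List (Node k)) (c : ℕ) :
    stackSize good (searchStep good (v :: st, c)).1 + 1 = stackSize good (v :: st) ∧
    (searchStep good (v :: st, c)).2 + stackCount good (searchStep good (v :: st, c)).1 =
      c + stackCount good (v :: st) := by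
  obtain ⟨i, j, a⟩ := v
  simp only [searchStep]
  split_ifs with h₁ h₂ h₃
  · obtain ⟨r, hr⟩ : ∃ r, k - i = r + 1 := ⟨k - i - 1, by omega⟩
    have hr' : k - (i + 1) = r := by omega
    have hi : k - (r + 1) = i := by omega
    simp only [stackSize, stackCount, List.map_cons, List.sum_cons, hr, hr', treeSize, leafCount, hi]
    omega
  · subst h₃
    have hr : k - i = 0 := by omega
    simp only [stackSize, stackCount, List.map_cons, List.sum_cons, hr, treeSize, leafCount, h₂,
      if_true]
    omega
  · obtain ⟨j, rfl⟩ : ∃ j', j = j' + 1 := ⟨j - 1, by omega⟩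
    have hr : k - i = 0 := by omega
    replace h₂ : good (j + 1) a := h₂
    simp only [stackSize, stackCount, List.map_cons, List.sum_cons, hr, treeSize, leafCount,
      if_pos h₂, Nat.add_sub_cancel, Nat.sub_zero]
    exact ⟨by omega, trivial⟩
  · have hr : k - i = 0 := by omega
    replace h₂ : ¬ good j a := h₂
    cases j with
    | zero =>
      simp only [stackSize, stackCount, List.map_cons, List.sum_cons, hr, treeSize, leafCount,
        if_neg h₂]
      omega
    | succ j =>
      simp only [stackSize, stackCount, List.map_cons, List.sum_cons, hr, treeSize, leafCount,
        if_neg h₂]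
      omega

/-- A step on the empty stack does nothing, so surplus steps are harmless; once the stack is empty,
the invariant reads off the counter. -/
theorem searchStep_iterate (N : ℕ) (st : List (Node k)) (c : ℕ) :
    (stackSize good st ≤ N → ((searchStep good)^[N] (st, c)).1 = []) ∧
    ((searchStep good)^[N] (st, c)).2 + stackCount good ((searchStep good)^[N] (st, c)).1 =
      c + stackCount good st := by
  induction N generalizing st c with
  | zero =>
    refine ⟨fun h => ?_, rfl⟩
    cases st with
    | nil => rfl
    | cons v st =>
      have := (searchStep_spec good v st c).1
      omega
  | succ N ih =>
    rw [Function.iterate_succ_apply]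
    cases st with
    | nil => exact ⟨fun h => (ih [] c).1 (by simp [stackSize]), (ih [] c).2⟩
    | cons v st =>
      have h := searchStep_spec good v st c
      have h' := ih (searchStep good (v :: st, c)).1 (searchStep good (v :: st, c)).2
      exact ⟨fun hN => h'.1 (by omega), by rw [← h.2]; exact h'.2⟩

/-- The box of a node. -/
def InBox (j r : ℕ) (a t : Fin k → ℕ) : Prop :=
  ∀ x, a x ≤ t x ∧ t x < a x + if x.val + r < k then 2 ^ j else 2 ^ (j + 1)

/-- The position of a box is compatible with its size. -/
def Aligned (j r : ℕ) (a : Fin k → ℕ) : Prop :=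
  ∀ x, (if x.val + r < k then 2 ^ j else 2 ^ (j + 1)) ∣ a x

/-- Glues the levels: nothing left to halve at level `j + 1` is the same box as everything left to
halve at level `j`. -/
theorem inBox_succ_level (j : ℕ) (a t : Fin k → ℕ) : InBox (j + 1) 0 a t ↔ InBox j k a t := by
  simp [InBox]

theorem aligned_succ_level (j : ℕ) (a : Fin k → ℕ) : Aligned (j + 1) 0 a ↔ Aligned j k a := by
  simp [Aligned]

theorem inBox_split {j r : ℕ} (hr : r + 1 ≤ k) (a t : Fin k → ℕ) :
    InBox j (r + 1) a t ↔ InBox j r a t ∨ InBox j r (bump a (k - (r + 1)) (2 ^ j)) t := by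
  set y : Fin k := ⟨k - (r + 1), by omega⟩ with hy
  have e : 2 ^ (j + 1) = 2 ^ j + 2 ^ j := by ring
  have hx : ∀ x : Fin k, x ≠ y → x.val ≠ k - (r + 1) := fun x hx h => hx (Fin.ext h)
  constructor
  · intro h
    have hb := h y
    rw [if_neg (by simp only [hy]; omega)] at hb
    by_cases hlt : t y < a y + 2 ^ j
    · left
      intro x
      by_cases hxy : x = y
      · subst hxy
        rw [if_pos (by simp only [hy]; omega)]
        exact ⟨hb.1, hlt⟩
      · have := h x
        have := hx x hxy
        have : (x.val + (r + 1) < k) ↔ (x.val + r < k) := by omega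
        simpa only [this] using h x
    · right
      intro x
      by_cases hxy : x = y
      · subst hxy
        rw [if_pos (by simp only [hy]; omega), bump, if_pos rfl]
        omega
      · have := hx x hxy
        have : (x.val + (r + 1) < k) ↔ (x.val + r < k) := by omega
        rw [bump, if_neg (hx x hxy)]
        simpa only [this] using h x
  · intro h x
    by_cases hxy : x = y
    · subst hxy
      rw [if_neg (by simp only [hy]; omega)]
      rcases h with h | h
      · have := h y
        rw [if_pos (by simp only [hy]; omega)] at this
        omega
      · have := h y
        rw [if_pos (by simp only [hy]; omega), bump, if_pos rfl] at this
        omega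
    · have h1 := hx x hxy
      have h2 : (x.val + (r + 1) < k) ↔ (x.val + r < k) := by omega
      rcases h with h | h
      · simpa only [h2] using h x
      · have := h x
        rw [bump, if_neg h1] at this
        simpa only [h2] using this

theorem inBox_disjoint {j r : ℕ} (hr : r + 1 ≤ k) (a t : Fin k → ℕ) :
    InBox j r a t → ¬ InBox j r (bump a (k - (r + 1)) (2 ^ j)) t := by
  intro h h'
  have h₁ := h ⟨k - (r + 1), by omega⟩
  have h₂ := h' ⟨k - (r + 1), by omega⟩
  rw [if_pos (by simp only; omega)] at h₁ h₂
  rw [bump, if_pos rfl] at h₂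
  omega

theorem Aligned.of_split {j r : ℕ} {a : Fin k → ℕ} (h : Aligned j (r + 1) a) : Aligned j r a := by
  intro x
  have := h x
  by_cases h₁ : x.val + (r + 1) < k
  · rw [if_pos h₁] at this
    rwa [if_pos (by omega)]
  · rw [if_neg h₁] at this
    split_ifs
    · exact (pow_dvd_pow 2 (Nat.le_succ j)).trans this
    · exact this

theorem Aligned.bump {j r : ℕ} {a : Fin k → ℕ} (h : Aligned j (r + 1) a) (hr : r + 1 ≤ k) :
    Aligned j r (bump a (k - (r + 1)) (2 ^ j)) := by
  intro x
  have := h.of_split x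
  rw [WitnessCounting.bump]
  split_ifs at this ⊢ with h₁ h₂ h₂
  · exact dvd_add this dvd_rfl
  · exact this
  · omega
  · exact this

theorem card_filter_inBox_split {α : Type} [DecidableEq α] (S : Finset α) (F : α → Fin k → ℕ)
    {j r : ℕ} (hr : r + 1 ≤ k) (a : Fin k → ℕ) (p : α → Prop) [DecidablePred p]
    [∀ j r a, DecidablePred fun y => InBox j r a (F y)] :
    (S.filter fun y => p y ∧ InBox j (r + 1) a (F y)).card =
      (S.filter fun y => p y ∧ InBox j r a (F y)).card +
      (S.filter fun y => p y ∧ InBox j r (bump a (k - (r + 1)) (2 ^ j)) (F y)).card := by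
  rw [← Finset.card_union_of_disjoint, ← Finset.filter_or]
  · congr 1
    ext y
    simp only [Finset.mem_filter, inBox_split hr]
    tauto
  · rw [Finset.disjoint_filter]
    rintro y - ⟨-, h⟩ ⟨-, h'⟩
    exact inBox_disjoint hr _ _ h h'

open Classical in
/-- The number of good nodes on the level `j'` in a box. -/
def goodCount (L j' j r : ℕ) (a : Fin k → ℕ) : ℕ :=
  ((Fintype.piFinset fun _ : Fin k => Finset.range (2 ^ L)).filter fun y =>
    ((∀ x, 2 ^ j' ∣ y x) ∧ good j' y) ∧ InBox j r a y).card

/-- A splitting tree for `r` coordinates has `2 ^ (r + 1) - 1` nodes, and every good node of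
positive level starts a new one for `k` coordinates. With `+ 1` on the left the bound is additive
under splitting. -/
theorem treeSize_le (L : ℕ) (j r : ℕ) (a : Fin k → ℕ) (hr : r ≤ k) (ha : Aligned j r a)
    (hL : ∀ y, InBox j r a y → ∀ x, y x < 2 ^ L) :
    treeSize good j r a + 1 ≤
      2 ^ (r + 1) + 2 ^ (k + 1) * ∑ j' ∈ Finset.range (j + 1), goodCount good L j' j r a := by
  classical
  fun_induction treeSize good j r a with
  | case1 j r a ih₁ ih₂ =>
    have h₁ := ih₁ (by omega) ha.of_split
      fun y hy => hL y ((inBox_split hr _ _).2 (Or.inl hy))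
    have h₂ := ih₂ (by omega) (ha.bump hr)
      fun y hy => hL y ((inBox_split hr _ _).2 (Or.inr hy))
    have : ∀ j', goodCount good L j' j (r + 1) a = goodCount good L j' j r a +
        goodCount good L j' j r (bump a (k - (r + 1)) (2 ^ j)) := fun j' => by
      exact card_filter_inBox_split _ (fun y => y) hr a _
    simp only [this, Finset.sum_add_distrib]
    rw [pow_succ 2 (r + 1)]
    linarith
  | case2 a => simp
  | case3 j a hg ih =>
    have h := ih le_rfl ((aligned_succ_level _ _).1 ha)
      fun y hy => hL y ((inBox_succ_level _ _ _).2 hy)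
    rw [Finset.sum_range_succ, mul_add]
    have e : ∀ j', goodCount good L j' (j + 1) 0 a = goodCount good L j' j k a := fun j' => by
      simp only [goodCount, inBox_succ_level]
    -- The node itself is good on its level, and this pays for the splitting tree below it.
    have h1 : 1 ≤ goodCount good L (j + 1) (j + 1) 0 a := by
      refine Finset.card_pos.2 ⟨a, ?_⟩
      have hb : InBox (j + 1) 0 a a := fun x => ⟨le_rfl, by split_ifs <;> simp⟩
      simp only [Finset.mem_filter, Fintype.mem_piFinset, Finset.mem_range]
      refine ⟨hL a hb, ⟨fun x => ?_, hg⟩, hb⟩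
      simpa using ha x
    have h2 := Nat.mul_le_mul_left (2 ^ (k + 1)) h1
    simp only [← e] at h
    simp only [Nat.succ_eq_add_one]
    omega
  | case4 j a hg =>
    omega

end Search

/-! ### Correctness of the search -/

section Correct

variable {n k : ℕ}

/-- The block tuple `a` of width `2 ^ j` is sorted, and some witness is covered by its blocks. -/
def Good (Wit : Finset (Finset (Fin n))) (f : Fin n → ℕ) (j : ℕ) (a : Fin k → ℕ) : Prop :=
  Monotone a ∧ ∃ W ∈ Wit, ∀ u ∈ W, ∃ x, a x ≤ f u ∧ f u < a x + 2 ^ j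

/-- The labels of the elements of `W` in increasing order. -/
def sortedLabels (k : ℕ) (f : Fin n → ℕ) (W : Finset (Fin n)) (x : Fin k) : ℕ :=
  -- The default value is never used for a witness with distinct labels.
  if h : (W.image f).card = k then (W.image f).orderEmbOfFin h x else 0

/-- Pruning is safe because a box that contains the sorted labels of a witness is good, and the two
halves of a box are disjoint. The conjunct `True` gives the filter the shape of
`card_filter_inBox_split`. -/
theorem leafCount_eq {Wit : Finset (Finset (Fin n))} (hWit : ∀ W ∈ Wit, W.card = k)
    {f : Fin n → ℕ} (hf : Function.Injective f) (j r : ℕ) (a : Fin k → ℕ) (hr : r ≤ k)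
    (ha : Aligned j r a) [∀ j r a, DecidablePred fun y => InBox j r a (sortedLabels k f y)] :
    leafCount (Good Wit f) j r a =
      (Wit.filter fun W => True ∧ InBox j r a (sortedLabels k f W)).card := by
  have hcard : ∀ W ∈ Wit, (W.image f).card = k := fun W hW => by
    rw [Finset.card_image_of_injective _ hf, hWit W hW]
  have hmono : ∀ W ∈ Wit, StrictMono (sortedLabels k f W) := fun W hW x y hxy => by
    simp only [sortedLabels, dif_pos (hcard W hW)]
    exact ((W.image f).orderEmbOfFin _).strictMono hxy
  have hrange : ∀ W ∈ Wit, Set.range (sortedLabels k f W) = W.image f := fun W hW => by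
    have : sortedLabels k f W = (W.image f).orderEmbOfFin (hcard W hW) := by
      funext x
      simp only [sortedLabels, dif_pos (hcard W hW)]
    rw [this, Finset.range_orderEmbOfFin]
  have hgood : ∀ j (a : Fin k → ℕ), Aligned j 0 a → ∀ W ∈ Wit,
      InBox j 0 a (sortedLabels k f W) → Good Wit f j a := by
    intro j a ha W hW hb
    simp only [InBox, Aligned, add_zero, Fin.is_lt, if_true] at hb ha
    constructor
    · intro x y hxy
      have h₁ := hb x
      have h₂ := hb y
      have h₃ := (hmono W hW).monotone hxy
      obtain ⟨p, hp⟩ := ha x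
      obtain ⟨q, hq⟩ := ha y
      -- Both starting points are multiples of `2 ^ j`, so comparing the block numbers `p` and `q`
      -- is enough.
      have : 2 ^ j * p < 2 ^ j * (q + 1) := by rw [mul_add, ← hp, ← hq]; omega
      have := Nat.lt_of_mul_lt_mul_left this
      rw [hp, hq]
      exact Nat.mul_le_mul_left _ (by omega)
    · refine ⟨W, hW, fun u hu => ?_⟩
      have : f u ∈ Set.range (sortedLabels k f W) := by
        rw [hrange W hW]
        exact Finset.mem_image_of_mem f hu
      obtain ⟨x, hx⟩ := this
      exact ⟨x, hx ▸ hb x⟩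
  classical
  fun_induction leafCount (Good Wit f) j r a with
  | case1 j r a ih₁ ih₂ =>
    rw [ih₁ (by omega) ha.of_split, ih₂ (by omega) (ha.bump hr)]
    exact (card_filter_inBox_split _ _ hr a _).symm
  | case2 a hg =>
    symm
    rw [Finset.card_eq_one]
    obtain ⟨hm, W, hW, hcov⟩ := id hg
    -- Covering `k` labels by at most `k` values leaves no room: the values of `a` are exactly the
    -- labels of `W`, and being sorted `a` lists them in order.
    have hsub : W.image f ⊆ Finset.univ.image a := by
      intro v hv
      obtain ⟨u, hu, rfl⟩ := Finset.mem_image.1 hv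
      obtain ⟨x, hx⟩ := hcov u hu
      exact Finset.mem_image.2 ⟨x, Finset.mem_univ _, by omega⟩
    have hle : (Finset.univ.image a).card ≤ k := by
      simpa using Finset.card_image_le (s := (Finset.univ : Finset (Fin k))) (f := a)
    have heq : W.image f = Finset.univ.image a :=
      Finset.eq_of_subset_of_card_le hsub (by rw [hcard W hW]; exact hle)
    have hinj : Function.Injective a := by
      rw [← Set.injOn_univ, ← Finset.coe_univ, ← Finset.card_image_iff, ← heq, hcard W hW]
      simp
    have hlab : sortedLabels k f W = a := by
      have := Finset.orderEmbOfFin_unique (hcard W hW) (f := a)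
        (fun x => heq ▸ Finset.mem_image_of_mem a (Finset.mem_univ x))
        (hm.strictMono_of_injective hinj)
      funext x
      simp only [sortedLabels, dif_pos (hcard W hW), this]
    refine ⟨W, ?_⟩
    ext W'
    simp only [Finset.mem_filter, true_and, Finset.mem_singleton]
    constructor
    · rintro ⟨hW', hb⟩
      have : sortedLabels k f W' = a := by
        funext x
        have := hb x
        simp only [add_zero, Fin.is_lt, if_true, pow_zero] at this
        omega
      have hi : ((W'.image f : Finset ℕ) : Set ℕ) = (W.image f : Finset ℕ) := by
        rw [← hrange W' hW', ← hrange W hW, this, hlab]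
      exact Finset.image_injective hf (Finset.coe_injective hi)
    · rintro rfl
      exact ⟨hW, hlab ▸ fun x => ⟨le_rfl, by split_ifs <;> simp⟩⟩
  | case3 a hg =>
    symm
    rw [Finset.card_eq_zero, Finset.filter_eq_empty_iff]
    rintro W hW ⟨-, hb⟩
    exact hg (hgood 0 a ha W hW hb)
  | case4 j a hg ih =>
    rw [ih le_rfl ((aligned_succ_level _ _).1 ha)]
    simp only [inBox_succ_level]
  | case5 j a hg =>
    symm
    rw [Finset.card_eq_zero, Finset.filter_eq_empty_iff]
    rintro W hW ⟨-, hb⟩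
    exact hg (hgood _ a ha W hW hb)

theorem leafCount_root {Wit : Finset (Finset (Fin n))} (hWit : ∀ W ∈ Wit, W.card = k)
    {L : ℕ} {f : Fin n → ℕ} (hf : Function.Injective f) (hL : ∀ u, f u < 2 ^ L) :
    leafCount (k := k) (Good Wit f) L 0 0 = Wit.card := by
  classical
  rw [leafCount_eq hWit hf L 0 0 (Nat.zero_le _) (fun x => by simp), Finset.filter_true_of_mem]
  refine fun W hW => ⟨trivial, fun x => ?_⟩
  simp only [Pi.zero_apply, Nat.zero_le, add_zero, Fin.is_lt, if_true, zero_add, true_and]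
  have hc : (W.image f).card = k := by rw [Finset.card_image_of_injective _ hf, hWit W hW]
  rw [sortedLabels, dif_pos hc]
  obtain ⟨u, -, hu⟩ := Finset.mem_image.1 (Finset.orderEmbOfFin_mem _ hc x)
  rw [← hu]
  exact hL u

end Correct

/-! ### The expected size of the search tree -/

/-- `d ^ d / d!` is one term of the series of `exp d`, and `exp 1 < 4`. -/
theorem pow_self_le (d : ℕ) : d ^ d ≤ 4 ^ d * d.factorial := by
  have h := Real.pow_div_factorial_le_exp (d : ℝ) (Nat.cast_nonneg d) d
  have h2 : Real.exp d ≤ 4 ^ d := by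
    rw [← mul_one (d : ℝ), Real.exp_nat_mul]
    have := Real.exp_one_lt_d9
    exact pow_le_pow_left₀ (Real.exp_pos 1).le (by linarith) d
  have hf : (0 : ℝ) < d.factorial := by exact_mod_cast Nat.factorial_pos d
  rw [div_le_iff₀ hf] at h
  have : (d : ℝ) ^ d ≤ 4 ^ d * d.factorial := h.trans (mul_le_mul_of_nonneg_right h2 hf.le)
  exact_mod_cast this

/-- After division by `B ^ k`: over all choices of `d` blocks, the probabilities `(d / B) ^ k` of
catching a fixed witness add up to at most `4 ^ k`. The factorial from `pow_self_le` turns the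
binomial coefficient into a falling factorial, which is at most `B ^ d`. -/
theorem pow_mul_choose_le {d k B : ℕ} (hdk : d ≤ k) (hdB : d ≤ B) :
    d ^ k * B.choose d ≤ 4 ^ k * B ^ k := by
  calc d ^ k * B.choose d = d ^ (k - d) * (d ^ d * B.choose d) := by
        rw [← mul_assoc, ← pow_add, Nat.sub_add_cancel hdk]
    _ ≤ B ^ (k - d) * (4 ^ d * d.factorial * B.choose d) := by
        gcongr
        exact pow_self_le d
    _ = B ^ (k - d) * (4 ^ d * B.descFactorial d) := by
        rw [Nat.descFactorial_eq_factorial_mul_choose, mul_assoc]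
    _ ≤ B ^ (k - d) * (4 ^ k * B ^ d) := by
        gcongr
        · norm_num
        · exact Nat.descFactorial_le_pow B d
    _ = 4 ^ k * B ^ k := by
        rw [mul_left_comm, ← pow_add, Nat.sub_add_cancel hdk]

/-- A monotone tuple is determined by its range and the positions of its first occurrences. -/
theorem monotone_eq_of_range_of_records {k B : ℕ} {b b' : Fin k → Fin B} (hb : Monotone b)
    (hb' : Monotone b') (hr : Finset.univ.image b = Finset.univ.image b')
    (hs : (Finset.univ.filter fun i => ∀ i' < i, b i' < b i) =
      Finset.univ.filter fun i => ∀ i' < i, b' i' < b' i) : b = b' := by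
  have key : ∀ (b b' : Fin k → Fin B), Monotone b → Monotone b' →
      Finset.univ.image b = Finset.univ.image b' →
      (Finset.univ.filter fun i => ∀ i' < i, b i' < b i) =
        (Finset.univ.filter fun i => ∀ i' < i, b' i' < b' i) →
      ∀ i, (∀ i' < i, b i' = b' i') → b' i ≤ b i := by
    intro b b' hb hb' hr hs i hi
    have hiff : (∀ i' < i, b i' < b i) ↔ ∀ i' < i, b' i' < b' i := by
      have := congrArg (i ∈ ·) hs
      simpa using this
    -- At a first occurrence, `b'` also takes the value `b i`, and not before `i`. Elsewhere `b'`
    -- repeats an earlier value, which it shares with `b`.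
    by_cases hrec : ∀ i' < i, b i' < b i
    · have : b i ∈ Finset.univ.image b' := hr ▸ Finset.mem_image_of_mem b (Finset.mem_univ i)
      obtain ⟨x, -, hx⟩ := Finset.mem_image.1 this
      rw [← hx]
      refine hb' (not_lt.1 fun hlt => ?_)
      have := hrec x hlt
      rw [hi x hlt, hx] at this
      exact lt_irrefl _ this
    · have hrec' : ¬ ∀ i' < i, b' i' < b' i := fun h => hrec (hiff.2 h)
      push Not at hrec'
      obtain ⟨x, hx, hle⟩ := hrec'
      rw [← hi x hx] at hle
      exact hle.trans (hb hx.le)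
  have main : ∀ i, b i = b' i := by
    intro i
    induction i using WellFoundedLT.induction with
    | _ i ih =>
      exact le_antisymm (key b' b hb' hb hr.symm hs.symm i fun i' hi' => (ih i' hi').symm)
        (key b b' hb hb' hr hs i ih)
  exact funext main

/-- The range is one of `B.choose d` sets, and the set of first occurrences one of `2 ^ k`; together
they determine the tuple. -/
theorem card_monotone_le (k B d : ℕ) [∀ b : Fin k → Fin B, Decidable (Monotone b)] :
    (Finset.univ.filter fun b : Fin k → Fin B =>
      Monotone b ∧ (Finset.univ.image b).card = d).card ≤ B.choose d * 2 ^ k := by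
  have : B.choose d * 2 ^ k = (((Finset.univ : Finset (Fin B)).powersetCard d) ×ˢ
      (Finset.univ : Finset (Finset (Fin k)))).card := by simp
  rw [this]
  refine Finset.card_le_card_of_injOn (fun b => (Finset.univ.image b,
    Finset.univ.filter fun i => ∀ i' < i, b i' < b i)) ?_ ?_
  · intro b hb
    simp only [Finset.coe_filter, Finset.mem_univ, true_and, Set.mem_ofPred_eq] at hb
    simp [Finset.mem_powersetCard, hb.2]
  · intro b hb b' hb' h
    simp only [Finset.coe_filter, Finset.mem_univ, true_and, Set.mem_ofPred_eq] at hb hb'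
    rw [Prod.mk.injEq] at h
    exact monotone_eq_of_range_of_records hb.1 hb'.1 h.1 h.2

/-- Group the tuples by the number `d` of their distinct values. Each `d` contributes at most `2 ^ k
* 4 ^ k * B ^ k`, and there are `k + 1 ≤ 2 ^ k` possible `d`. -/
theorem sum_card_range_pow_le (k B : ℕ) [∀ b : Fin k → Fin B, Decidable (Monotone b)] :
    ∑ b : Fin k → Fin B with Monotone b, (Finset.univ.image b).card ^ k ≤ 16 ^ k * B ^ k := by
  have hmaps : ∀ b ∈ Finset.univ.filter (fun b : Fin k → Fin B => Monotone b),
      (Finset.univ.image b).card ∈ Finset.range (k + 1) := by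
    intro b _
    have : (Finset.univ.image b).card ≤ (Finset.univ : Finset (Fin k)).card :=
      Finset.card_image_le
    simp at this ⊢
    omega
  rw [← Finset.sum_fiberwise_of_maps_to hmaps]
  calc _ ≤ ∑ d ∈ Finset.range (k + 1), 8 ^ k * B ^ k := by
        refine Finset.sum_le_sum fun d hd => ?_
        rw [Finset.filter_filter]
        have : ∀ b ∈ Finset.univ.filter (fun b : Fin k → Fin B =>
            Monotone b ∧ (Finset.univ.image b).card = d), (Finset.univ.image b).card ^ k = d ^ k := by
          intro b hb
          rw [(Finset.mem_filter.1 hb).2.2]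
        rw [Finset.sum_congr rfl this, Finset.sum_const, smul_eq_mul]
        by_cases hdB : d ≤ B
        · calc _ ≤ B.choose d * 2 ^ k * d ^ k :=
                Nat.mul_le_mul_right _ (card_monotone_le k B d)
            _ = 2 ^ k * (d ^ k * B.choose d) := by ring
            _ ≤ 2 ^ k * (4 ^ k * B ^ k) := Nat.mul_le_mul_left _
                (pow_mul_choose_le (by simpa [Nat.lt_succ_iff] using hd) hdB)
            _ = 8 ^ k * B ^ k := by
                rw [← mul_assoc, ← mul_pow]; norm_num
        · have h0 := card_monotone_le k B d
          rw [Nat.choose_eq_zero_of_lt (not_le.1 hdB), zero_mul, Nat.le_zero] at h0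
          rw [h0, zero_mul]
          exact Nat.zero_le _
    _ = (k + 1) * 8 ^ k * B ^ k := by rw [Finset.sum_const, Finset.card_range, smul_eq_mul, mul_assoc]
    _ ≤ 2 ^ k * 8 ^ k * B ^ k := by
        gcongr
        exact Nat.lt_two_pow_self
    _ = 16 ^ k * B ^ k := by rw [← mul_pow]; norm_num

theorem card_filter_div_mem_le {w B : ℕ} (S : Finset (Fin B)) (hw : 0 < w) (N : ℕ)
    [DecidablePred fun v : Fin N => ∃ x ∈ S, v.val / w = x.val] :
    (Finset.univ.filter fun v : Fin N => ∃ x ∈ S, v.val / w = x.val).card ≤ S.card * w := by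
  have : S.card * w = ((S.image Fin.val) ×ˢ Finset.range w).card := by
    rw [Finset.card_product, Finset.card_image_of_injective _ Fin.val_injective, Finset.card_range]
  rw [this]
  refine Finset.card_le_card_of_injOn (fun v => (v.val / w, v.val % w)) ?_ ?_
  · intro v hv
    simp only [Finset.coe_filter, Finset.mem_univ, true_and, Set.mem_ofPred_eq] at hv
    obtain ⟨x, hx, e⟩ := hv
    simp only [Finset.coe_product, Set.mem_prod, Finset.mem_coe, Finset.mem_image,
      Finset.mem_range]
    exact ⟨⟨x, hx, e.symm⟩, Nat.mod_lt _ hw⟩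
  · intro v _ v' _ h
    rw [Prod.mk.injEq] at h
    refine Fin.ext ?_
    rw [← Nat.div_add_mod v.val w, ← Nat.div_add_mod v'.val w, h.1, h.2]

/-! ### Averages over all labelings -/

variable {n k : ℕ}

open Classical in
-- Pass from starting points to block numbers, which loses nothing because the starting points are
-- multiples of `2 ^ j`; then apply the union bound over the witnesses.
theorem goodCount_le (Wit : Finset (Finset (Fin n))) {L j : ℕ} (hj : j ≤ L)
    (f : Fin n → Fin (2 ^ L)) :
    goodCount (k := k) (Good Wit fun u => (f u).val) L j L 0 0 ≤
      ∑ b : Fin k → Fin (2 ^ (L - j)) with Monotone b,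
        ∑ W ∈ Wit, if ∀ u ∈ W, ∃ x ∈ Finset.univ.image b, (f u).val / 2 ^ j = x.val then 1 else 0 := by
  have hpow : 2 ^ (L - j) * 2 ^ j = 2 ^ L := by rw [← pow_add, Nat.sub_add_cancel hj]
  have hpos : 0 < 2 ^ j := by positivity
  have hpos' : 0 < 2 ^ (L - j) := by positivity
  calc _ ≤ (Finset.univ.filter fun b : Fin k → Fin (2 ^ (L - j)) => Monotone b ∧
        ∃ W ∈ Wit, ∀ u ∈ W, ∃ x ∈ Finset.univ.image b, (f u).val / 2 ^ j = x.val).card := by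
        have hlt : ∀ y ∈ Finset.range (2 ^ L), y / 2 ^ j < 2 ^ (L - j) := by
          intro y hy
          rw [Nat.div_lt_iff_lt_mul hpos, hpow]
          exact Finset.mem_range.1 hy
        refine Finset.card_le_card_of_injOn
          -- The reduction modulo `2 ^ (L - j)` changes nothing and only serves to land in `Fin`.
          (fun y x => ⟨(y x / 2 ^ j) % 2 ^ (L - j), Nat.mod_lt _ hpos'⟩) ?_ ?_
        · intro y hy
          simp only [Finset.coe_filter, Set.mem_ofPred_eq, Fintype.mem_piFinset] at hy
          obtain ⟨hy, ⟨hdvd, hm, W, hW, hc⟩, -⟩ := hy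
          simp only [Finset.coe_filter, Set.mem_ofPred_eq, Finset.mem_univ, true_and]
          refine ⟨fun x x' hx => ?_, W, hW, fun u hu => ?_⟩
          · rw [Fin.mk_le_mk, Nat.mod_eq_of_lt (hlt _ (hy _)), Nat.mod_eq_of_lt (hlt _ (hy _))]
            exact Nat.div_le_div_right (hm hx)
          · obtain ⟨x, hx⟩ := hc u hu
            refine ⟨_, Finset.mem_image_of_mem _ (Finset.mem_univ x), ?_⟩
            simp only
            rw [Nat.mod_eq_of_lt (hlt _ (hy _))]
            obtain ⟨z, hz⟩ := hdvd x
            rw [hz, Nat.mul_div_cancel_left _ hpos]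
            rw [hz] at hx
            exact Nat.div_eq_of_lt_le (by rw [mul_comm]; exact hx.1)
              (by rw [add_mul, one_mul, mul_comm]; exact hx.2)
        · intro y hy y' hy' h
          simp only [Finset.coe_filter, Set.mem_ofPred_eq, Fintype.mem_piFinset] at hy hy'
          funext x
          have := congrArg Fin.val (congrFun h x)
          simp only at this
          rw [Nat.mod_eq_of_lt (hlt _ (hy.1 _)), Nat.mod_eq_of_lt (hlt _ (hy'.1 _))] at this
          rw [← Nat.div_mul_cancel (hy.2.1.1 x), ← Nat.div_mul_cancel (hy'.2.1.1 x), this]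
    _ = ∑ b : Fin k → Fin (2 ^ (L - j)) with Monotone b, if
        ∃ W ∈ Wit, ∀ u ∈ W, ∃ x ∈ Finset.univ.image b, (f u).val / 2 ^ j = x.val then 1 else 0 := by
        rw [← Finset.filter_filter, Finset.card_filter]
    _ ≤ _ := by
        refine Finset.sum_le_sum fun b _ => ?_
        split_ifs with h
        · obtain ⟨W, hW, h⟩ := h
          refine le_trans ?_ (Finset.single_le_sum (fun _ _ => Nat.zero_le _) hW)
          rw [if_pos h]
        · exact Nat.zero_le _

open Classical in
-- For fixed `b` with `d` distinct blocks and fixed `W`, each element of `W` has at most `d * 2 ^ j`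
-- admissible labels and the other `n - k` elements are free. In the sum over `b` the number of
-- blocks and their width multiply to `2 ^ L`, so the bound does not depend on the level.
theorem sum_goodCount_le {Wit : Finset (Finset (Fin n))} (hWit : ∀ W ∈ Wit, W.card = k) {L j : ℕ}
    (hj : j ≤ L) :
    ∑ f : Fin n → Fin (2 ^ L), goodCount (k := k) (Good Wit fun u => (f u).val) L j L 0 0 ≤
      Wit.card * 16 ^ k * (2 ^ L) ^ n := by
  have hpow : 2 ^ (L - j) * 2 ^ j = 2 ^ L := by rw [← pow_add, Nat.sub_add_cancel hj]
  refine (Finset.sum_le_sum fun f _ => goodCount_le Wit hj f).trans ?_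
  rw [Finset.sum_comm]
  have hcount : ∀ b : Fin k → Fin (2 ^ (L - j)), ∀ W ∈ Wit,
      (∑ f : Fin n → Fin (2 ^ L),
        if ∀ u ∈ W, ∃ x ∈ Finset.univ.image b, (f u).val / 2 ^ j = x.val then 1 else 0) ≤
      (Finset.univ.image b).card ^ k * ((2 ^ j) ^ k * (2 ^ L) ^ (n - k)) := by
    intro b W hW
    rw [← Finset.card_filter]
    have : (Finset.univ.filter fun f : Fin n → Fin (2 ^ L) =>
        ∀ u ∈ W, ∃ x ∈ Finset.univ.image b, (f u).val / 2 ^ j = x.val) =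
        Fintype.piFinset fun u => if u ∈ W then
          Finset.univ.filter fun v : Fin (2 ^ L) => ∃ x ∈ Finset.univ.image b, v.val / 2 ^ j = x.val
          else Finset.univ := by
      ext f
      simp only [Finset.mem_filter, Finset.mem_univ, true_and, Fintype.mem_piFinset]
      refine forall_congr' fun u => ?_
      by_cases hu : u ∈ W <;> simp [hu]
    rw [this, Fintype.card_piFinset]
    simp only [apply_ite Finset.card]
    rw [Finset.prod_ite, Finset.prod_const, Finset.prod_const, Finset.filter_mem_eq_inter,
      Finset.univ_inter, hWit W hW, Finset.card_univ, Fintype.card_fin]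
    have hc : (Finset.univ.filter fun u => u ∉ W).card = n - k := by
      rw [← hWit W hW, Finset.filter_not, Finset.filter_mem_eq_inter, Finset.univ_inter,
        Finset.card_sdiff_of_subset (Finset.subset_univ _), Finset.card_univ, Fintype.card_fin]
    rw [hc, ← mul_assoc, ← mul_pow]
    exact Nat.mul_le_mul_right _ (Nat.pow_le_pow_left
      (card_filter_div_mem_le (Finset.univ.image b) (by positivity) _) k)
  calc _ ≤ ∑ b : Fin k → Fin (2 ^ (L - j)) with Monotone b,
        ∑ W ∈ Wit, (Finset.univ.image b).card ^ k * ((2 ^ j) ^ k * (2 ^ L) ^ (n - k)) := by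
        refine Finset.sum_le_sum fun b _ => ?_
        rw [Finset.sum_comm]
        exact Finset.sum_le_sum fun W hW => hcount b W hW
    _ = (∑ b : Fin k → Fin (2 ^ (L - j)) with Monotone b, (Finset.univ.image b).card ^ k) *
        (Wit.card * ((2 ^ j) ^ k * (2 ^ L) ^ (n - k))) := by
        rw [Finset.sum_mul]
        refine Finset.sum_congr rfl fun b _ => ?_
        rw [Finset.sum_const, smul_eq_mul]
        ring
    _ ≤ 16 ^ k * (2 ^ (L - j)) ^ k * (Wit.card * ((2 ^ j) ^ k * (2 ^ L) ^ (n - k))) :=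
        Nat.mul_le_mul_right _ (sum_card_range_pow_le k _)
    _ = Wit.card * 16 ^ k * ((2 ^ (L - j) * 2 ^ j) ^ k * (2 ^ L) ^ (n - k)) := by
        rw [mul_pow]
        ring
    _ ≤ Wit.card * 16 ^ k * (2 ^ L) ^ n := by
        -- A witness is what guarantees `k ≤ n`; without one both sides vanish.
        rcases Finset.eq_empty_or_nonempty Wit with rfl | ⟨W, hW⟩
        · simp
        · have hkn : k ≤ n := by
            rw [← hWit W hW]
            simpa using Finset.card_le_univ W
          rw [hpow, ← pow_add, Nat.add_sub_cancel' hkn]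

/-- The number of repetitions of the basic step that one run of the search is granted. -/
def budget (k L M : ℕ) : ℕ := 16 * 32 ^ k * ((L + 1) * M)

theorem treeSize_root_le (Wit : Finset (Finset (Fin n))) (L : ℕ) (f : Fin n → ℕ) :
    treeSize (k := k) (Good Wit f) L 0 0 ≤
      1 + 2 ^ (k + 1) * ∑ j ∈ Finset.range (L + 1), goodCount (k := k) (Good Wit f) L j L 0 0 := by
  have := treeSize_le (k := k) (Good Wit f) L L 0 0 (Nat.zero_le _) (fun x => by simp)
    (fun y hy x => by simpa using (hy x).2)
  omega

open Classical in
-- Markov's inequality, written with sums over all labelings.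
theorem card_treeSize_gt {Wit : Finset (Finset (Fin n))} (hWit : ∀ W ∈ Wit, W.card = k) (L : ℕ)
    {M : ℕ} (hM : 1 ≤ M) (hWM : Wit.card ≤ M) :
    4 * (Finset.univ.filter fun f : Fin n → Fin (2 ^ L) =>
      budget k L M < treeSize (k := k) (Good Wit fun u => (f u).val) L 0 0).card ≤ (2 ^ L) ^ n := by
  set A := Finset.univ.filter fun f : Fin n → Fin (2 ^ L) =>
      budget k L M < treeSize (k := k) (Good Wit fun u => (f u).val) L 0 0
  have h₁ : A.card * budget k L M ≤
      ∑ f : Fin n → Fin (2 ^ L), treeSize (k := k) (Good Wit fun u => (f u).val) L 0 0 := by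
    calc _ ≤ ∑ f ∈ A, treeSize (k := k) (Good Wit fun u => (f u).val) L 0 0 := by
          rw [← smul_eq_mul]
          exact Finset.card_nsmul_le_sum _ _ _ fun f hf => (Finset.mem_filter.1 hf).2.le
      _ ≤ _ := Finset.sum_le_sum_of_subset (Finset.subset_univ _)
  have h₂ : ∑ f : Fin n → Fin (2 ^ L), treeSize (k := k) (Good Wit fun u => (f u).val) L 0 0 ≤
      (2 ^ L) ^ n + 2 ^ (k + 1) * ((L + 1) * (Wit.card * 16 ^ k * (2 ^ L) ^ n)) := by
    refine (Finset.sum_le_sum fun f _ => treeSize_root_le Wit L _).trans ?_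
    rw [Finset.sum_add_distrib, ← Finset.mul_sum, Finset.sum_comm]
    gcongr
    · simp
    · calc _ ≤ ∑ j ∈ Finset.range (L + 1), Wit.card * 16 ^ k * (2 ^ L) ^ n :=
            Finset.sum_le_sum fun j hj => sum_goodCount_le hWit
              (Nat.lt_succ_iff.1 (Finset.mem_range.1 hj))
        _ = _ := by rw [Finset.sum_const, Finset.card_range, smul_eq_mul]
  -- With `X = 32 ^ k * ((L + 1) * M) ≥ 1`, four times the mean is at most `4 + 8 * X ≤ 16 * X`,
  -- which explains the factor in `budget`.
  have h₃ : 4 * ((2 ^ L) ^ n + 2 ^ (k + 1) * ((L + 1) * (Wit.card * 16 ^ k * (2 ^ L) ^ n))) ≤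
      budget k L M * (2 ^ L) ^ n := by
    have e : 32 ^ k = 2 ^ k * 16 ^ k := by rw [← mul_pow]; norm_num
    have e1 : 1 ≤ 2 ^ k * 16 ^ k * ((L + 1) * M) :=
      Nat.one_le_iff_ne_zero.2 (by positivity)
    calc _ = (4 + 8 * (2 ^ k * 16 ^ k * ((L + 1) * Wit.card))) * (2 ^ L) ^ n := by ring
      _ ≤ (4 + 8 * (2 ^ k * 16 ^ k * ((L + 1) * M))) * (2 ^ L) ^ n := by gcongr
      _ ≤ _ := by
        refine Nat.mul_le_mul_right _ ?_
        rw [budget, e]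
        rw [mul_assoc 16]
        omega
  have hpos : 0 < budget k L M := by unfold budget; positivity
  refine Nat.le_of_mul_le_mul_right ?_ hpos
  calc 4 * A.card * budget k L M = 4 * (A.card * budget k L M) := by ring
    _ ≤ budget k L M * (2 ^ L) ^ n := (Nat.mul_le_mul_left 4 (h₁.trans h₂)).trans h₃
    _ = _ := mul_comm _ _

open Classical in
-- Union bound over pairs `u ≠ v`. Overwriting the label of `u` by any of the `N` values is
-- injective on the labelings with `f u = f v`, so these are at most a fraction `1 / N` of all.
theorem card_not_injective_le (n N : ℕ) (hN : 4 * n ^ 2 ≤ N) :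
    4 * (Finset.univ.filter fun f : Fin n → Fin N => ¬ Function.Injective f).card ≤ N ^ n := by
  have hsub : (Finset.univ.filter fun f : Fin n → Fin N => ¬ Function.Injective f) ⊆
      (Finset.univ.filter fun p : Fin n × Fin n => p.1 ≠ p.2).biUnion fun p =>
        Finset.univ.filter fun f : Fin n → Fin N => f p.1 = f p.2 := by
    intro f hf
    simp only [Finset.mem_filter, Finset.mem_univ, true_and, Function.Injective, not_forall] at hf
    obtain ⟨u, v, h, hne⟩ := hf
    simp only [Finset.mem_biUnion, Finset.mem_filter, Finset.mem_univ, true_and]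
    exact ⟨(u, v), hne, h⟩
  have hpair : ∀ u v : Fin n, u ≠ v →
      N * (Finset.univ.filter fun f : Fin n → Fin N => f u = f v).card ≤ N ^ n := by
    intro u v huv
    have e₁ : N * (Finset.univ.filter fun f : Fin n → Fin N => f u = f v).card =
        ((Finset.univ : Finset (Fin N)) ×ˢ
          Finset.univ.filter fun f : Fin n → Fin N => f u = f v).card := by
      rw [Finset.card_product, Finset.card_univ, Fintype.card_fin]
    have e₂ : N ^ n = (Finset.univ : Finset (Fin n → Fin N)).card := by simp
    rw [e₁, e₂]
    refine Finset.card_le_card_of_injOn (fun q => Function.update q.2 u q.1)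
      (fun _ _ => Finset.mem_coe.2 (Finset.mem_univ _)) ?_
    rintro ⟨x, f⟩ hf ⟨y, g⟩ hg h
    simp only [Finset.coe_product, Set.mem_prod, Finset.coe_filter, Set.mem_ofPred_eq,
      Finset.mem_univ, true_and] at hf hg h
    have hx := congrFun h u
    simp only [Function.update_self] at hx
    have hfg : f = g := by
      funext z
      by_cases hz : z = u
      · have hv := congrFun h v
        rw [Function.update_of_ne huv.symm, Function.update_of_ne huv.symm] at hv
        rw [hz, hf.2, hg.2, hv]
      · have hz' := congrFun h z
        rwa [Function.update_of_ne hz, Function.update_of_ne hz] at hz'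
    rw [hx, hfg]
  rcases Nat.eq_zero_or_pos N with rfl | hNpos
  · have hn : n = 0 := by
      have : n ^ 2 = 0 := by omega
      exact pow_eq_zero_iff (by norm_num) |>.1 this
    subst hn
    have : (Finset.univ.filter fun f : Fin 0 → Fin 0 => ¬ Function.Injective f) = ∅ := by
      refine Finset.filter_eq_empty_iff.2 fun f _ h => h fun x => x.elim0
    rw [this, Finset.card_empty]
    exact Nat.zero_le _
  refine Nat.le_of_mul_le_mul_left ?_ hNpos
  calc N * (4 * (Finset.univ.filter fun f : Fin n → Fin N => ¬ Function.Injective f).card)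
      ≤ N * (4 * ∑ p ∈ (Finset.univ.filter fun p : Fin n × Fin n => p.1 ≠ p.2),
          (Finset.univ.filter fun f : Fin n → Fin N => f p.1 = f p.2).card) := by
        gcongr
        exact (Finset.card_le_card hsub).trans Finset.card_biUnion_le
    _ = 4 * ∑ p ∈ (Finset.univ.filter fun p : Fin n × Fin n => p.1 ≠ p.2),
          N * (Finset.univ.filter fun f : Fin n → Fin N => f p.1 = f p.2).card := by
        rw [Finset.mul_sum, Finset.mul_sum, Finset.mul_sum]
        exact Finset.sum_congr rfl fun _ _ => by ring
    _ ≤ 4 * ∑ p ∈ (Finset.univ.filter fun p : Fin n × Fin n => p.1 ≠ p.2), N ^ n := by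
        gcongr with p hp
        exact hpair _ _ (Finset.mem_filter.1 hp).2
    _ ≤ 4 * ∑ p : Fin n × Fin n, N ^ n := by
        gcongr
        exact Finset.filter_subset _ _
    _ = 4 * n ^ 2 * N ^ n := by
        rw [Finset.sum_const, Finset.card_univ, Fintype.card_prod, Fintype.card_fin, smul_eq_mul]
        ring
    _ ≤ N * N ^ n := Nat.mul_le_mul_right _ hN

/-- With the labels `f` the search is granted enough steps and finds the number of witnesses. -/
def Succeeds (Wit : Finset (Finset (Fin n))) (k L M : ℕ) (f : Fin n → ℕ) : Prop :=
  Function.Injective f ∧ treeSize (k := k) (Good Wit f) L 0 0 ≤ budget k L M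

open Classical in
theorem card_not_succeeds {Wit : Finset (Finset (Fin n))} (hWit : ∀ W ∈ Wit, W.card = k) {L M : ℕ}
    (hM : 1 ≤ M) (hWM : Wit.card ≤ M) (hL : 4 * n ^ 2 ≤ 2 ^ L) :
    2 * (Finset.univ.filter fun f : Fin n → Fin (2 ^ L) =>
      ¬ Succeeds Wit k L M fun u => (f u).val).card ≤ (2 ^ L) ^ n := by
  have h₁ := card_not_injective_le n (2 ^ L) hL
  have h₂ := card_treeSize_gt hWit L hM hWM
  have h₃ : (Finset.univ.filter fun f : Fin n → Fin (2 ^ L) =>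
      ¬ Succeeds Wit k L M fun u => (f u).val).card ≤
      (Finset.univ.filter fun f : Fin n → Fin (2 ^ L) => ¬ Function.Injective f).card +
      (Finset.univ.filter fun f : Fin n → Fin (2 ^ L) =>
        budget k L M < treeSize (k := k) (Good Wit fun u => (f u).val) L 0 0).card := by
    refine le_trans (Finset.card_le_card ?_) (Finset.card_union_le _ _)
    intro f hf
    rw [Finset.mem_union, Finset.mem_filter, Finset.mem_filter]
    by_contra h
    simp only [Finset.mem_univ, true_and, not_or, not_not, not_lt] at h
    exact (Finset.mem_filter.1 hf).2 ⟨Fin.val_injective.comp h.1, h.2⟩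
  omega

/-! ### The program

Cells `0, …, 3` hold the input, cells up to `63` serve as registers, and the arrays follow from cell
`64` on: the powers of two, the current query, the labels for all runs, and the stack of nodes.

`4`: one, `5`: number of levels, `6`: budget, `7`: address of the query, `8`: address of the labels,
`9`: address of the stack, `10`: first free cell above the stack, `11`: counter, `12`: size of a node,
`13`: has some run succeeded, `14`: result, `16`: address of the powers of two, `17`: largest label,
`18`: zero, `19`: are the labels distinct. -/

/-- Sequential composition. -/
def block {E : Type} : List (Prog E) → Prog E
  | [] => .const 18 0
  | [p] => p
  | p :: q :: l => .seq p (block (q :: l))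

/-- Copy `[23]` cells from address `[21]` to address `[22]`. -/
def copyProg : Prog OracleOp :=
  .loop 23 (block [.load 24 21, .store 22 24, .add 21 21 4, .add 22 22 4, .sub 23 23 4])

/-- Record in the cell at address `[22]` whether one of the blocks of width `[34]` starting at the
`[24]` numbers from address `[25]` on contains `[23]`. -/
def coverOneProg : Prog OracleOp :=
  -- Truncated subtraction acts as comparison: `[27] ≠ 0` says that the label is below the end of
  -- the block, `[28] = 0` that it is not below its start.
  .loop 24 (block [.load 26 25, .add 27 26 34, .sub 27 27 23, .sub 28 26 23,
    .cond 27 (.cond 28 (.const 28 0) (.store 22 4)) (.const 28 0), .add 25 25 4, .sub 24 24 4])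

/-- Prepare the query for the tuple at address `[35]`. -/
def coverProg : Prog OracleOp :=
  block [.add 20 0 18, .add 21 8 18, .add 22 7 18,
    .loop 20 (block [.store 22 18, .load 23 21, .add 24 1 18, .add 25 35 18, coverOneProg,
      .add 21 21 4, .add 22 22 4, .sub 20 20 4])]

/-- Clear `[36]` unless the tuple at address `[35]` is sorted. -/
def sortedProg : Prog OracleOp :=
  block [.sub 20 1 4, .add 21 35 18,
    .loop 20 (block [.load 22 21, .add 21 21 4, .load 23 21, .sub 24 22 23,
      .cond 24 (.const 36 0) (.const 24 0), .sub 20 20 4])]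

/-- Split a coordinate of the node on the top of the stack. -/
def splitProg : Prog OracleOp :=
  -- The copy on top becomes the upper half: the coordinate to be increased lies at offset `2 +
  -- [32]`, after the two cells for `i` and `j`.
  block [.add 21 31 18, .add 22 10 18, .add 23 12 18, copyProg, .add 24 32 4, .store 31 24, .store 10 24,
    .add 25 10 4, .add 25 25 4, .add 25 25 32, .load 26 25, .add 26 26 34, .store 25 26, .add 10 10 12]

/-- Query the node on the top of the stack. -/
def checkProg : Prog OracleOp :=
  block [coverProg, .ext (.query 36 7), sortedProg,
    .cond 36 (.cond 33 (block [.store 31 18, .sub 20 33 4, .add 21 31 4, .store 21 20])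
      (block [.add 11 11 4, .add 10 31 18])) (.add 10 31 18)]

/-- One step of the search. -/
def stepProg : Prog OracleOp :=
  block [.sub 31 10 12, .load 32 31, .add 20 31 4, .load 33 20, .add 35 20 4, .add 20 16 33, .load 34 20,
    .sub 20 1 32, .cond 20 splitProg checkProg]

/-- Compare the label at address `[41]` with `[20]` labels from address `[21]` on. -/
def distinctOneProg : Prog OracleOp :=
  -- The sum of both truncated differences is the absolute difference, which vanishes only for equal
  -- labels.
  .loop 20 (block [.load 22 21, .load 23 41, .sub 24 22 23, .sub 25 23 22, .add 24 24 25,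
    .cond 24 (.const 25 0) (.const 19 0), .add 21 21 4, .sub 20 20 4])

/-- Check whether the labels are distinct. -/
def distinctProg : Prog OracleOp :=
  block [.const 19 1, .add 40 0 18, .add 41 8 18, .const 42 0,
    .loop 40 (block [.add 20 42 18, .add 21 8 18, distinctOneProg, .add 41 41 4, .add 42 42 4,
      .sub 40 40 4])]

/-- Initialise the stack and the counter. -/
def rootProg : Prog OracleOp :=
  block [.add 21 9 18, .store 21 1, .add 21 21 4, .store 21 5, .add 21 21 4, .add 20 1 18,
    .loop 20 (block [.store 21 18, .add 21 21 4, .sub 20 20 4]), .add 10 21 18, .const 11 0]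

/-- The search with a given budget. -/
def searchProg : Prog OracleOp :=
  block [.add 40 6 18,
    -- Always `[6]` rounds; a round with an empty stack does nothing, as in `searchStep`.
    .loop 40 (block [.sub 30 10 9, .cond 30 stepProg (.const 30 0), .sub 40 40 4])]

/-- One run with the labels at address `[8]`. -/
def runProg : Prog OracleOp :=
  block [distinctProg, rootProg, searchProg, .sub 30 10 9,
    -- A run with an unfinished search or with repeated labels leaves no result.
    .cond 30 (.const 30 0) (.cond 19 (block [.const 13 1, .add 14 11 18]) (.const 30 0))]

/-- All runs, and the output. -/
def runsProg : Prog OracleOp :=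
  block [.loop 3 (block [runProg, .add 8 8 0, .sub 3 3 4]), .sub 20 14 2,
    .cond 13 (.cond 20 (.const 0 0) (block [.const 0 1, .add 1 14 18])) (.const 0 0)]

/-- Compute the number of levels. -/
def levelsProg : Prog OracleOp :=
  block [.const 4 1, .const 16 64, .const 20 1, .add 21 0 18,
    .loop 21 (block [.sub 22 0 20, .cond 22 (block [.add 20 20 20, .add 5 5 4]) (.const 22 0),
      .sub 21 21 4]),
    -- The number of levels is `4 * e` with `n ≤ 2 ^ e`, so that `4 * n ^ 2 ≤ n ^ 4 ≤ 2 ^ L` for `n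
    -- ≥ 2`.
    .add 5 5 5, .add 5 5 5]

/-- Compute the table of powers of two. -/
def powersProg : Prog OracleOp :=
  block [.const 20 1, .const 21 64, .store 21 20, .add 22 5 18,
    .loop 22 (block [.add 20 20 20, .add 21 21 4, .store 21 20, .sub 22 22 4]),
    .add 7 21 4, .sub 17 20 4]

/-- Compute the addresses of the labels and of the stack. -/
def addressProg : Prog OracleOp :=
  block [.add 8 7 0, .add 9 8 18, .add 22 3 18, .loop 22 (block [.add 9 9 0, .sub 22 22 4]),
    .add 12 1 4, .add 12 12 4]

/-- Compute the budget. -/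
def budgetProg : Prog OracleOp :=
  block [.add 22 5 4, .loop 22 (block [.add 6 6 2, .sub 22 22 4]), .add 22 1 18,
    -- Five doublings in each of `k` rounds give `32 ^ k`; the final four give the factor `16`.
    .loop 22 (block [.add 6 6 6, .add 6 6 6, .add 6 6 6, .add 6 6 6, .add 6 6 6, .sub 22 22 4]),
    .add 6 6 6, .add 6 6 6, .add 6 6 6, .add 6 6 6]

/-- All computations before the labels are chosen. -/
def prepareProg : Prog OracleOp :=
  block [levelsProg, powersProg, addressProg, budgetProg, .sub 22 9 8, .add 23 8 18]

/-- Choose the labels for all runs. -/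
def labelProg : Prog OracleOp :=
  .loop 22 (block [.ext (.rand 24 17), .store 23 24, .add 23 23 4, .sub 22 22 4])

/-- The counting algorithm. -/
def countProg : Prog OracleOp :=
  -- For `k = 0` the factor `2 ^ (C * k)` hides no constant, but then the answer to a single query
  -- is already the number of witnesses.
  .cond 1 (block [prepareProg, labelProg, runsProg]) (block [.ext (.query 1 4), .const 0 1])

/-! ### Verification of the program -/

section Verify

variable {P : WitnessProblem} {I : P.Inst} {Q : Config (Finset (Fin (P.univSize I))) → Prop}
  {m : ℕ → ℕ} {t : ℕ} {l : List (Finset (Fin (P.univSize I)))}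

/-! ### Rules for blocks, and the elementary subroutines -/

theorem WP.block_cons {p q : Prog OracleOp} {ps : List (Prog OracleOp)}
    {s : Config (Finset (Fin (P.univSize I)))} (h : WP P I p (WP P I (block (q :: ps)) Q) s) :
    WP P I (block (p :: q :: ps)) Q s :=
  WP.seq h

theorem WP.block_one {p : Prog OracleOp} {s : Config (Finset (Fin (P.univSize I)))}
    (h : WP P I p Q s) : WP P I (block [p]) Q s :=
  h

theorem block_singleton {E : Type} (p : Prog E) : block [p] = p := rfl

theorem block_cons_cons {E : Type} (p q : Prog E) (l : List (Prog E)) :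
    block (p :: q :: l) = .seq p (block (q :: l)) := rfl

attribute [irreducible] block

/-- The specifications from here on share one shape: any configuration with the stated time bound,
the stated unchanged cells and the stated effect must satisfy `Q`. Loop invariants say the same
after `i` rounds. -/
theorem wp_copyProg {src dst len : ℕ} (h4 : m 4 = 1) (h21 : m 21 = src) (h22 : m 22 = dst)
    (h23 : m 23 = len) (hsrc : 64 ≤ src) (hd : src + len ≤ dst)
    (hQ : ∀ m' t', t' ≤ t + (6 * len + 1) →
      (∀ c, ¬ (20 ≤ c ∧ c < 30) → ¬ (dst ≤ c ∧ c < dst + len) → m' c = m c) →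
      (∀ x < len, m' (dst + x) = m (src + x)) → Q ⟨m', t', l⟩) :
    WP P I copyProg Q ⟨m, t, l⟩ := by
  refine WP.loop (fun i s => i + s.mem 23 = len ∧ s.mem 21 = src + i ∧ s.mem 22 = dst + i ∧
    s.steps ≤ t + 6 * i ∧ s.queries = l ∧
    (∀ c, ¬ (20 ≤ c ∧ c < 30) → ¬ (dst ≤ c ∧ c < dst + i) → s.mem c = m c) ∧
    ∀ x < i, s.mem (dst + x) = m (src + x)) len (fun i s h => h.1) ?_ ?_ ?_
  · rintro i m₁ t₁ l₁ hi ⟨h1, h2, h3, h4, h5, h6, h7⟩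
    simp only at *
    have h44 := h6 4 (by omega) (by omega)
    have hs := h6 (src + i) (by omega) (by omega)
    repeat first
      | apply WP.block_cons | apply WP.block_one | apply WP.load | apply WP.store | apply WP.add
      | apply WP.sub | intro _
    simp only [Function.update_apply] at *
    refine ⟨?_, ?_, ?_, ?_, ?_, ?_, ?_⟩
    · grind
    · grind
    · grind
    · grind
    · grind
    · grind
    · grind
  · simp only
    grind
  · rintro m₁ t₁ l₁ ⟨h1, h2, h3, h4, h5, h6, h7⟩
    simp only at *
    subst h5
    exact hQ _ _ (by omega) h6 h7

theorem wp_coverOneProg {k ab xp v w : ℕ} (h4 : m 4 = 1) (h22 : m 22 = xp) (h23 : m 23 = v)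
    (h24 : m 24 = k) (h25 : m 25 = ab) (h34 : m 34 = w) (hxp : 64 ≤ xp) (hab : xp < ab)
    (hQ : ∀ m' t', t' ≤ t + (10 * k + 1) →
      (∀ c, ¬ (24 ≤ c ∧ c < 30) → c ≠ xp → m' c = m c) →
      (m' xp ≠ 0 ↔ m xp ≠ 0 ∨ ∃ x < k, m (ab + x) ≤ v ∧ v < m (ab + x) + w) → Q ⟨m', t', l⟩) :
    WP P I coverOneProg Q ⟨m, t, l⟩ := by
  refine WP.loop (fun i s => i + s.mem 24 = k ∧ s.mem 25 = ab + i ∧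
    s.steps ≤ t + 10 * i ∧ s.queries = l ∧
    (∀ c, ¬ (24 ≤ c ∧ c < 30) → c ≠ xp → s.mem c = m c) ∧
    (s.mem xp ≠ 0 ↔ m xp ≠ 0 ∨ ∃ x < i, m (ab + x) ≤ v ∧ v < m (ab + x) + w)) k
    (fun i s h => h.1) ?_ ?_ ?_
  · rintro i m₁ t₁ l₁ hi ⟨h1, h2, h3, h5, h6, h7⟩
    simp only at *
    have e4 := h6 4 (by omega) (by omega)
    have e22 := h6 22 (by omega) (by omega)
    have e23 := h6 23 (by omega) (by omega)
    have e34 := h6 34 (by omega) (by omega)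
    have hs := h6 (ab + i) (by omega) (by omega)
    have hex : (∃ x < i + 1, m (ab + x) ≤ v ∧ v < m (ab + x) + w) ↔
        (∃ x < i, m (ab + x) ≤ v ∧ v < m (ab + x) + w) ∨
        (m (ab + i) ≤ v ∧ v < m (ab + i) + w) := by
      simp only [Nat.lt_succ_iff_lt_or_eq, or_and_right, exists_or, exists_eq_left]
    rw [hex]
    generalize (∃ x < i, m (ab + x) ≤ v ∧ v < m (ab + x) + w) = E at *
    repeat' first
      | apply WP.block_cons | apply WP.block_one | apply WP.load | apply WP.store | apply WP.add
      | apply WP.sub | apply WP.const | apply WP.cond | intro _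
    all_goals
      simp only [Function.update_apply] at *
      refine ⟨?_, ?_, ?_, ?_, ?_, ?_⟩ <;> grind
  · simp only
    grind
  · rintro m₁ t₁ l₁ ⟨h1, h2, h3, h5, h6, h7⟩
    simp only at *
    subst h5
    exact hQ _ _ (by omega) h6 h7

theorem wp_coverProg {n k lp ab bx w : ℕ} (h0 : m 0 = n) (h1 : m 1 = k) (h4 : m 4 = 1)
    (h7 : m 7 = bx) (h8 : m 8 = lp) (h18 : m 18 = 0) (h34 : m 34 = w) (h35 : m 35 = ab)
    (hbx : 64 ≤ bx) (hlp : bx + n ≤ lp) (hab : lp + n ≤ ab)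
    (hQ : ∀ m' t', t' ≤ t + (n * (10 * k + 9) + 4) →
      (∀ c, ¬ (20 ≤ c ∧ c < 30) → ¬ (bx ≤ c ∧ c < bx + n) → m' c = m c) →
      (∀ u < n, m' (bx + u) ≠ 0 ↔
        ∃ x < k, m (ab + x) ≤ m (lp + u) ∧ m (lp + u) < m (ab + x) + w) → Q ⟨m', t', l⟩) :
    WP P I coverProg Q ⟨m, t, l⟩ := by
  unfold coverProg
  repeat first
    | apply WP.block_cons | apply WP.block_one | apply WP.add | intro _
  refine WP.loop (fun i s => i + s.mem 20 = n ∧ s.mem 21 = lp + i ∧ s.mem 22 = bx + i ∧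
    s.steps ≤ t + 3 + i * (10 * k + 9) ∧ s.queries = l ∧
    (∀ c, ¬ (20 ≤ c ∧ c < 30) → ¬ (bx ≤ c ∧ c < bx + n) → s.mem c = m c) ∧
    (∀ u < i, s.mem (bx + u) ≠ 0 ↔
        ∃ x < k, m (ab + x) ≤ m (lp + u) ∧ m (lp + u) < m (ab + x) + w)) n
    (fun i s h => h.1) ?_ ?_ ?_
  · rintro i m₁ t₁ l₁ hi ⟨g1, g2, g3, g5, g6, g7, g8⟩
    simp only at *
    have e0 := g7 0 (by omega) (by omega)
    have e1 := g7 1 (by omega) (by omega)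
    have e4 := g7 4 (by omega) (by omega)
    have e18 := g7 18 (by omega) (by omega)
    have e34 := g7 34 (by omega) (by omega)
    have e35 := g7 35 (by omega) (by omega)
    have el := g7 (lp + i) (by omega) (by omega)
    repeat first
      | apply WP.block_cons | apply WP.block_one | apply WP.load | apply WP.store | apply WP.add | intro _
    refine WP.rename fun m₂ hm => ?_
    simp only [Function.update_apply] at *
    have ha : ∀ x, m₂ (ab + x) = m (ab + x) := fun x => by
      rw [← g7 (ab + x) (by omega) (by omega), hm]
      grind
    refine wp_coverOneProg (k := k) (ab := ab) (xp := bx + i) (v := m (lp + i)) (w := w)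
      (by grind) (by grind) (by grind) (by grind) (by grind) (by grind) (by omega) (by omega) ?_
    intro m₃ t₃ ht₃ hf hx
    have hx' : m₃ (bx + i) ≠ 0 ↔
        ∃ x < k, m (ab + x) ≤ m (lp + i) ∧ m (lp + i) < m (ab + x) + w := by
      have h0 : m₂ (bx + i) = 0 := by rw [hm]; grind
      rw [hx]
      simp only [ha, h0, ne_eq, not_true_eq_false, false_or]
    replace hf : ∀ c, ¬ (23 ≤ c ∧ c < 30) → c ≠ bx + i → m₃ c = m₁ c := by
      intro c hc hc'
      rw [hf c (by omega) hc', hm]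
      grind
    clear hm hx ha
    have f4 := hf 4 (by omega) (by omega)
    have f20 := hf 20 (by omega) (by omega)
    have f21 := hf 21 (by omega) (by omega)
    have f22 := hf 22 (by omega) (by omega)
    repeat first
      | apply WP.block_cons | apply WP.block_one | apply WP.add | apply WP.sub | intro _
    simp only [Function.update_apply] at *
    have hmul : (i + 1) * (10 * k + 9) = i * (10 * k + 9) + (10 * k + 9) := by ring
    refine ⟨?_, ?_, ?_, ?_, ?_, ?_, ?_⟩
    · grind
    · grind
    · grind
    · omega
    · grind
    · grind
    · intro u hu
      rcases Nat.lt_succ_iff_lt_or_eq.1 hu with hu | rfl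
      · have := hf (bx + u) (by omega) (by omega)
        rw [← g8 u hu]
        grind
      · rw [← hx']
        grind
  · simp only [Function.update_apply] at *
    grind
  · rintro m₁ t₁ l₁ ⟨g1, g2, g3, g5, g6, g7, g8⟩
    simp only at *
    subst g6
    exact hQ _ _ (by omega) g7 g8

theorem wp_sortedProg {k ab : ℕ} (h1 : m 1 = k) (h4 : m 4 = 1) (h18 : m 18 = 0) (h35 : m 35 = ab)
    (hab : 64 ≤ ab)
    (hQ : ∀ m' t', t' ≤ t + (8 * k + 3) →
      (∀ c, ¬ (20 ≤ c ∧ c < 30) → c ≠ 36 → m' c = m c) →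
      (m' 36 ≠ 0 ↔ m 36 ≠ 0 ∧ ∀ x, x + 1 < k → m (ab + x) ≤ m (ab + (x + 1))) → Q ⟨m', t', l⟩) :
    WP P I sortedProg Q ⟨m, t, l⟩ := by
  unfold sortedProg
  repeat first
    | apply WP.block_cons | apply WP.block_one | apply WP.add | apply WP.sub | intro _
  refine WP.loop (fun i s => i + s.mem 20 = k - 1 ∧ s.mem 21 = ab + i ∧
    s.steps ≤ t + 2 + 8 * i ∧ s.queries = l ∧
    (∀ c, ¬ (20 ≤ c ∧ c < 30) → c ≠ 36 → s.mem c = m c) ∧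
    (s.mem 36 ≠ 0 ↔ m 36 ≠ 0 ∧ ∀ x < i, m (ab + x) ≤ m (ab + (x + 1)))) (k - 1)
    (fun i s h => h.1) ?_ ?_ ?_
  · rintro i m₁ t₁ l₁ hi ⟨g1, g2, g3, g5, g6, g7⟩
    simp only at *
    have e4 := g6 4 (by omega) (by omega)
    have ea := g6 (ab + i) (by omega) (by omega)
    have eb := g6 (ab + (i + 1)) (by omega) (by omega)
    have hex : (∀ x < i + 1, m (ab + x) ≤ m (ab + (x + 1))) ↔
        (∀ x < i, m (ab + x) ≤ m (ab + (x + 1))) ∧ m (ab + i) ≤ m (ab + (i + 1)) := by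
      simp only [Nat.lt_succ_iff_lt_or_eq, or_imp, forall_and, forall_eq]
    rw [hex]
    generalize (∀ x < i, m (ab + x) ≤ m (ab + (x + 1))) = E at *
    repeat' first
      | apply WP.block_cons | apply WP.block_one | apply WP.load | apply WP.store | apply WP.add
      | apply WP.sub | apply WP.const | apply WP.cond | intro _
    all_goals
      simp only [Function.update_apply] at *
      refine ⟨?_, ?_, ?_, ?_, ?_, ?_⟩ <;> grind
  · simp only [Function.update_apply] at *
    grind
  · rintro m₁ t₁ l₁ ⟨g1, g2, g3, g5, g6, g7⟩
    simp only at *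
    subst g5
    refine hQ _ _ (by omega) g6 ?_
    rw [g7]
    have : ∀ x, x < k - 1 ↔ x + 1 < k := fun x => by omega
    simp only [this]

/-! ### The test for distinct labels -/

theorem wp_distinctOneProg {lp i v : ℕ} (h4 : m 4 = 1) (h20 : m 20 = i) (h21 : m 21 = lp)
    (h41 : m (m 41) = v) (hlp : 64 ≤ lp) (h41' : 64 ≤ m 41)
    (hQ : ∀ m' t', t' ≤ t + (10 * i + 1) →
      (∀ c, ¬ (20 ≤ c ∧ c < 30) → c ≠ 19 → m' c = m c) →
      (m' 19 ≠ 0 ↔ m 19 ≠ 0 ∧ ∀ x < i, m (lp + x) ≠ v) → Q ⟨m', t', l⟩) :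
    WP P I distinctOneProg Q ⟨m, t, l⟩ := by
  refine WP.loop (fun j s => j + s.mem 20 = i ∧ s.mem 21 = lp + j ∧
    s.steps ≤ t + 10 * j ∧ s.queries = l ∧
    (∀ c, ¬ (20 ≤ c ∧ c < 30) → c ≠ 19 → s.mem c = m c) ∧
    (s.mem 19 ≠ 0 ↔ m 19 ≠ 0 ∧ ∀ x < j, m (lp + x) ≠ v)) i
    (fun i s h => h.1) ?_ ?_ ?_
  · rintro i m₁ t₁ l₁ hi ⟨g1, g2, g3, g5, g6, g7⟩
    simp only at *
    have e4 := g6 4 (by omega) (by omega)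
    have e41 := g6 41 (by omega) (by omega)
    have ev := g6 (m 41) (by omega) (by omega)
    have ea := g6 (lp + i) (by omega) (by omega)
    have hex : (∀ x < i + 1, m (lp + x) ≠ v) ↔ (∀ x < i, m (lp + x) ≠ v) ∧ m (lp + i) ≠ v := by
      simp only [Nat.lt_succ_iff_lt_or_eq, or_imp, forall_and, forall_eq]
    rw [hex]
    generalize (∀ x < i, m (lp + x) ≠ v) = E at *
    repeat' first
      | apply WP.block_cons | apply WP.block_one | apply WP.load | apply WP.store | apply WP.add
      | apply WP.sub | apply WP.const | apply WP.cond | intro _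
    all_goals
      simp only [Function.update_apply] at *
      refine ⟨?_, ?_, ?_, ?_, ?_, ?_⟩ <;> grind
  · simp only
    grind
  · rintro m₁ t₁ l₁ ⟨g1, g2, g3, g5, g6, g7⟩
    simp only at *
    subst g5
    exact hQ _ _ (by omega) g6 g7

theorem wp_distinctProg {n lp : ℕ} (h0 : m 0 = n) (h4 : m 4 = 1) (h8 : m 8 = lp) (h18 : m 18 = 0)
    (hlp : 64 ≤ lp)
    (hQ : ∀ m' t', t' ≤ t + (n * (10 * n + 7) + 5) →
      (∀ c, ¬ (20 ≤ c ∧ c < 30) → ¬ (40 ≤ c ∧ c < 50) → c ≠ 19 → m' c = m c) →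
      (m' 19 ≠ 0 ↔ ∀ u < n, ∀ x < u, m (lp + x) ≠ m (lp + u)) → Q ⟨m', t', l⟩) :
    WP P I distinctProg Q ⟨m, t, l⟩ := by
  unfold distinctProg
  repeat first
    | apply WP.block_cons | apply WP.block_one | apply WP.add | apply WP.const | intro _
  refine WP.loop (fun i s => i + s.mem 40 = n ∧ s.mem 41 = lp + i ∧ s.mem 42 = i ∧
    s.steps ≤ t + 4 + i * (10 * n + 7) ∧ s.queries = l ∧
    (∀ c, ¬ (20 ≤ c ∧ c < 30) → ¬ (40 ≤ c ∧ c < 50) → c ≠ 19 → s.mem c = m c) ∧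
    (s.mem 19 ≠ 0 ↔ ∀ u < i, ∀ x < u, m (lp + x) ≠ m (lp + u))) n
    (fun i s h => h.1) ?_ ?_ ?_
  · rintro i m₁ t₁ l₁ hi ⟨g1, g2, g3, g5, g6, g7, g8⟩
    simp only at *
    have e0 := g7 0 (by omega) (by omega)
    have e4 := g7 4 (by omega) (by omega) (by omega)
    have e8 := g7 8 (by omega) (by omega) (by omega)
    have e18 := g7 18 (by omega) (by omega) (by omega)
    have el := g7 (lp + i) (by omega) (by omega) (by omega)
    repeat first
      | apply WP.block_cons | apply WP.block_one | apply WP.load | apply WP.store | apply WP.add | intro _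
    refine wp_distinctOneProg (i := i) (lp := lp) (v := m (lp + i)) ?_ ?_ ?_ ?_ hlp ?_ ?_
    iterate 5 simp only [Function.update_apply] at *; grind
    intro m₂ t₂ ht₂ hf hx
    have hx' : m₂ 19 ≠ 0 ↔ ∀ u < i + 1, ∀ x < u, m (lp + x) ≠ m (lp + u) := by
      rw [hx]
      have : ∀ x, m₁ (lp + x) = m (lp + x) := fun x => g7 _ (by omega) (by omega) (by omega)
      simp only [Nat.lt_succ_iff_lt_or_eq, or_imp, forall_and, forall_eq, ← g8]
      simp only [Function.update_apply] at *
      grind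
    replace hf : ∀ c, ¬ (20 ≤ c ∧ c < 30) → c ≠ 19 → m₂ c = m₁ c := by
      intro c hc hc'
      rw [hf c (by omega) hc']
      simp only [Function.update_apply] at *
      grind
    have f4 := hf 4 (by omega) (by omega)
    have f40 := hf 40 (by omega) (by omega)
    have f41 := hf 41 (by omega) (by omega)
    have f42 := hf 42 (by omega) (by omega)
    clear hx
    repeat first
      | apply WP.block_cons | apply WP.block_one | apply WP.add | apply WP.sub | intro _
    simp only [Function.update_apply] at *
    have hmul : (i + 1) * (10 * n + 7) = i * (10 * n + 7) + (10 * n + 7) := by ring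
    refine ⟨?_, ?_, ?_, ?_, ?_, ?_, ?_⟩
    · grind
    · grind
    · grind
    · omega
    · grind
    · grind
    · exact hx'
  · simp only [Function.update_apply] at *
    grind
  · rintro m₁ t₁ l₁ ⟨g1, g2, g3, g5, g6, g7, g8⟩
    simp only at *
    subst g6
    exact hQ _ _ (by omega) g7 g8

/-! ### One step of the search -/

theorem wp_splitProg {k tp i w : ℕ} (h4 : m 4 = 1) (h18 : m 18 = 0) (h31 : m 31 = tp)
    (h10 : m 10 = tp + (k + 2)) (h12 : m 12 = k + 2) (h32 : m 32 = i) (h34 : m 34 = w)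
    (hi : i < k) (htp : 64 ≤ tp)
    (hQ : ∀ m' t', t' ≤ t + (6 * k + 26) →
      (∀ c, ¬ (20 ≤ c ∧ c < 30) → c ≠ 10 → c ≠ tp →
        ¬ (tp + (k + 2) ≤ c ∧ c < tp + (k + 2) + (k + 2)) → m' c = m c) →
      m' 10 = tp + (k + 2) + (k + 2) → m' tp = i + 1 → m' (tp + (k + 2)) = i + 1 →
      m' (tp + (k + 2) + 1) = m (tp + 1) →
      (∀ x < k, m' (tp + (k + 2) + 2 + x) =
        if x = i then m (tp + 2 + x) + w else m (tp + 2 + x)) → Q ⟨m', t', l⟩) :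
    WP P I splitProg Q ⟨m, t, l⟩ := by
  unfold splitProg
  repeat first
    | apply WP.block_cons | apply WP.block_one | apply WP.add | intro _
  refine WP.rename fun m₁ hm => ?_
  simp only [Function.update_apply] at *
  refine wp_copyProg (src := tp) (dst := tp + (k + 2)) (len := k + 2)
    (by grind) (by grind) (by grind) (by grind) htp le_rfl ?_
  intro m₂ t₂ ht₂ hf hc
  replace hf : ∀ c, ¬ (20 ≤ c ∧ c < 30) →
      ¬ (tp + (k + 2) ≤ c ∧ c < tp + (k + 2) + (k + 2)) → m₂ c = m c := by
    intro c h1 h2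
    rw [hf c h1 h2, hm]
    grind
  replace hc : ∀ x < k + 2, m₂ (tp + (k + 2) + x) = m (tp + x) := by
    intro x hx
    rw [hc x hx, hm]
    grind
  clear hm
  have e4 := hf 4 (by omega) (by omega)
  have e10 := hf 10 (by omega) (by omega)
  have e12 := hf 12 (by omega) (by omega)
  have e31 := hf 31 (by omega) (by omega)
  have e32 := hf 32 (by omega) (by omega)
  have e34 := hf 34 (by omega) (by omega)
  have c1 := hc 1 (by omega)
  have ci : m₂ (tp + (k + 2) + 2 + i) = m (tp + 2 + i) := by
    simpa only [add_assoc] using hc (2 + i) (by omega)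
  repeat first
    | apply WP.block_cons | apply WP.block_one | apply WP.add | apply WP.load | apply WP.store
    | intro _
  refine hQ _ _ (by omega) ?_ ?_ ?_ ?_ ?_ ?_
  · intro c h1 h2 h3 h4
    rw [← hf c h1 h4]
    simp only [Function.update_apply] at *
    grind (splits := 40)
  · simp only [Function.update_apply] at *
    grind (splits := 40)
  · simp only [Function.update_apply] at *
    grind (splits := 40)
  · simp only [Function.update_apply] at *
    grind (splits := 40)
  · simp only [Function.update_apply] at *
    grind (splits := 40)
  · intro x hx
    have cx : m₂ (tp + (k + 2) + 2 + x) = m (tp + 2 + x) := by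
      simpa only [add_assoc] using hc (2 + x) (by omega)
    rw [← cx]
    simp only [Function.update_apply] at *
    grind (splits := 40)

theorem monotone_fin_iff {k : ℕ} {a : Fin k → ℕ} {F : ℕ → ℕ} (hF : ∀ x : Fin k, F x = a x) :
    Monotone a ↔ ∀ x, x + 1 < k → F x ≤ F (x + 1) := by
  cases k with
  | zero => exact ⟨fun _ x hx => by omega, fun _ x => x.elim0⟩
  | succ k =>
    rw [Fin.monotone_iff_le_succ]
    constructor
    · intro h x hx
      have := h ⟨x, by omega⟩
      rw [← hF, ← hF] at this
      simpa using this
    · intro h x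
      rw [← hF, ← hF]
      simpa using h x (by omega)

theorem oracle_ne_zero_iff {X : Finset (Fin (P.univSize I))} :
    P.oracle I X ≠ 0 ↔ P.YesOn I X := by
  unfold WitnessProblem.oracle
  split_ifs with h <;> simp [h]

/-- The oracle answer, cleared if the tuple is unsorted, decides `Good`. The three implications in
`hQ` are the three cases of `searchStep` for a fully halved node. -/
theorem wp_checkProg {n k tp lp bx j : ℕ} {f : Fin n → ℕ} {a : Fin k → ℕ}
    {Wit : Finset (Finset (Fin n))} (hn : n = P.univSize I)
    (hWit : ∀ X : Finset (Fin (P.univSize I)), P.YesOn I X ↔ ∃ W ∈ Wit, ∀ u ∈ W, Fin.cast hn u ∈ X)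
    (h0 : m 0 = n) (h1 : m 1 = k) (h4 : m 4 = 1)
    (h7 : m 7 = bx) (h8 : m 8 = lp) (h18 : m 18 = 0) (h31 : m 31 = tp) (h33 : m 33 = j)
    (h34 : m 34 = 2 ^ j) (h35 : m 35 = tp + 2)
    (hbx : 64 ≤ bx) (hlp : bx + n ≤ lp) (htp : lp + n ≤ tp)
    (hf : ∀ u : Fin n, m (lp + u) = f u) (ha : ∀ x : Fin k, m (tp + 2 + x) = a x)
    (hQ : ∀ m' t' X, t' ≤ t + (n * (10 * k + 9) + n + 8 * k + 16) →
      (∀ c, ¬ (20 ≤ c ∧ c < 30) → ¬ (bx ≤ c ∧ c < bx + n) → c ≠ 10 → c ≠ 11 → c ≠ 36 → c ≠ tp →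
        c ≠ tp + 1 → m' c = m c) →
      (Good Wit f j a → j ≠ 0 → m' tp = 0 ∧ m' (tp + 1) = j - 1 ∧ m' 10 = m 10 ∧ m' 11 = m 11) →
      (Good Wit f j a → j = 0 → m' 10 = tp ∧ m' 11 = m 11 + 1) →
      (¬ Good Wit f j a → m' 10 = tp ∧ m' 11 = m 11) → Q ⟨m', t', X :: l⟩) :
    WP P I checkProg Q ⟨m, t, l⟩ := by
  unfold checkProg
  apply WP.block_cons
  refine wp_coverProg h0 h1 h4 h7 h8 h18 h34 h35 hbx hlp (by omega) ?_
  intro m₁ t₁ ht₁ hf₁ hx₁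
  apply WP.block_cons
  apply WP.query
  intro v X hX hv
  apply WP.block_cons
  refine WP.rename fun m₂ hm => ?_
  simp only [Function.update_apply] at hm
  have e : ∀ c, ¬ (20 ≤ c ∧ c < 30) → ¬ (bx ≤ c ∧ c < bx + n) → c ≠ 36 → m₂ c = m c := by
    intro c h1 h2 h3
    rw [hm, if_neg h3, hf₁ c h1 h2]
  refine wp_sortedProg (k := k) (ab := tp + 2) (by rw [e] <;> omega) (by rw [e] <;> omega)
    (by rw [e] <;> omega) (by rw [e] <;> omega) (by omega) ?_
  intro m₃ t₃ ht₃ hf₃ hs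
  have hgood : m₃ 36 ≠ 0 ↔ Good Wit f j a := by
    rw [hs, hm, if_pos rfl, hv, oracle_ne_zero_iff, hWit, Good, and_comm]
    have hF : ∀ x : Fin k, m₂ (tp + 2 + x) = a x := fun x => by
      rw [e _ (by omega) (by omega) (by omega), ha]
    rw [← monotone_fin_iff (F := fun x => m₂ (tp + 2 + x)) hF]
    refine and_congr_right fun _ => exists_congr fun W => and_congr_right fun _ =>
      forall_congr' fun u => imp_congr_right fun _ => ?_
    have h7' : m₁ 7 = bx := by rw [hf₁ 7 (by omega) (by omega), h7]
    rw [hX, storedSet, Finset.mem_filter, h7', Fin.val_cast, hx₁ u u.2, hf]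
    simp only [Finset.mem_univ, true_and]
    constructor
    · rintro ⟨x, hx, h⟩
      exact ⟨⟨x, hx⟩, by rw [← ha]; exact h⟩
    · rintro ⟨x, h⟩
      exact ⟨x, x.2, by rw [ha]; exact h⟩
  replace hf₃ : ∀ c, ¬ (20 ≤ c ∧ c < 30) → ¬ (bx ≤ c ∧ c < bx + n) → c ≠ 36 → m₃ c = m c := by
    intro c h1 h2 h3
    rw [hf₃ c h1 h3, e c h1 h2 h3]
  have e4 := hf₃ 4 (by omega) (by omega) (by omega)
  have e10 := hf₃ 10 (by omega) (by omega) (by omega)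
  have e11 := hf₃ 11 (by omega) (by omega) (by omega)
  have e18 := hf₃ 18 (by omega) (by omega) (by omega)
  have e31 := hf₃ 31 (by omega) (by omega) (by omega)
  have e33 := hf₃ 33 (by omega) (by omega) (by omega)
  clear hs hm hx₁ e hWit ha hf hX hv hf₁
  generalize Good Wit f j a = G at *
  subst hn
  apply WP.block_one
  apply WP.cond
  · intro h36
    apply WP.cond
    · intro h33'
      repeat first
        | apply WP.block_cons | apply WP.block_one | apply WP.add | apply WP.load | apply WP.store
        | apply WP.sub | intro _
      refine hQ _ _ _ (by omega) ?_ ?_ ?_ ?_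
      · intro c g1 g2 g3 g4 g5 g6 g7
        rw [← hf₃ c g1 g2 g5]
        simp only [Function.update_apply] at *
        grind (splits := 40)
      all_goals
        simp only [Function.update_apply] at *
        grind (splits := 40)
    · intro h33'
      repeat first
        | apply WP.block_cons | apply WP.block_one | apply WP.add | intro _
      refine hQ _ _ _ (by omega) ?_ ?_ ?_ ?_
      · intro c g1 g2 g3 g4 g5 g6 g7
        rw [← hf₃ c g1 g2 g5]
        simp only [Function.update_apply] at *
        grind (splits := 40)
      all_goals
        simp only [Function.update_apply] at *
        grind (splits := 40)
  · intro h36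
    repeat first
      | apply WP.block_cons | apply WP.block_one | apply WP.add | intro _
    refine hQ _ _ _ (by omega) ?_ ?_ ?_ ?_
    · intro c g1 g2 g3 g4 g5 g6 g7
      rw [← hf₃ c g1 g2 g5]
      simp only [Function.update_apply] at *
      grind (splits := 40)
    all_goals
      simp only [Function.update_apply] at *
      grind (splits := 40)

/-- The cells from `p` on describe the node `v`. -/
def NodeAt {k : ℕ} (m : ℕ → ℕ) (p : ℕ) (v : Node k) : Prop :=
  m p = v.i ∧ m (p + 1) = v.j ∧ ∀ x : Fin k, m (p + 2 + x) = v.a x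

/-- The cells from `bs` on describe the stack, with its first entry on top. -/
def StackAt {k : ℕ} (m : ℕ → ℕ) (bs : ℕ) : List (Node k) → Prop
  | [] => True
  -- A node occupies `k + 2` cells and the stack grows upwards, so the nodes of `st` lie below `v`.
  | v :: st => NodeAt m (bs + st.length * (k + 2)) v ∧ StackAt m bs st

theorem StackAt.congr {k : ℕ} {m m' : ℕ → ℕ} {bs : ℕ} {st : List (Node k)}
    (h : ∀ c, bs ≤ c → c < bs + st.length * (k + 2) → m' c = m c) (hs : StackAt m bs st) :
    StackAt m' bs st := by
  induction st with
  | nil => trivial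
  | cons v st ih =>
    rw [List.length_cons, add_mul, one_mul] at h
    refine ⟨⟨?_, ?_, fun x => ?_⟩, ih (fun c h1 h2 => h c h1 (by omega)) hs.2⟩
    · rw [h _ (by omega) (by omega), hs.1.1]
    · rw [h _ (by omega) (by omega), hs.1.2.1]
    · rw [h _ (by omega) (by omega), hs.1.2.2]

/-- The registers, the table of powers and the labels `f` are in place. -/
structure Env (m : ℕ → ℕ) (n k L bx lp bs : ℕ) (f : Fin n → ℕ) : Prop where
  r0 : m 0 = n
  r1 : m 1 = k
  r4 : m 4 = 1
  r5 : m 5 = L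
  r7 : m 7 = bx
  r8 : m 8 = lp
  r9 : m 9 = bs
  r12 : m 12 = k + 2
  r16 : m 16 = 64
  r18 : m 18 = 0
  pow : ∀ j ≤ L, m (64 + j) = 2 ^ j
  lab : ∀ u : Fin n, m (lp + u) = f u
  hbx : 64 + L < bx
  hlp : bx + n ≤ lp
  hbs : lp + n ≤ bs

theorem Env.congr {m m' : ℕ → ℕ} {n k L bx lp bs : ℕ} {f : Fin n → ℕ}
    (h : Env m n k L bx lp bs f)
    (hm : ∀ c, (c < 13 ∧ c ≠ 10 ∧ c ≠ 11) ∨ (15 ≤ c ∧ c < 19) ∨ (64 ≤ c ∧ c < bx) ∨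
      (bx + n ≤ c ∧ c < bs) → m' c = m c) : Env m' n k L bx lp bs f := by
  obtain ⟨h0, h1, h4, h5, h7, h8, h9, h12, h16, h18, hp, hl, hbx, hlp, hbs⟩ := h
  constructor
  iterate 10 rw [hm _ (by omega)]; assumption
  · intro j hj
    rw [hm _ (by omega), hp j hj]
  · intro u
    rw [hm _ (by omega), hl u]
  all_goals assumption

/-- The program simulates `searchStep` on the stored stack at the price of at most one query. -/
theorem wp_stepProg {n k L lp bx bs c : ℕ} {f : Fin n → ℕ} {v : Node k} {st : List (Node k)}
    {Wit : Finset (Finset (Fin n))} (hn : n = P.univSize I)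
    (hWit : ∀ X : Finset (Fin (P.univSize I)), P.YesOn I X ↔ ∃ W ∈ Wit, ∀ u ∈ W, Fin.cast hn u ∈ X)
    (hE : Env m n k L bx lp bs f) (hj : v.j ≤ L) (hst : StackAt m bs (v :: st))
    (h10 : m 10 = bs + (st.length + 1) * (k + 2)) (h11 : m 11 = c)
    (hQ : ∀ m' t' l', t' ≤ t + (n * (10 * k + 9) + n + 8 * k + 40) →
      l'.length ≤ l.length + 1 →
      (∀ c, (c < 10 ∨ 12 ≤ c ∧ c < 20 ∨ 40 ≤ c ∧ c < bx ∨ bx + n ≤ c ∧ c < bs) → m' c = m c) →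
      StackAt m' bs (searchStep (Good Wit f) (v :: st, c)).1 →
      m' 10 = bs + (searchStep (Good Wit f) (v :: st, c)).1.length * (k + 2) →
      m' 11 = (searchStep (Good Wit f) (v :: st, c)).2 → Q ⟨m', t', l'⟩) :
    WP P I stepProg Q ⟨m, t, l⟩ := by
  obtain ⟨r0, r1, r4, r5, r7, r8, r9, r12, r16, r18, hpow, hlab, hbx, hlp, hbs⟩ := hE
  obtain ⟨⟨hvi, hvj, hva⟩, hrest⟩ := hst
  obtain ⟨vi, vj, va⟩ := v
  simp only at hvi hvj hva hj
  obtain ⟨tp, htp⟩ : ∃ tp, tp = bs + st.length * (k + 2) := ⟨_, rfl⟩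
  rw [← htp] at hvi hvj hva
  have h10' : m 10 = tp + (k + 2) := by rw [h10, htp]; ring
  have hpj := hpow vj hj
  have hbt : bs ≤ tp := by omega
  unfold stepProg
  repeat first
    | apply WP.block_cons | apply WP.block_one | apply WP.add | apply WP.load | apply WP.sub
    | intro _
  refine WP.rename fun m₁ hm => ?_
  simp only [Function.update_apply, Nat.reduceEqDiff, reduceIte] at *
  have f31 : m₁ 31 = tp := by rw [hm]; grind (splits := 40)
  have f32 : m₁ 32 = vi := by rw [hm]; grind (splits := 40)
  have f33 : m₁ 33 = vj := by rw [hm]; grind (splits := 40)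
  have f34 : m₁ 34 = 2 ^ vj := by rw [hm]; grind (splits := 40)
  have f35 : m₁ 35 = tp + 2 := by rw [hm]; grind (splits := 40)
  have f20 : m₁ 20 = k - vi := by rw [hm]; grind (splits := 40)
  replace hm : ∀ c, ¬ (20 ≤ c ∧ c < 40) → m₁ c = m c := by
    intro c hc
    rw [hm]
    repeat rw [if_neg (by omega)]
  apply WP.cond
  · intro h20
    have hik : vi < k := by omega
    refine wp_splitProg (k := k) (tp := tp) (i := vi) (w := 2 ^ vj) (by rw [hm] <;> omega)
      (by rw [hm] <;> omega) f31 (by rw [hm] <;> omega) (by rw [hm] <;> omega) f32 f34 hik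
      (by omega) ?_
    intro m₂ t₂ ht₂ hf g10 gtp gsp gsp1 ga
    have hmm : ∀ c, ¬ (20 ≤ c ∧ c < 40) → c ≠ 10 → c ≠ tp →
        ¬ (tp + (k + 2) ≤ c ∧ c < tp + (k + 2) + (k + 2)) → m₂ c = m c := by
      intro c h1 h2 h3 h4
      rw [hf c (by omega) h2 h3 h4, hm c h1]
    have hstep : searchStep (Good Wit f) (⟨vi, vj, va⟩ :: st, c) =
        (⟨vi + 1, vj, bump va vi (2 ^ vj)⟩ :: ⟨vi + 1, vj, va⟩ :: st, c) := by
      simp only [searchStep, if_pos hik]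
    have htp' : bs + (st.length + 1) * (k + 2) = tp + (k + 2) := by rw [htp]; ring
    refine hQ _ _ _ (by omega) (by omega) ?_ ?_ ?_ ?_
    · intro c hc
      exact hmm c (by omega) (by omega) (by omega) (by omega)
    · rw [hstep]
      refine ⟨⟨?_, ?_, fun x => ?_⟩, ⟨?_, ?_, fun x => ?_⟩, ?_⟩
      · simp only [List.length_cons]
        rw [htp', gsp]
      · simp only [List.length_cons]
        rw [htp', gsp1, hm _ (by omega), hvj]
      · simp only [List.length_cons, bump]
        rw [htp', ga x x.2, hm _ (by omega), hva]
      · rw [← htp, gtp]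
      · rw [← htp, hmm _ (by omega) (by omega) (by omega) (by omega), hvj]
      · rw [← htp, hmm _ (by omega) (by omega) (by omega) (by omega), hva]
      · refine hrest.congr fun c h1 h2 => ?_
        exact hmm c (by omega) (by omega) (by omega) (by omega)
    · rw [hstep, g10]
      simp only [List.length_cons]
      rw [htp]
      ring
    · rw [hstep, hmm 11 (by omega) (by omega) (by omega) (by omega), h11]
  · intro h20
    have hik : ¬ vi < k := by omega
    refine wp_checkProg (n := n) (k := k) (tp := tp) (lp := lp) (bx := bx) (j := vj) (f := f)
      (a := va) (Wit := Wit) hn hWit (by rw [hm] <;> omega) (by rw [hm] <;> omega)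
      (by rw [hm] <;> omega) (by rw [hm] <;> omega) (by rw [hm] <;> omega) (by rw [hm] <;> omega)
      f31 f33 f34 f35 (by omega) hlp (by omega)
      (fun u => by rw [hm _ (by omega), hlab]) (fun x => by rw [hm _ (by omega), hva]) ?_
    intro m₂ t₂ X ht₂ hf g1 g2 g3
    have hmm : ∀ c, ¬ (20 ≤ c ∧ c < 40) → ¬ (bx ≤ c ∧ c < bx + n) → c ≠ 10 → c ≠ 11 → c ≠ tp →
        c ≠ tp + 1 → m₂ c = m c := by
      intro c h1 h2 h3 h4 h5 h6
      rw [hf c (by omega) h2 h3 h4 (by omega) h5 h6, hm c h1]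
    have hrest' : StackAt m₂ bs st := hrest.congr fun c h1 h2 =>
      hmm c (by omega) (by omega) (by omega) (by omega) (by omega) (by omega)
    have e10 : m₁ 10 = m 10 := hm 10 (by omega)
    have e11 : m₁ 11 = m 11 := hm 11 (by omega)
    have hframe : ∀ c, (c < 10 ∨ 12 ≤ c ∧ c < 20 ∨ 40 ≤ c ∧ c < bx ∨ bx + n ≤ c ∧ c < bs) →
        m₂ c = m c := fun c hc =>
      hmm c (by omega) (by omega) (by omega) (by omega) (by omega) (by omega)
    by_cases hG : Good Wit f vj va
    · by_cases hj0 : vj = 0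
      · have hstep : searchStep (Good Wit f) (⟨vi, vj, va⟩ :: st, c) = (st, c + 1) := by
          simp only [searchStep, if_neg hik, if_pos hG, if_pos hj0]
        obtain ⟨k1, k2⟩ := g2 hG hj0
        refine hQ _ _ _ (by omega) (by simp) hframe ?_ ?_ ?_
        · rw [hstep]; exact hrest'
        · rw [hstep, k1, htp]
        · rw [hstep, k2, e11, h11]
      · have hstep : searchStep (Good Wit f) (⟨vi, vj, va⟩ :: st, c) =
            (⟨0, vj - 1, va⟩ :: st, c) := by
          simp only [searchStep, if_neg hik, if_pos hG, if_neg hj0]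
        obtain ⟨k1, k2, k3, k4⟩ := g1 hG hj0
        refine hQ _ _ _ (by omega) (by simp) hframe ?_ ?_ ?_
        · rw [hstep]
          refine ⟨⟨?_, ?_, fun x => ?_⟩, hrest'⟩
          · rw [← htp, k1]
          · rw [← htp, k2]
          · rw [← htp, hmm _ (by omega) (by omega) (by omega) (by omega) (by omega) (by omega), hva]
        · rw [hstep, k3, e10, h10, List.length_cons]
        · rw [hstep, k4, e11, h11]
    · have hstep : searchStep (Good Wit f) (⟨vi, vj, va⟩ :: st, c) = (st, c) := by
        simp only [searchStep, if_neg hik, if_neg hG]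
      obtain ⟨k1, k2⟩ := g3 hG
      refine hQ _ _ _ (by omega) (by simp) hframe ?_ ?_ ?_
      · rw [hstep]; exact hrest'
      · rw [hstep, k1, htp]
      · rw [hstep, k2, e11, h11]

/-! ### A complete run, and all runs -/

theorem wp_rootProg {k L bs : ℕ} (h1 : m 1 = k) (h4 : m 4 = 1) (h5 : m 5 = L) (h9 : m 9 = bs)
    (h18 : m 18 = 0) (hbs : 64 ≤ bs)
    (hQ : ∀ m' t', t' ≤ t + (4 * k + 9) →
      (∀ c, ¬ (20 ≤ c ∧ c < 30) → c ≠ 10 → c ≠ 11 → c < bs → m' c = m c) →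
      m' 10 = bs + (k + 2) → m' 11 = 0 → NodeAt m' bs (⟨k, L, 0⟩ : Node k) → Q ⟨m', t', l⟩) :
    WP P I rootProg Q ⟨m, t, l⟩ := by
  unfold rootProg
  repeat first
    | apply WP.block_cons | apply WP.block_one | apply WP.add | apply WP.store | intro _
  refine WP.rename fun m₁ hm => ?_
  simp only [Function.update_apply] at *
  have e20 : m₁ 20 = k := by rw [hm]; grind (splits := 40)
  have e21 : m₁ 21 = bs + 2 := by rw [hm]; grind (splits := 40)
  have eb : m₁ bs = k := by rw [hm]; grind (splits := 40)
  have eb1 : m₁ (bs + 1) = L := by rw [hm]; grind (splits := 40)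
  have hm' : ∀ c, ¬ (20 ≤ c ∧ c < 30) → c < bs → m₁ c = m c := by
    intro c h1 h2
    rw [hm]
    grind (splits := 40)
  have e4 := hm' 4 (by omega) (by omega)
  have e18 := hm' 18 (by omega) (by omega)
  clear hm
  refine WP.loop (fun i s => i + s.mem 20 = k ∧ s.mem 21 = bs + 2 + i ∧
    s.steps ≤ t + 6 + 4 * i ∧ s.queries = l ∧
    (∀ c, ¬ (20 ≤ c ∧ c < 30) → c < bs + 2 → s.mem c = m₁ c) ∧
    ∀ x < i, s.mem (bs + 2 + x) = 0) k (fun i s h => h.1) ?_ ?_ ?_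
  · rintro i m₂ t₂ l₂ hi ⟨g1, g2, g3, g5, g6, g7⟩
    simp only at *
    have e4 := g6 4 (by omega) (by omega)
    have e18 := g6 18 (by omega) (by omega)
    repeat first
      | apply WP.block_cons | apply WP.block_one | apply WP.load | apply WP.store | apply WP.add
      | apply WP.sub | intro _
    simp only [Function.update_apply] at *
    refine ⟨?_, ?_, ?_, ?_, ?_, ?_⟩ <;> grind
  · simp only
    exact ⟨by omega, by omega, by omega, trivial, fun _ _ _ => trivial, fun x hx => by omega⟩
  · rintro m₂ t₂ l₂ ⟨g1, g2, g3, g5, g6, g7⟩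
    simp only at *
    subst g5
    have e18 := g6 18 (by omega) (by omega)
    have f0 := g6 bs (by omega) (by omega)
    have f1 := g6 (bs + 1) (by omega) (by omega)
    repeat first
      | apply WP.block_cons | apply WP.block_one | apply WP.add | apply WP.const | intro _
    refine hQ _ _ (by omega) ?_ ?_ ?_ ⟨?_, ?_, ?_⟩
    · intro c k1 k2 k3 k4
      rw [← hm' c k1 k4, ← g6 c k1 (by omega)]
      simp only [Function.update_apply] at *
      grind
    · simp only [Function.update_apply] at *
      grind
    · simp only [Function.update_apply] at *
      grind
    · simp only [Function.update_apply] at *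
      grind
    · simp only [Function.update_apply] at *
      grind
    · intro x
      have := g7 x x.2
      simp only [Function.update_apply, Pi.zero_apply] at *
      grind

/-- Levels never grow, so the table of powers up to `2 ^ L` contains every block width needed. -/
theorem searchStep_level {k L : ℕ} {good : ℕ → (Fin k → ℕ) → Prop} {x : List (Node k) × ℕ}
    (hx : ∀ v ∈ x.1, v.j ≤ L) : ∀ v ∈ (searchStep good x).1, v.j ≤ L := by
  obtain ⟨st, c⟩ := x
  cases st with
  | nil => exact hx
  | cons v st =>
    simp only [List.mem_cons, forall_eq_or_imp] at hx
    simp only [searchStep]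
    split_ifs
    · simp only [List.mem_cons, forall_eq_or_imp]
      exact ⟨hx.1, hx.1, hx.2⟩
    · exact hx.2
    · simp only [List.mem_cons, forall_eq_or_imp]
      exact ⟨(Nat.sub_le _ _).trans hx.1, hx.2⟩
    · exact hx.2

/-- A bound on the number of steps of one round of the search. -/
def roundTime (n k : ℕ) : ℕ := n * (10 * k + 9) + n + 8 * k + 44

/-- Each round is one `searchStep`, so the number `B` of rounds also bounds the number of queries.
-/
theorem wp_searchProg {n k L lp bx bs c B : ℕ} {f : Fin n → ℕ} {st : List (Node k)}
    {Wit : Finset (Finset (Fin n))} (hn : n = P.univSize I)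
    (hWit : ∀ X : Finset (Fin (P.univSize I)), P.YesOn I X ↔ ∃ W ∈ Wit, ∀ u ∈ W, Fin.cast hn u ∈ X)
    (hE : Env m n k L bx lp bs f) (hj : ∀ v ∈ st, v.j ≤ L) (hst : StackAt m bs st)
    (h6 : m 6 = B) (h10 : m 10 = bs + st.length * (k + 2)) (h11 : m 11 = c)
    (hQ : ∀ m' t' l', t' ≤ t + (B * roundTime n k + 2) → l'.length ≤ l.length + B →
      (∀ c, (c < 10 ∨ 12 ≤ c ∧ c < 20 ∨ 64 ≤ c ∧ c < bx ∨ bx + n ≤ c ∧ c < bs) → m' c = m c) →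
      m' 10 = bs + ((searchStep (Good Wit f))^[B] (st, c)).1.length * (k + 2) →
      m' 11 = ((searchStep (Good Wit f))^[B] (st, c)).2 → Q ⟨m', t', l'⟩) :
    WP P I searchProg Q ⟨m, t, l⟩ := by
  have hbs : 64 ≤ bs := by have := hE.hbx; have := hE.hlp; have := hE.hbs; omega
  have hbx := hE.hbx
  unfold searchProg
  apply WP.block_cons
  apply WP.add
  intro v hv
  apply WP.block_one
  refine WP.loop (fun i s => i + s.mem 40 = B ∧ s.steps ≤ t + 1 + i * roundTime n k ∧
    s.queries.length ≤ l.length + i ∧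
    (∀ c, (c < 10 ∨ 12 ≤ c ∧ c < 20 ∨ 64 ≤ c ∧ c < bx ∨ bx + n ≤ c ∧ c < bs) →
      s.mem c = m c) ∧
    StackAt s.mem bs ((searchStep (Good Wit f))^[i] (st, c)).1 ∧
    (∀ v ∈ ((searchStep (Good Wit f))^[i] (st, c)).1, v.j ≤ L) ∧
    s.mem 10 = bs + ((searchStep (Good Wit f))^[i] (st, c)).1.length * (k + 2) ∧
    s.mem 11 = ((searchStep (Good Wit f))^[i] (st, c)).2) B (fun i s h => h.1) ?_ ?_ ?_
  · rintro i m₁ t₁ l₁ hi ⟨g1, g2, g3, g4, g5, g6, g7, g8⟩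
    have hlev := searchStep_level (good := Good Wit f) g6
    rw [Function.iterate_succ_apply']
    generalize (searchStep (Good Wit f))^[i] (st, c) = x at *
    obtain ⟨st', c'⟩ := x
    simp only at *
    have hmul : (i + 1) * roundTime n k = i * roundTime n k + roundTime n k := by ring
    have hrt : roundTime n k = n * (10 * k + 9) + n + 8 * k + 44 := rfl
    have e4 : m₁ 4 = 1 := by rw [g4 4 (by omega), hE.r4]
    have e9 : m₁ 9 = bs := by rw [g4 9 (by omega), hE.r9]
    apply WP.block_cons
    apply WP.sub
    intro v₁ hv₁
    apply WP.block_cons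
    have hE' : Env (Function.update m₁ 30 v₁) n k L bx lp bs f := by
      refine hE.congr fun c hc => ?_
      rw [Function.update_of_ne (by omega), g4 c (by omega)]
    have hst' : StackAt (Function.update m₁ 30 v₁) bs st' :=
      g5.congr fun c h1 _ => Function.update_of_ne (by omega) _ _
    apply WP.cond
    · intro h30
      rw [Function.update_self] at h30
      cases st' with
      | nil => simp at g7; omega
      | cons v st' =>
        refine wp_stepProg hn hWit hE' (g6 v (by simp)) hst'
          (by rw [Function.update_of_ne (by omega), g7, List.length_cons])
          (by rw [Function.update_of_ne (by omega), g8]) ?_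
        intro m₂ t₂ l₂ k1 k2 k3 k4 k5 k6
        have k3' : ∀ c, (c < 10 ∨ 12 ≤ c ∧ c < 20 ∨ 40 ≤ c ∧ c < bx ∨ bx + n ≤ c ∧ c < bs) →
            m₂ c = m₁ c := by
          intro c hc
          rw [k3 c hc, Function.update_of_ne (by omega)]
        apply WP.block_one
        apply WP.sub
        intro v₂ hv₂
        have f4 : m₂ 4 = m₁ 4 := k3' 4 (by omega)
        have f40 : m₂ 40 = m₁ 40 := k3' 40 (by omega)
        refine ⟨?_, ?_, ?_, ?_, ?_, hlev, ?_, ?_⟩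
        · simp only [Function.update_self]; omega
        · simp only; omega
        · simp only; omega
        · intro c hc
          simp only
          rw [Function.update_of_ne (by omega), k3' c (by omega), g4 c hc]
        · exact k4.congr fun c h1 _ => Function.update_of_ne (by omega) _ _
        · simp only
          rw [Function.update_of_ne (by omega), k5]
        · simp only
          rw [Function.update_of_ne (by omega), k6]
    · intro h30
      rw [Function.update_self] at h30
      cases st' with
      | cons v st' =>
        rw [List.length_cons, add_mul] at g7
        omega
      | nil =>
        apply WP.const
        apply WP.block_one
        apply WP.sub
        intro v₂ hv₂
        simp only [Function.update_apply] at *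
        refine ⟨?_, ?_, ?_, ?_, trivial, hlev, ?_, ?_⟩
        · grind
        · omega
        · omega
        · intro c hc
          rw [← g4 c hc]
          grind
        · simp only [searchStep]; grind
        · simp only [searchStep]; grind
  · have h18 := hE.r18
    refine ⟨?_, ?_, ?_, ?_, ?_, hj, ?_, ?_⟩
    · simp only [Function.update_self]; omega
    · simp only; omega
    · simp only; omega
    · intro c hc
      exact Function.update_of_ne (by omega) _ _
    · exact hst.congr fun c h1 _ => Function.update_of_ne (by omega) _ _
    · simp only
      rw [Function.update_of_ne (by omega)]
      exact h10
    · simp only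
      rw [Function.update_of_ne (by omega)]
      exact h11
  · rintro m₁ t₁ l₁ ⟨g1, g2, g3, g4, g5, g6, g7, g8⟩
    simp only at *
    exact hQ _ _ _ (by omega) g3 g4 g7 g8

/-- A bound on the number of steps of one run. -/
def runTime (n k B : ℕ) : ℕ := n * (10 * n + 7) + 4 * k + B * roundTime n k + 22

/-- Any result written is exact, whatever the labels are; `Succeeds` is only needed to guarantee
that there is one. -/
theorem wp_runProg {n k L M lp bx bs : ℕ} {f : Fin n → ℕ}
    {Wit : Finset (Finset (Fin n))} (hn : n = P.univSize I)
    (hWit : ∀ X : Finset (Fin (P.univSize I)), P.YesOn I X ↔ ∃ W ∈ Wit, ∀ u ∈ W, Fin.cast hn u ∈ X)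
    (hcard : ∀ W ∈ Wit, W.card = k)
    (hE : Env m n k L bx lp bs f) (hL : ∀ u, f u < 2 ^ L) (h6 : m 6 = budget k L M)
    (hQ : ∀ m' t' l', t' ≤ t + runTime n k (budget k L M) →
      l'.length ≤ l.length + budget k L M →
      (∀ c, (c < 10 ∨ c = 12 ∨ 15 ≤ c ∧ c < 19 ∨ 64 ≤ c ∧ c < bx ∨ bx + n ≤ c ∧ c < bs) →
        m' c = m c) →
      (Succeeds Wit k L M f → m' 13 = 1) →
      (m' 13 = m 13 ∧ m' 14 = m 14) ∨ (m' 13 = 1 ∧ m' 14 = Wit.card) → Q ⟨m', t', l'⟩) :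
    WP P I runProg Q ⟨m, t, l⟩ := by
  have hbs : 64 ≤ bs := by have := hE.hbx; have := hE.hlp; have := hE.hbs; omega
  have hlp : 64 ≤ lp := by have := hE.hbx; have := hE.hlp; have := hE.hbs; omega
  have hbx : 64 < bx := by have := hE.hbx; omega
  have hlp' := hE.hlp
  have hbs' := hE.hbs
  have hlen : runTime n k (budget k L M) =
    n * (10 * n + 7) + 4 * k + budget k L M * roundTime n k + 22 := rfl
  have hinj : Function.Injective f ↔ ∀ u < n, ∀ x < u, m (lp + x) ≠ m (lp + u) := by
    constructor
    · intro h u hu x hx he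
      have e1 := hE.lab ⟨u, hu⟩
      have e2 := hE.lab ⟨x, hx.trans hu⟩
      simp only at e1 e2
      rw [e1, e2] at he
      have := congrArg Fin.val (h he)
      simp only at this
      omega
    · intro h u v huv
      by_contra hne
      have hne' : u.val ≠ v.val := fun h => hne (Fin.ext h)
      rcases Nat.lt_or_gt_of_ne hne' with hlt | hlt
      · exact h v v.2 u hlt (by rw [hE.lab, hE.lab, huv])
      · exact h u u.2 v hlt (by rw [hE.lab, hE.lab, huv])
  unfold runProg
  apply WP.block_cons
  refine wp_distinctProg hE.r0 hE.r4 hE.r8 hE.r18 hlp ?_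
  intro m₁ t₁ ht₁ hf₁ h19
  rw [← hinj] at h19
  have hE₁ : Env m₁ n k L bx lp bs f := hE.congr fun c hc => hf₁ c (by omega) (by omega) (by omega)
  apply WP.block_cons
  refine wp_rootProg hE₁.r1 hE₁.r4 hE₁.r5 hE₁.r9 hE₁.r18 hbs ?_
  intro m₂ t₂ ht₂ hf₂ g10 g11 hroot
  have hE₂ : Env m₂ n k L bx lp bs f :=
    hE₁.congr fun c hc => hf₂ c (by omega) (by omega) (by omega) (by omega)
  apply WP.block_cons
  refine wp_searchProg (B := budget k L M) (st := [⟨k, L, 0⟩]) (c := 0) hn hWit hE₂ (by simp)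
    ⟨by simpa using hroot, trivial⟩
    (by rw [hf₂ 6, hf₁ 6, h6] <;> omega) (by rw [g10]; simp) g11 ?_
  intro m₃ t₃ l₃ ht₃ hl₃ hf₃ h10 h11
  have hspec := searchStep_iterate (Good Wit f) (budget k L M) [⟨k, L, (0 : Fin k → ℕ)⟩] 0
  have hsz : stackSize (Good Wit f) [⟨k, L, (0 : Fin k → ℕ)⟩] =
      treeSize (k := k) (Good Wit f) L 0 0 := by
    simp [stackSize]
  have hcn : Function.Injective f →
      stackCount (Good Wit f) [⟨k, L, (0 : Fin k → ℕ)⟩] = Wit.card := by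
    intro hi
    simp only [stackCount, List.map_cons, List.map_nil, List.sum_cons, List.sum_nil, add_zero,
      Nat.sub_self]
    exact leafCount_root hcard hi hL
  rw [hsz] at hspec
  generalize (searchStep (Good Wit f))^[budget k L M] ([⟨k, L, (0 : Fin k → ℕ)⟩], 0) = x at *
  obtain ⟨st, cnt⟩ := x
  simp only at hspec h10 h11
  have e9 : m₃ 9 = bs := by rw [hf₃ 9 (by omega), hE₂.r9]
  have e18 : m₃ 18 = 0 := by rw [hf₃ 18 (by omega), hE₂.r18]
  have e19 : m₃ 19 = m₁ 19 := by rw [hf₃ 19 (by omega), hf₂] <;> omega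
  have e13 : m₃ 13 = m 13 := by rw [hf₃ 13 (by omega), hf₂, hf₁] <;> omega
  have e14 : m₃ 14 = m 14 := by rw [hf₃ 14 (by omega), hf₂, hf₁] <;> omega
  have hf : ∀ c, (c < 10 ∨ c = 12 ∨ 15 ≤ c ∧ c < 19 ∨ 64 ≤ c ∧ c < bx ∨ bx + n ≤ c ∧ c < bs) →
      m₃ c = m c := by
    intro c hc
    rw [hf₃ c (by omega), hf₂ c (by omega) (by omega) (by omega) (by omega),
      hf₁ c (by omega) (by omega) (by omega)]
  apply WP.block_cons
  apply WP.sub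
  intro v hv
  apply WP.block_one
  apply WP.cond
  · intro h30
    rw [Function.update_self] at h30
    apply WP.const
    refine hQ _ _ _ (by omega) hl₃ ?_ ?_ ?_
    · intro c hc
      rw [Function.update_of_ne (by omega), Function.update_of_ne (by omega), hf c hc]
    · intro hs
      rw [hspec.1 hs.2] at h10
      simp at h10
      omega
    · left
      rw [Function.update_of_ne (by omega), Function.update_of_ne (by omega),
        Function.update_of_ne (by omega), Function.update_of_ne (by omega)]
      exact ⟨e13, e14⟩
  · intro h30
    rw [Function.update_self] at h30
    have hst : st = [] := by
      cases st with
      | nil => rfl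
      | cons v st =>
        rw [List.length_cons, add_mul] at h10
        omega
    subst hst
    apply WP.cond
    · intro h19'
      rw [Function.update_of_ne (by omega), e19] at h19'
      have hi := h19.1 h19'
      have hc : cnt = Wit.card := by
        have := hspec.2
        rw [hcn hi] at this
        simpa [stackCount] using this
      apply WP.block_cons
      apply WP.const
      apply WP.block_one
      apply WP.add
      intro v₂ hv₂
      simp only [Function.update_apply] at hv₂
      refine hQ _ _ _ (by omega) hl₃ ?_ ?_ ?_
      · intro c hc
        rw [Function.update_of_ne (by omega), Function.update_of_ne (by omega),
          Function.update_of_ne (by omega), hf c hc]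
      · intro _
        rw [Function.update_of_ne (by omega), Function.update_self]
      · right
        rw [Function.update_of_ne (by omega), Function.update_self, Function.update_self]
        refine ⟨rfl, ?_⟩
        simp at hv₂
        omega
    · intro h19'
      rw [Function.update_of_ne (by omega), e19] at h19'
      apply WP.const
      refine hQ _ _ _ (by omega) hl₃ ?_ ?_ ?_
      · intro c hc
        rw [Function.update_of_ne (by omega), Function.update_of_ne (by omega), hf c hc]
      · intro hs
        exact absurd h19' (h19.2 hs.1)
      · left
        rw [Function.update_of_ne (by omega), Function.update_of_ne (by omega),
          Function.update_of_ne (by omega), Function.update_of_ne (by omega)]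
        exact ⟨e13, e14⟩

/-- No probability enters: for all labels the output is "More than `M`" or the exact number, the
latter only up to `M`. If the number is at most `M`, a single successful run suffices to output it.
-/
theorem wp_runsProg {n k L M R lp bx bs : ℕ} {F : ℕ → Fin n → ℕ}
    {Wit : Finset (Finset (Fin n))} (hn : n = P.univSize I)
    (hWit : ∀ X : Finset (Fin (P.univSize I)), P.YesOn I X ↔ ∃ W ∈ Wit, ∀ u ∈ W, Fin.cast hn u ∈ X)
    (hcard : ∀ W ∈ Wit, W.card = k)
    (hE : Env m n k L bx lp bs (F 0)) (hbs : bs = lp + R * n)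
    (h2 : m 2 = M) (h3 : m 3 = R) (h6 : m 6 = budget k L M)
    (h13 : m 13 = 0) (hlab : ∀ i < R, ∀ u : Fin n, m (lp + i * n + u) = F i u)
    (hL : ∀ i < R, ∀ u, F i u < 2 ^ L)
    (hQ : ∀ m' t' l', t' ≤ t + (R * (runTime n k (budget k L M) + 3) + 6) →
      l'.length ≤ l.length + R * budget k L M →
      (m' 0 = 0 ∨ m' 0 = 1 ∧ m' 1 = Wit.card ∧ Wit.card ≤ M) →
      (Wit.card ≤ M → (∃ i < R, Succeeds Wit k L M (F i)) → m' 0 = 1) → Q ⟨m', t', l'⟩) :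
    WP P I runsProg Q ⟨m, t, l⟩ := by
  have hbx := hE.hbx
  have hlp := hE.hlp
  unfold runsProg
  apply WP.block_cons
  refine WP.loop (fun i s => i + s.mem 3 = R ∧
    s.steps ≤ t + i * (runTime n k (budget k L M) + 3) ∧
    s.queries.length ≤ l.length + i * budget k L M ∧
    (∀ c, (c < 8 ∧ c ≠ 3 ∨ c = 9 ∨ c = 12 ∨ 15 ≤ c ∧ c < 19 ∨ 64 ≤ c ∧ c < bx ∨
      bx + n ≤ c ∧ c < bs) → s.mem c = m c) ∧
    s.mem 8 = lp + i * n ∧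
    ((s.mem 13 = 0 ∧ ∀ i' < i, ¬ Succeeds Wit k L M (F i')) ∨
      (s.mem 13 = 1 ∧ s.mem 14 = Wit.card))) R (fun i s h => h.1) ?_ ?_ ?_
  · rintro i m₁ t₁ l₁ hi ⟨g1, g2, g3, g4, g5, g6⟩
    simp only at *
    have hin : (i + 1) * n ≤ R * n := Nat.mul_le_mul_right n hi
    have hin' : (i + 1) * n = i * n + n := by ring
    have hE₁ : Env m₁ n k L bx (lp + i * n) bs (F i) := by
      constructor
      · rw [g4 _ (by omega), hE.r0]
      · rw [g4 _ (by omega), hE.r1]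
      · rw [g4 _ (by omega), hE.r4]
      · rw [g4 _ (by omega), hE.r5]
      · rw [g4 _ (by omega), hE.r7]
      · exact g5
      · rw [g4 _ (by omega), hE.r9]
      · rw [g4 _ (by omega), hE.r12]
      · rw [g4 _ (by omega), hE.r16]
      · rw [g4 _ (by omega), hE.r18]
      · intro j hj
        rw [g4 _ (by omega), hE.pow j hj]
      · intro u
        rw [g4 _ (by omega), hlab i hi]
      · omega
      · omega
      · omega
    apply WP.block_cons
    refine wp_runProg (M := M) hn hWit hcard hE₁ (hL i hi) (by rw [g4 6 (by omega), h6]) ?_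
    intro m₂ t₂ l₂ ht₂ hl₂ hf hsuc hres
    have e0 : m₂ 0 = n := by rw [hf 0 (by omega), hE₁.r0]
    have e3 : m₂ 3 = m₁ 3 := by rw [hf 3 (by omega)]
    have e4 : m₂ 4 = 1 := by rw [hf 4 (by omega), hE₁.r4]
    have e8 : m₂ 8 = lp + i * n := by rw [hf 8 (by omega), hE₁.r8]
    apply WP.block_cons
    apply WP.add
    intro v₁ hv₁
    apply WP.block_one
    apply WP.sub
    intro v₂ hv₂
    rw [Function.update_of_ne (by omega), Function.update_of_ne (by omega)] at hv₂
    refine ⟨?_, ?_, ?_, ?_, ?_, ?_⟩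
    · simp only [Function.update_self]
      omega
    · simp only
      rw [add_mul i 1, one_mul]
      omega
    · simp only
      rw [add_mul, one_mul]
      omega
    · intro c hc
      simp only
      rw [Function.update_of_ne (by omega), Function.update_of_ne (by omega), hf c (by omega),
        g4 c hc]
    · simp only
      rw [Function.update_of_ne (by omega), Function.update_self]
      omega
    · simp only
      rw [Function.update_of_ne (by omega), Function.update_of_ne (by omega),
        Function.update_of_ne (by omega), Function.update_of_ne (by omega)]
      rcases hres with ⟨k1, k2⟩ | hres
      · rw [k2]
        rcases g6 with ⟨q1, q2⟩ | q
        · left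
          refine ⟨by omega, fun i' hi' => ?_⟩
          rcases Nat.lt_succ_iff_lt_or_eq.1 hi' with h | rfl
          · exact q2 i' h
          · intro hs
            have := hsuc hs
            omega
        · right
          exact ⟨by omega, q.2⟩
      · exact Or.inr hres
  · refine ⟨by simp only; omega, by simp only; omega, by simp only; omega, fun _ _ => rfl, ?_, ?_⟩
    · simp only
      rw [hE.r8]
      ring
    · exact Or.inl ⟨h13, fun i hi => by omega⟩
  · rintro m₁ t₁ l₁ ⟨g1, g2, g3, g4, g5, g6⟩
    simp only at *
    have e2 : m₁ 2 = M := by rw [g4 2 (by omega), h2]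
    have e18 : m₁ 18 = 0 := by rw [g4 18 (by omega), hE.r18]
    apply WP.block_cons
    apply WP.sub
    intro v hv
    apply WP.block_one
    apply WP.cond
    · intro k13
      rw [Function.update_of_ne (by omega)] at k13
      have g : m₁ 13 = 1 ∧ m₁ 14 = Wit.card := by
        rcases g6 with g | g
        · omega
        · exact g
      apply WP.cond
      · intro k20
        rw [Function.update_self] at k20
        apply WP.const
        refine hQ _ _ _ (by omega) g3 (Or.inl (Function.update_self _ _ _)) ?_
        intro hle
        omega
      · intro k20
        rw [Function.update_self] at k20
        apply WP.block_cons
        apply WP.const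
        apply WP.block_one
        apply WP.add
        intro v' hv'
        rw [Function.update_of_ne (by omega), Function.update_of_ne (by omega),
          Function.update_of_ne (by omega), Function.update_of_ne (by omega)] at hv'
        have k0 : Function.update (Function.update (Function.update m₁ 20 v) 0 1) 1 v' 0 = 1 := by
          rw [Function.update_of_ne (by omega), Function.update_self]
        refine hQ _ _ _ (by omega) g3 (Or.inr ⟨k0, ?_, by omega⟩) fun _ _ => k0
        rw [Function.update_self]
        omega
    · intro k13
      rw [Function.update_of_ne (by omega)] at k13
      apply WP.const
      refine hQ _ _ _ (by omega) g3 (Or.inl (Function.update_self _ _ _)) ?_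
      rintro - ⟨i, hi, hs⟩
      rcases g6 with g | g
      · exact absurd hs (g.2 i hi)
      · omega

/-! ### Computations before the labels are chosen -/

theorem wp_levelsProg {n : ℕ} (hn : 1 ≤ n) (h0 : m 0 = n) (h5 : m 5 = 0) (h18 : m 18 = 0)
    (hQ : ∀ m' t' e, t' ≤ t + (6 * n + 7) → n ≤ 2 ^ e → 2 ^ e < 2 * n →
      (∀ c, ¬ (20 ≤ c ∧ c < 30) → c ≠ 4 → c ≠ 5 → c ≠ 16 → m' c = m c) →
      m' 4 = 1 → m' 16 = 64 → m' 5 = 4 * e → Q ⟨m', t', l⟩) :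
    WP P I levelsProg Q ⟨m, t, l⟩ := by
  unfold levelsProg
  repeat first
    | apply WP.block_cons | apply WP.block_one | apply WP.add | apply WP.const | intro _
  refine WP.loop (fun i s => i + s.mem 21 = n ∧ s.mem 20 = 2 ^ s.mem 5 ∧
    (n ≤ s.mem 20 ∨ s.mem 5 = i) ∧ s.mem 20 < 2 * n ∧ s.mem 4 = 1 ∧ s.mem 16 = 64 ∧
    s.steps ≤ t + 4 + 6 * i ∧ s.queries = l ∧
    (∀ c, ¬ (20 ≤ c ∧ c < 30) → c ≠ 4 → c ≠ 5 → c ≠ 16 → s.mem c = m c)) n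
    (fun i s h => h.1) ?_ ?_ ?_
  · rintro i m₁ t₁ l₁ hi ⟨g1, g2, g3, g4, g5, g6, g7, g8, g9⟩
    simp only at *
    have e0 := g9 0 (by omega) (by omega) (by omega) (by omega)
    have e : 2 ^ (m₁ 5 + 1) = 2 ^ m₁ 5 + 2 ^ m₁ 5 := by ring
    repeat' first
      | apply WP.block_cons | apply WP.block_one | apply WP.add | apply WP.sub | apply WP.const
      | apply WP.cond | intro _
    all_goals
      simp only [Function.update_apply] at *
      refine ⟨?_, ?_, ?_, ?_, ?_, ?_, ?_, ?_, ?_⟩ <;> grind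
  · simp only [Function.update_apply] at *
    refine ⟨?_, ?_, ?_, ?_, ?_, ?_, ?_, ?_, ?_⟩ <;> grind
  · rintro m₁ t₁ l₁ ⟨g1, g2, g3, g4, g5, g6, g7, g8, g9⟩
    simp only at *
    subst g8
    repeat first
      | apply WP.block_cons | apply WP.block_one | apply WP.add | intro _
    refine hQ _ _ (m₁ 5) (by omega) ?_ (by omega) ?_ ?_ ?_ ?_
    -- If `n` has not been reached, every one of the `n` rounds was a doubling, so `e = n` and `n <
    -- 2 ^ n`.
    · rcases g3 with g3 | g3
      · omega
      · rw [g3]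
        exact Nat.lt_two_pow_self.le
    all_goals
      simp only [Function.update_apply] at *
      grind

theorem wp_powersProg {L : ℕ} (h4 : m 4 = 1) (h5 : m 5 = L) (h18 : m 18 = 0)
    (hQ : ∀ m' t', t' ≤ t + (5 * L + 7) →
      (∀ c, ¬ (20 ≤ c ∧ c < 30) → c ≠ 7 → c ≠ 17 → ¬ (64 ≤ c ∧ c < 65 + L) → m' c = m c) →
      m' 7 = 65 + L → m' 17 = 2 ^ L - 1 → (∀ j ≤ L, m' (64 + j) = 2 ^ j) → Q ⟨m', t', l⟩) :
    WP P I powersProg Q ⟨m, t, l⟩ := by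
  unfold powersProg
  repeat first
    | apply WP.block_cons | apply WP.block_one | apply WP.add | apply WP.const | apply WP.store
    | intro _
  refine WP.loop (fun i s => i + s.mem 22 = L ∧ s.mem 20 = 2 ^ i ∧ s.mem 21 = 64 + i ∧
    s.steps ≤ t + 4 + 5 * i ∧ s.queries = l ∧
    (∀ c, ¬ (20 ≤ c ∧ c < 30) → ¬ (64 ≤ c ∧ c < 65 + i) → s.mem c = m c) ∧
    (∀ j ≤ i, s.mem (64 + j) = 2 ^ j)) L
    (fun i s h => h.1) ?_ ?_ ?_
  · rintro i m₁ t₁ l₁ hi ⟨g1, g2, g3, g4, g5, g6, g7⟩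
    simp only at *
    have e0 := g6 4 (by omega) (by omega)
    have e : 2 ^ (i + 1) = 2 ^ i + 2 ^ i := by ring
    repeat first
      | apply WP.block_cons | apply WP.block_one | apply WP.add | apply WP.sub | apply WP.store
      | intro _
    simp only [Function.update_apply] at *
    refine ⟨?_, ?_, ?_, ?_, ?_, ?_, ?_⟩
    · grind
    · grind
    · grind
    · grind
    · grind
    · grind
    · intro j hj
      rcases Nat.le_succ_iff.1 hj with hj | rfl
      · have := g7 j hj
        grind
      · grind
  · simp only [Function.update_apply] at *
    refine ⟨?_, ?_, ?_, ?_, ?_, ?_, ?_⟩ <;> grind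
  · rintro m₁ t₁ l₁ ⟨g1, g2, g3, g4, g5, g6, g7⟩
    simp only at *
    subst g5
    have e0 := g6 4 (by omega) (by omega)
    repeat first
      | apply WP.block_cons | apply WP.block_one | apply WP.add | apply WP.sub | intro _
    refine hQ _ _ (by omega) ?_ ?_ ?_ ?_
    · intro c k1 k2 k3 k4
      rw [← g6 c k1 k4]
      simp only [Function.update_apply] at *
      grind
    · simp only [Function.update_apply] at *
      grind
    · simp only [Function.update_apply] at *
      grind
    · intro j hj
      rw [← g7 j hj]
      simp only [Function.update_apply] at *
      grind

theorem wp_addressProg {n k R bx : ℕ} (h0 : m 0 = n) (h1 : m 1 = k) (h3 : m 3 = R)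
    (h4 : m 4 = 1) (h7 : m 7 = bx) (h18 : m 18 = 0)
    (hQ : ∀ m' t', t' ≤ t + (3 * R + 6) →
      (∀ c, ¬ (20 ≤ c ∧ c < 30) → c ≠ 8 → c ≠ 9 → c ≠ 12 → m' c = m c) →
      m' 8 = bx + n → m' 9 = bx + n + R * n → m' 12 = k + 2 → Q ⟨m', t', l⟩) :
    WP P I addressProg Q ⟨m, t, l⟩ := by
  unfold addressProg
  repeat first
    | apply WP.block_cons | apply WP.block_one | apply WP.add | intro _
  refine WP.loop (fun i s => i + s.mem 22 = R ∧ s.mem 8 = bx + n ∧ s.mem 9 = bx + n + i * n ∧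
    s.steps ≤ t + 3 + 3 * i ∧ s.queries = l ∧
    (∀ c, ¬ (20 ≤ c ∧ c < 30) → c ≠ 8 → c ≠ 9 → c ≠ 12 → s.mem c = m c)) R
    (fun i s h => h.1) ?_ ?_ ?_
  · rintro i m₁ t₁ l₁ hi ⟨g1, g2, g3, g4, g5, g6⟩
    simp only at *
    have e0 := g6 0 (by omega) (by omega) (by omega) (by omega)
    have e4 := g6 4 (by omega) (by omega) (by omega) (by omega)
    have e : (i + 1) * n = i * n + n := by ring
    rw [e]
    repeat first
      | apply WP.block_cons | apply WP.block_one | apply WP.add | apply WP.sub | intro _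
    simp only [Function.update_apply] at *
    refine ⟨?_, ?_, ?_, ?_, ?_, ?_⟩ <;> grind
  · simp only [Function.update_apply, zero_mul] at *
    refine ⟨?_, ?_, ?_, ?_, ?_, ?_⟩ <;> grind
  · rintro m₁ t₁ l₁ ⟨g1, g2, g3, g4, g5, g6⟩
    simp only at *
    subst g5
    have e1 := g6 1 (by omega) (by omega) (by omega) (by omega)
    have e4 := g6 4 (by omega) (by omega) (by omega) (by omega)
    repeat first
      | apply WP.block_cons | apply WP.block_one | apply WP.add | intro _
    refine hQ _ _ (by omega) ?_ ?_ ?_ ?_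
    · intro c k1 k2 k3 k4
      rw [← g6 c k1 k2 k3 k4]
      simp only [Function.update_apply] at *
      grind
    all_goals
      simp only [Function.update_apply] at *
      grind

theorem wp_budgetProg {k L M : ℕ} (h1 : m 1 = k) (h2 : m 2 = M) (h4 : m 4 = 1) (h5 : m 5 = L)
    (h6 : m 6 = 0) (h18 : m 18 = 0)
    (hQ : ∀ m' t', t' ≤ t + (3 * L + 7 * k + 11) →
      (∀ c, ¬ (20 ≤ c ∧ c < 30) → c ≠ 6 → m' c = m c) →
      m' 6 = budget k L M → Q ⟨m', t', l⟩) :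
    WP P I budgetProg Q ⟨m, t, l⟩ := by
  unfold budgetProg
  repeat first
    | apply WP.block_cons | apply WP.block_one | apply WP.add | intro _
  refine WP.loop (fun i s => i + s.mem 22 = L + 1 ∧ s.mem 6 = i * M ∧
    s.steps ≤ t + 1 + 3 * i ∧ s.queries = l ∧
    (∀ c, ¬ (20 ≤ c ∧ c < 30) → c ≠ 6 → s.mem c = m c)) (L + 1)
    (fun i s h => h.1) ?_ ?_ ?_
  · rintro i m₁ t₁ l₁ hi ⟨g1, g2, g3, g4, g5⟩
    simp only at *
    have e2 := g5 2 (by omega) (by omega)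
    have e4 := g5 4 (by omega) (by omega)
    have e : (i + 1) * M = i * M + M := by ring
    rw [e]
    repeat first
      | apply WP.block_cons | apply WP.block_one | apply WP.add | apply WP.sub | intro _
    simp only [Function.update_apply] at *
    refine ⟨?_, ?_, ?_, ?_, ?_⟩ <;> grind
  · simp only [Function.update_apply, zero_mul] at *
    refine ⟨?_, ?_, ?_, ?_, ?_⟩ <;> grind
  · rintro m₁ t₁ l₁ ⟨g1, g2, g3, g4, g5⟩
    simp only at *
    subst g4
    have e1 := g5 1 (by omega) (by omega)
    have e18 := g5 18 (by omega) (by omega)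
    repeat first
      | apply WP.block_cons | apply WP.block_one | apply WP.add | intro _
    refine WP.loop (fun i s => i + s.mem 22 = k ∧ s.mem 6 = 32 ^ i * ((L + 1) * M) ∧
      s.steps ≤ t + 6 + 3 * L + 7 * i ∧ s.queries = l₁ ∧
      (∀ c, ¬ (20 ≤ c ∧ c < 30) → c ≠ 6 → s.mem c = m c)) k
      (fun i s h => h.1) ?_ ?_ ?_
    · rintro i m₂ t₂ l₂ hi ⟨q1, q2, q3, q4, q5⟩
      simp only at *
      have e4 := q5 4 (by omega) (by omega)
      have e : 32 ^ (i + 1) * ((L + 1) * M) = 32 * (32 ^ i * ((L + 1) * M)) := by ring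
      rw [e, ← q2]
      repeat first
        | apply WP.block_cons | apply WP.block_one | apply WP.add | apply WP.sub | intro _
      simp only [Function.update_apply] at *
      refine ⟨?_, ?_, ?_, ?_, ?_⟩ <;> grind
    · simp only [Function.update_apply, pow_zero, one_mul] at *
      refine ⟨?_, ?_, ?_, ?_, ?_⟩ <;> grind
    · rintro m₂ t₂ l₂ ⟨q1, q2, q3, q4, q5⟩
      simp only at *
      subst q4
      repeat first
        | apply WP.block_cons | apply WP.block_one | apply WP.add | intro _
      have e : budget k L M = 16 * m₂ 6 := by rw [q2, budget, mul_assoc]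
      refine hQ _ _ (by omega) ?_ ?_
      · intro c k1 k2
        rw [← q5 c k1 k2]
        simp only [Function.update_apply] at *
        grind
      · rw [e]
        simp only [Function.update_apply] at *
        grind

theorem wp_prepareProg {n k M R : ℕ} (hn : 1 ≤ n) (h0 : m 0 = n) (h1 : m 1 = k) (h2 : m 2 = M)
    (h3 : m 3 = R) (hz : ∀ c, 4 ≤ c → m c = 0)
    (hQ : ∀ m' t' e L bx lp bs, t' ≤ t + (6 * n + 8 * L + 7 * k + 3 * R + 33) →
      n ≤ 2 ^ e → 2 ^ e < 2 * n → L = 4 * e → bx = 65 + L → lp = bx + n → bs = lp + R * n →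
      m' 0 = n → m' 1 = k → m' 2 = M → m' 3 = R → m' 4 = 1 → m' 5 = L → m' 6 = budget k L M →
      m' 7 = bx → m' 8 = lp → m' 9 = bs → m' 12 = k + 2 → m' 13 = 0 → m' 16 = 64 →
      m' 17 = 2 ^ L - 1 → m' 18 = 0 → m' 22 = R * n → m' 23 = lp →
      (∀ j ≤ L, m' (64 + j) = 2 ^ j) → Q ⟨m', t', l⟩) :
    WP P I prepareProg Q ⟨m, t, l⟩ := by
  unfold prepareProg
  apply WP.block_cons
  refine wp_levelsProg hn h0 (hz _ (by omega)) (hz _ (by omega)) ?_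
  intro m₁ t₁ e ht₁ he he' hf₁ a4 a16 a5
  apply WP.block_cons
  refine wp_powersProg a4 a5 (by rw [hf₁, hz] <;> omega) ?_
  intro m₂ t₂ ht₂ hf₂ b7 b17 bp
  have c0 : m₂ 0 = n := by rw [hf₂, hf₁] <;> omega
  have c1 : m₂ 1 = k := by rw [hf₂, hf₁] <;> omega
  have c2 : m₂ 2 = M := by rw [hf₂, hf₁] <;> omega
  have c3 : m₂ 3 = R := by rw [hf₂, hf₁] <;> omega
  have c4 : m₂ 4 = 1 := by rw [hf₂] <;> omega
  have c5 : m₂ 5 = 4 * e := by rw [hf₂] <;> omega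
  have c6 : m₂ 6 = 0 := by rw [hf₂, hf₁, hz] <;> omega
  have c13 : m₂ 13 = 0 := by rw [hf₂, hf₁, hz] <;> omega
  have c16 : m₂ 16 = 64 := by rw [hf₂] <;> omega
  have c18 : m₂ 18 = 0 := by rw [hf₂, hf₁, hz] <;> omega
  apply WP.block_cons
  refine wp_addressProg c0 c1 c3 c4 b7 c18 ?_
  intro m₃ t₃ ht₃ hf₃ d8 d9 d12
  apply WP.block_cons
  refine wp_budgetProg (k := k) (L := 4 * e) (M := M) (by rw [hf₃] <;> omega)
    (by rw [hf₃] <;> omega) (by rw [hf₃] <;> omega) (by rw [hf₃] <;> omega)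
    (by rw [hf₃] <;> omega) (by rw [hf₃] <;> omega) ?_
  intro m₄ t₄ ht₄ hf₄ f6
  have hf : ∀ c, ¬ (20 ≤ c ∧ c < 30) → c ≠ 6 → c ≠ 8 → c ≠ 9 → c ≠ 12 → m₄ c = m₂ c := by
    intro c k1 k2 k3 k4 k5
    rw [hf₄ c k1 k2, hf₃ c k1 k3 k4 k5]
  apply WP.block_cons
  apply WP.sub
  intro v₁ hv₁
  apply WP.block_one
  apply WP.add
  intro v₂ hv₂
  have g8 : m₄ 8 = 65 + 4 * e + n := by rw [hf₄, d8] <;> omega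
  have g9 : m₄ 9 = 65 + 4 * e + n + R * n := by rw [hf₄, d9] <;> omega
  have g18 : m₄ 18 = 0 := by rw [hf] <;> omega
  rw [Function.update_of_ne (by omega), Function.update_of_ne (by omega)] at hv₂
  have hu : ∀ c, c ≠ 22 → c ≠ 23 →
      Function.update (Function.update m₄ 22 v₁) 23 v₂ c = m₄ c := by
    intro c k1 k2
    rw [Function.update_of_ne k2, Function.update_of_ne k1]
  refine hQ _ _ e (4 * e) (65 + 4 * e) (65 + 4 * e + n) _ (by omega) he he' rfl rfl rfl rfl
    ?_ ?_ ?_ ?_ ?_ ?_ ?_ ?_ ?_ ?_ ?_ ?_ ?_ ?_ ?_ ?_ ?_ ?_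
  · rw [hu, hf] <;> omega
  · rw [hu, hf] <;> omega
  · rw [hu, hf] <;> omega
  · rw [hu, hf] <;> omega
  · rw [hu, hf] <;> omega
  · rw [hu, hf] <;> omega
  · rw [hu] <;> omega
  · rw [hu, hf] <;> omega
  · rw [hu] <;> omega
  · rw [hu] <;> omega
  · rw [hu, hf₄, d12] <;> omega
  · rw [hu, hf] <;> omega
  · rw [hu, hf] <;> omega
  · rw [hu, hf, b17] <;> omega
  · rw [hu] <;> omega
  · rw [Function.update_of_ne (by omega), Function.update_self]
    omega
  · rw [Function.update_self]
    omega
  · intro j hj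
    rw [hu _ (by omega) (by omega), hf _ (by omega) (by omega) (by omega) (by omega) (by omega),
      bp j hj]

end Verify

/-! ### The random labels -/

/-- Merges the draw of one label with the draws of the remaining ones into a single uniform choice.
-/
theorem uniform_bind_map {α β γ δ : Type} [Fintype α] [Nonempty α] [Fintype β] [Nonempty β]
    [Fintype γ] [Nonempty γ] (e : γ ≃ α × β) (F : α → β → δ) :
    ((PMF.uniformOfFintype α).bind fun a => (PMF.uniformOfFintype β).map (F a)) =
      (PMF.uniformOfFintype γ).map fun c => F (e c).1 (e c).2 := by
  classical
  have hcard : Fintype.card γ = Fintype.card α * Fintype.card β := by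
    rw [Fintype.card_congr e, Fintype.card_prod]
  ext d
  simp only [PMF.bind_apply, PMF.map_apply, PMF.uniformOfFintype_apply, tsum_fintype]
  rw [← e.symm.sum_comp, Fintype.sum_prod_type]
  refine Finset.sum_congr rfl fun a _ => ?_
  rw [Finset.mul_sum]
  refine Finset.sum_congr rfl fun b _ => ?_
  simp only [Equiv.apply_symm_apply]
  split_ifs
  · rw [hcard, Nat.cast_mul, ENNReal.mul_inv] <;> simp
  · simp

section Labels

variable {P : WitnessProblem} {I : P.Inst}

/-- The final configuration is a function of a uniform vector `g`. Since `g` ranges over a finite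
type, `HasOutcome.seq` reduces the rest of the program to a deterministic statement for each `g`. -/
theorem labelProg_outcome (N T b : ℕ) [NeZero N] (s : Config (Finset (Fin (P.univSize I))))
    (h4 : s.mem 4 = 1) (h17 : s.mem 17 + 1 = N) (h22 : s.mem 22 = T) (h23 : s.mem 23 = b)
    (hb : 64 ≤ b) :
    ∃ F : (Fin T → Fin N) → Config (Finset (Fin (P.univSize I))),
      HasOutcome (oracleStep P I) labelProg s
        ((PMF.uniformOfFintype (Fin T → Fin N)).map F) ∧
      ∀ g, (F g).steps ≤ s.steps + (5 * T + 1) ∧ (F g).queries = s.queries ∧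
        (∀ c, ¬ (20 ≤ c ∧ c < 30) → ¬ (b ≤ c ∧ c < b + T) → (F g).mem c = s.mem c) ∧
        ∀ x : Fin T, (F g).mem (b + x) = g x := by
  induction T generalizing s b with
  | zero =>
    refine ⟨fun _ => s.tick, ?_, fun g => ⟨?_, rfl, fun _ _ _ => rfl, fun x => x.elim0⟩⟩
    · have : (PMF.uniformOfFintype (Fin 0 → Fin N)).map (fun _ => s.tick) =
          PMF.pure s.tick := PMF.map_const _ _
      rw [this]
      exact HasOutcome.loop_done h22
    · simp [Config.tick]
  | succ T ih =>
    have hbody : ∀ x : Fin N, ∃ s' : Config (Finset (Fin (P.univSize I))),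
        HasOutcome (oracleStep P I) (block [.store 23 24, .add 23 23 4, .sub 22 22 4])
          (s.tick.write 24 x) (PMF.pure s') ∧ s'.steps ≤ s.steps + 5 ∧ s'.queries = s.queries ∧
        (∀ c, ¬ (20 ≤ c ∧ c < 30) → c ≠ b → s'.mem c = s.mem c) ∧ s'.mem b = x ∧
        s'.mem 22 = T ∧ s'.mem 23 = b + 1 := by
      intro x
      refine WP.exists_outcome (Q := fun s' => s'.steps ≤ s.steps + 5 ∧ s'.queries = s.queries ∧
        (∀ c, ¬ (20 ≤ c ∧ c < 30) → c ≠ b → s'.mem c = s.mem c) ∧ s'.mem b = x ∧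
        s'.mem 22 = T ∧ s'.mem 23 = b + 1) ?_
      simp only [Config.tick, Config.write]
      repeat first
        | apply WP.block_cons | apply WP.block_one | apply WP.add | apply WP.store | apply WP.sub
        | intro _
      simp only [Function.update_apply] at *
      refine ⟨?_, ?_, ?_, ?_, ?_, ?_⟩ <;> grind
    choose G hG₁ hG₂ hG₃ hG₄ hG₅ hG₆ hG₇ using hbody
    have hone : HasOutcome (oracleStep P I)
        (block [.ext (.rand 24 17), .store 23 24, .add 23 23 4, .sub 22 22 4]) s.tick
        ((PMF.uniformOfFintype (Fin N)).map G) := by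
      have h₁ : HasOutcome (oracleStep P I) (.ext (.rand 24 17)) s.tick
          ((PMF.uniformOfFintype (Fin N)).map fun x : Fin N => s.tick.write 24 x.val) := by
        refine ⟨1, ?_⟩
        subst h17
        rfl
      have h₂ := HasOutcome.seq h₁ hG₁
      rw [block_cons_cons]
      exact h₂
    have hrest := fun x => ih (b + 1) (G x)
      (by rw [hG₄ x 4 (by omega) (by omega), h4]) (by rw [hG₄ x 17 (by omega) (by omega), h17])
      (hG₆ x) (hG₇ x) (by omega)
    choose F hF₁ hF₂ using hrest
    refine ⟨fun g => F (g 0) (Fin.tail g), ?_, fun g => ?_⟩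
    · have := HasOutcome.loop (r := 22) (by omega) hone hF₁
      rw [uniform_bind_map (Fin.consEquiv fun _ : Fin (T + 1) => Fin N).symm] at this
      exact this
    · obtain ⟨k1, k2, k3, k4⟩ := hF₂ (g 0) (Fin.tail g)
      have := hG₂ (g 0)
      refine ⟨by simp only; omega, by rw [k2, hG₃], fun c hc hc' => ?_, fun x => ?_⟩
      · rw [k3 c hc (by omega), hG₄ _ c hc (by omega)]
      · refine Fin.cases ?_ (fun x => ?_) x
        · rw [k3 _ (by simp; omega) (by simp), Fin.val_zero, add_zero, hG₅]
        · have := k4 x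
          rw [Fin.val_succ, ← add_assoc, add_right_comm, this]
          rfl

end Labels

/-! ### The probability of success -/

open Classical in
-- The runs use separate labels, so the bad choices form a product of `R` sets of density at most
-- `1/2` each.
theorem card_all_not_succeeds {n k L M R : ℕ} {Wit : Finset (Finset (Fin n))}
    (hWit : ∀ W ∈ Wit, W.card = k) (hM : 1 ≤ M) (hWM : Wit.card ≤ M) (hL : 4 * n ^ 2 ≤ 2 ^ L) :
    2 ^ R * (Finset.univ.filter fun g : Fin R → Fin n → Fin (2 ^ L) =>
      ∀ i, ¬ Succeeds Wit k L M fun u => (g i u).val).card ≤ ((2 ^ L) ^ n) ^ R := by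
  have : (Finset.univ.filter fun g : Fin R → Fin n → Fin (2 ^ L) =>
      ∀ i, ¬ Succeeds Wit k L M fun u => (g i u).val) =
      Fintype.piFinset fun _ : Fin R => Finset.univ.filter fun f : Fin n → Fin (2 ^ L) =>
        ¬ Succeeds Wit k L M fun u => (f u).val := by
    ext g
    simp [Fintype.mem_piFinset]
  rw [this, Fintype.card_piFinset, Finset.prod_const, Finset.card_univ, Fintype.card_fin, ← mul_pow]
  exact Nat.pow_le_pow_left (card_not_succeeds hWit hM hWM hL) R

theorem toOuterMeasure_uniform_ge {G : Type} [Fintype G] [Nonempty G] (S : Set G) (R : ℕ) (δ : ℝ)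
    (hδ : 1 / 2 ^ R ≤ δ) [DecidablePred (· ∈ S)]
    (hS : 2 ^ R * (Finset.univ.filter fun g => g ∉ S).card ≤ Fintype.card G) :
    ENNReal.ofReal (1 - δ) ≤ (PMF.uniformOfFintype G).toOuterMeasure S := by
  have hsum : (Finset.univ.filter fun g => g ∈ S).card +
      (Finset.univ.filter fun g => g ∉ S).card = Fintype.card G :=
    Finset.card_filter_add_card_filter_not _
  rw [PMF.toOuterMeasure_uniformOfFintype_apply]
  have hG : (0 : ℝ) < Fintype.card G := by exact_mod_cast Fintype.card_pos
  have hc : Fintype.card S = (Finset.univ.filter fun g => g ∈ S).card := Fintype.card_subtype _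
  rw [hc]
  have e : ((Finset.univ.filter fun g => g ∈ S).card : ℝ≥0∞) / (Fintype.card G : ℝ≥0∞) =
      ENNReal.ofReal ((Finset.univ.filter fun g => g ∈ S).card / Fintype.card G) := by
    rw [ENNReal.ofReal_div_of_pos hG, ENNReal.ofReal_natCast, ENNReal.ofReal_natCast]
  rw [e]
  refine ENNReal.ofReal_le_ofReal ?_
  rw [le_div_iff₀ hG]
  have h1 : ((Finset.univ.filter fun g => g ∈ S).card : ℝ) +
      (Finset.univ.filter fun g => g ∉ S).card = Fintype.card G := by exact_mod_cast hsum
  have h2 : (2 : ℝ) ^ R * (Finset.univ.filter fun g => g ∉ S).card ≤ Fintype.card G := by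
    exact_mod_cast hS
  have h3 : ((Finset.univ.filter fun g => g ∉ S).card : ℝ) ≤ δ * Fintype.card G := by
    calc ((Finset.univ.filter fun g => g ∉ S).card : ℝ)
        = 1 / 2 ^ R * (2 ^ R * (Finset.univ.filter fun g => g ∉ S).card) := by field_simp
      _ ≤ 1 / 2 ^ R * Fintype.card G := by gcongr
      _ ≤ δ * Fintype.card G := by gcongr
  linarith

/-- The time is bounded for every random choice, so no averaging is needed. -/
theorem expectedTime_le {L : Type} {μ : PMF (Config L)} {time : L → ℕ} {B : ℝ≥0∞}
    (h : ∀ s ∈ μ.support, ((s.steps + (s.queries.map time).sum : ℕ) : ℝ≥0∞) ≤ B) :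
    expectedTime μ time ≤ B := by
  calc expectedTime μ time ≤ ∑' s, μ s * B := by
        refine ENNReal.tsum_le_tsum fun s => ?_
        by_cases hs : μ s = 0
        · simp [hs]
        · gcongr
          exact h s ((PMF.mem_support_iff _ _).2 hs)
    _ = B := by rw [ENNReal.tsum_mul_right, PMF.tsum_coe, one_mul]

/-! ### The outcome of the counting program -/

section Outcome

variable {P : WitnessProblem} {I : P.Inst}

/-- A bound on the number of steps of the counting program. -/
def totalTime (n k L M R : ℕ) : ℕ :=
  6 * n + 8 * L + 7 * k + 3 * R + 5 * (R * n) + R * (runTime n k (budget k L M) + 3) + 50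

theorem countProg_outcome_zero (hk : P.param I = 0) (M : ℕ) (δ : ℝ) :
    ∃ s, HasOutcome (oracleStep P I) countProg (countStart P I M δ) (PMF.pure s) ∧
      s.steps ≤ P.univSize I + 3 ∧ s.queries.length ≤ 1 ∧
      s.output = some (P.witnesses I).card ∧ (P.witnesses I).card ≤ 1 := by
  refine WP.exists_outcome (Q := fun s => s.steps ≤ P.univSize I + 3 ∧ s.queries.length ≤ 1 ∧
      s.output = some (P.witnesses I).card ∧ (P.witnesses I).card ≤ 1) ?_
  unfold countProg
  refine WP.cond (fun h => absurd hk h) fun _ => ?_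
  apply WP.block_cons
  apply WP.query
  intro v X hX hv
  apply WP.block_one
  apply WP.const
  refine ⟨by simp only; omega, by simp, ?_⟩
  -- The empty set is the only possible witness and lies in every `X`, so it does not matter which
  -- set is queried.
  have hsub : P.witnesses I ⊆ {∅} := fun W hW => by
    rw [Finset.mem_singleton, ← Finset.card_eq_zero, P.card_witness I W hW, hk]
  have hv' : v = (P.witnesses I).card := by
    rcases Finset.subset_singleton_iff.1 hsub with h | h
    · have : ¬ P.YesOn I X := by
        rintro ⟨W, hW, -⟩
        simp [h] at hW
      rw [hv, WitnessProblem.oracle, if_neg this, h]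
      rfl
    · have : P.YesOn I X := ⟨∅, by simp [h], Finset.empty_subset _⟩
      rw [hv, WitnessProblem.oracle, if_pos this, h]
      rfl
  exact ⟨by simp [Config.output, hv'], (Finset.card_le_card hsub).trans (by simp)⟩

/-- All labels form one vector of length `R * n`; run `i` reads the entries `finProdFinEquiv (i,
u)`, that is, `u + n * i`. -/
theorem countProg_outcome_pos (hk : P.param I ≠ 0) (hn : 2 ≤ P.univSize I) {M : ℕ}
    {δ : ℝ} {R : ℕ} (hR : R = ⌈Real.logb 2 (1 / δ)⌉₊) (hR1 : 1 ≤ R) :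
    ∃ (L e : ℕ) (F : (Fin (R * P.univSize I) → Fin (2 ^ L)) →
        Config (Finset (Fin (P.univSize I)))),
      L = 4 * e ∧ P.univSize I ≤ 2 ^ e ∧ 2 ^ e < 2 * P.univSize I ∧
      HasOutcome (oracleStep P I) countProg (countStart P I M δ)
        ((PMF.uniformOfFintype (Fin (R * P.univSize I) → Fin (2 ^ L))).map F) ∧
      ∀ g, (F g).steps ≤ totalTime (P.univSize I) (P.param I) L M R ∧
        (F g).queries.length ≤ R * budget (P.param I) L M ∧
        ((F g).mem 0 = 0 ∨ (F g).mem 0 = 1 ∧ (F g).mem 1 = (P.witnesses I).card ∧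
          (P.witnesses I).card ≤ M) ∧
        ((P.witnesses I).card ≤ M →
          (∃ i, Succeeds (P.witnesses I) (P.param I) L M fun u =>
            (g (finProdFinEquiv (i, u))).val) → (F g).mem 0 = 1) := by
  obtain ⟨s₁, ho₁, e, L, bx, lp, bs, ht, hl, he, he', hL, hbx, hlp, hbs, a0, a1, a2, a3, a4, a5, a6,
      a7, a8, a9, a12, a13, a16, a17, a18, a22, a23, hpow⟩ :
      ∃ s, HasOutcome (oracleStep P I) prepareProg (countStart P I M δ).tick (PMF.pure s) ∧
      ∃ e L bx lp bs,
        s.steps ≤ 1 + (6 * P.univSize I + 8 * L + 7 * P.param I + 3 * R + 33) ∧ s.queries = [] ∧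
        P.univSize I ≤ 2 ^ e ∧ 2 ^ e < 2 * P.univSize I ∧
        L = 4 * e ∧ bx = 65 + L ∧ lp = bx + P.univSize I ∧ bs = lp + R * P.univSize I ∧
        s.mem 0 = P.univSize I ∧ s.mem 1 = P.param I ∧ s.mem 2 = M ∧ s.mem 3 = R ∧ s.mem 4 = 1 ∧
        s.mem 5 = L ∧ s.mem 6 = budget (P.param I) L M ∧
        s.mem 7 = bx ∧ s.mem 8 = lp ∧ s.mem 9 = bs ∧ s.mem 12 = P.param I + 2 ∧ s.mem 13 = 0 ∧
        s.mem 16 = 64 ∧ s.mem 17 = 2 ^ L - 1 ∧ s.mem 18 = 0 ∧ s.mem 22 = R * P.univSize I ∧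
        s.mem 23 = lp ∧ ∀ j ≤ L, s.mem (64 + j) = 2 ^ j := by
    apply WP.exists_outcome
    refine wp_prepareProg (n := P.univSize I) (k := P.param I) (M := M) (R := R) (by omega)
      rfl rfl rfl hR.symm ?_ ?_
    · intro c hc
      simp only [countStart]
      repeat rw [if_neg (by omega)]
    · intro m' t' e L bx lp bs ht h1 h2 h3 h4 h5 h6 h7 h8 h9 h10 h11 h12 h13 h14 h15 h16 h17 h18 h19
        h20 h21 h22 h23 h24
      exact ⟨e, L, bx, lp, bs, by simpa [countStart] using ht, rfl, h1, h2, h3, h4, h5, h6, h7, h8,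
        h9, h10, h11, h12, h13, h14, h15, h16, h17, h18, h19, h20, h21, h22, h23, h24⟩
  obtain ⟨F₀, ho₂, hF₀⟩ := labelProg_outcome (2 ^ L) (R * P.univSize I) lp s₁ a4
    (by rw [a17]; have : 0 < 2 ^ L := by positivity
        omega) a22 a23 (by omega)
  have hruns : ∀ g : Fin (R * P.univSize I) → Fin (2 ^ L), ∃ s,
      HasOutcome (oracleStep P I) runsProg (F₀ g) (PMF.pure s) ∧
      s.steps ≤ totalTime (P.univSize I) (P.param I) L M R ∧
        s.queries.length ≤ R * budget (P.param I) L M ∧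
        (s.mem 0 = 0 ∨ s.mem 0 = 1 ∧ s.mem 1 = (P.witnesses I).card ∧
          (P.witnesses I).card ≤ M) ∧
        ((P.witnesses I).card ≤ M →
          (∃ i, Succeeds (P.witnesses I) (P.param I) L M fun u =>
            (g (finProdFinEquiv (i, u))).val) → s.mem 0 = 1) := by
    intro g
    obtain ⟨k1, k2, k3, k4⟩ := hF₀ g
    generalize F₀ g = s₂ at *
    obtain ⟨m₂, t₂, l₂⟩ := s₂
    simp only at k1 k2 k3 k4
    have hRn : P.univSize I ≤ R * P.univSize I := Nat.le_mul_of_pos_left _ hR1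
    obtain ⟨F, hF⟩ : ∃ F : ℕ → Fin (P.univSize I) → ℕ, ∀ (i : Fin R) u,
        F i u = (g (finProdFinEquiv (i, u))).val :=
      ⟨fun i u => if h : i < R then (g (finProdFinEquiv (⟨i, h⟩, u))).val else 0,
        fun i _ => dif_pos i.2⟩
    have hlab : ∀ i < R, ∀ u : Fin (P.univSize I), m₂ (lp + i * P.univSize I + u) = F i u := by
      intro i hi u
      have h1 := k4 (finProdFinEquiv (⟨i, hi⟩, u))
      have h2 := hF ⟨i, hi⟩ u
      simp only [finProdFinEquiv_apply_val] at h1 h2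
      rw [h2, ← h1]
      congr 1
      ring
    apply WP.exists_outcome
    refine wp_runsProg (n := P.univSize I) (k := P.param I) (L := L) (M := M) (R := R) (lp := lp)
      (bx := bx) (bs := bs) (F := F) (Wit := P.witnesses I) rfl ?_ (P.card_witness I) ?_ hbs
      ?_ ?_ ?_ ?_ hlab ?_ ?_
    · intro X
      rfl
    · constructor
      · rw [k3 _ (by omega) (by omega), a0]
      · rw [k3 _ (by omega) (by omega), a1]
      · rw [k3 _ (by omega) (by omega), a4]
      · rw [k3 _ (by omega) (by omega), a5]
      · rw [k3 _ (by omega) (by omega), a7]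
      · rw [k3 _ (by omega) (by omega), a8]
      · rw [k3 _ (by omega) (by omega), a9]
      · rw [k3 _ (by omega) (by omega), a12]
      · rw [k3 _ (by omega) (by omega), a16]
      · rw [k3 _ (by omega) (by omega), a18]
      · intro j hj
        rw [k3 _ (by omega) (by omega), hpow j hj]
      · intro u
        simpa using hlab 0 hR1 u
      · omega
      · omega
      · omega
    · rw [k3 _ (by omega) (by omega), a2]
    · rw [k3 _ (by omega) (by omega), a3]
    · rw [k3 _ (by omega) (by omega), a6]
    · rw [k3 _ (by omega) (by omega), a13]
    · intro i hi u
      rw [hF ⟨i, hi⟩ u]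
      exact Fin.is_lt _
    · intro m' t' l' q1 q2 q3 q4
      refine ⟨?_, ?_, q3, ?_⟩
      · simp only
        unfold totalTime
        omega
      · simpa [k2, hl] using q2
      · rintro hle ⟨i, hi⟩
        refine q4 hle ⟨i, i.2, ?_⟩
        have : F i = fun u => (g (finProdFinEquiv (i, u))).val := funext (hF i)
        rw [this]
        exact hi
  choose F hF₁ hF₂ using hruns
  refine ⟨L, e, F, hL, he, he', ?_, hF₂⟩
  have h₂ := HasOutcome.seq ho₂ hF₁
  refine HasOutcome.cond_pos hk ?_
  rw [block_cons_cons]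
  refine HasOutcome.seq_pure ho₁ ?_
  rw [block_cons_cons, block_singleton]
  exact h₂

end Outcome

/-! ### Estimates -/

theorem exponent_le {n e : ℕ} (he : 2 ^ e < 2 * n) : e ≤ n := by
  cases e with
  | zero => exact Nat.zero_le _
  | succ e =>
    have h : e < 2 ^ e := Nat.lt_two_pow_self
    rw [pow_succ] at he
    omega

/-- The running time may lose powers of `n`, so `L + 1` is bounded by `5 * n` here; the logarithm is
kept only in `queries_le_log`. -/
theorem budget_le {n k e M : ℕ} (hn : 1 ≤ n) (he : 2 ^ e < 2 * n) :
    budget k (4 * e) M ≤ 80 * (n * 32 ^ k * M) := by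
  have h := exponent_le he
  calc budget k (4 * e) M ≤ 16 * 32 ^ k * ((5 * n) * M) := by
        unfold budget
        gcongr
        omega
    _ = 80 * (n * 32 ^ k * M) := by ring

/-- The `64 ^ k` is `32 ^ k` from the budget times `2 ^ k ≥ k` from the cost of a round. Every
summand is compared with the same product `Z`. -/
theorem totalTime_le {n k e M R : ℕ} (hn : 1 ≤ n) (hM : 1 ≤ M) (hR : 1 ≤ R)
    (he : 2 ^ e < 2 * n) :
    totalTime n k (4 * e) M R ≤ 2 ^ 13 * (R * (n ^ 2 * 64 ^ k * M)) := by
  have hB := budget_le (k := k) (M := M) hn he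
  have he := exponent_le he
  have hk : k ≤ 2 ^ k := Nat.lt_two_pow_self.le
  have hK : 1 ≤ 2 ^ k := Nat.one_le_two_pow
  have h32 : 1 ≤ 32 ^ k := Nat.one_le_pow _ _ (by norm_num)
  have h64 : (64 : ℕ) ^ k = 32 ^ k * 2 ^ k := by rw [← mul_pow]; norm_num
  set K := 2 ^ k
  set A := 32 ^ k
  have hrt : roundTime n k ≤ 72 * (n * K) := by
    have h1 : 1 * 1 ≤ n * K := Nat.mul_le_mul hn hK
    have h2 : n * 1 ≤ n * K := Nat.mul_le_mul le_rfl hK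
    have h3 : n * k ≤ n * K := Nat.mul_le_mul le_rfl hk
    have h4 : 1 * k ≤ n * K := Nat.mul_le_mul hn hk
    have h5 : n * (10 * k + 9) = 10 * (n * k) + 9 * n := by ring
    unfold roundTime
    omega
  set Z := n ^ 2 * (A * K) * M with hZ
  have hAM : 1 ≤ A * M := Nat.mul_le_mul h32 hM
  have hnnK : n * n * K ≤ Z := by
    calc n * n * K = n * n * K * 1 := by ring
      _ ≤ n * n * K * (A * M) := Nat.mul_le_mul le_rfl hAM
      _ = Z := by rw [hZ]; ring
  have hnn : n * n ≤ Z := le_trans (by nlinarith) hnnK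
  have hn1 : n ≤ Z := le_trans (by nlinarith) hnn
  have hk1 : k ≤ Z := by
    refine le_trans ?_ hnnK
    calc k = 1 * 1 * k := by ring
      _ ≤ n * n * K := by gcongr
  have h1Z : 1 ≤ Z := hn.trans hn1
  have hBr : budget k (4 * e) M * roundTime n k ≤ 5760 * Z := by
    calc budget k (4 * e) M * roundTime n k ≤ 80 * (n * A * M) * (72 * (n * K)) :=
          Nat.mul_le_mul hB hrt
      _ = 5760 * Z := by rw [hZ]; ring
  have hrun : runTime n k (budget k (4 * e) M) ≤ 5803 * Z := by
    have h5 : n * (10 * n + 7) = 10 * (n * n) + 7 * n := by ring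
    unfold runTime
    omega
  have hRZ : ∀ x, x ≤ Z → x ≤ R * Z := fun x hx => hx.trans (Nat.le_mul_of_pos_left _ hR)
  have r1 := hRZ n hn1
  have r2 := hRZ k hk1
  have r3 := hRZ 1 h1Z
  have r4 : R * 1 ≤ R * Z := Nat.mul_le_mul le_rfl h1Z
  have r5 : R * n ≤ R * Z := Nat.mul_le_mul le_rfl hn1
  have r6 : R * (runTime n k (budget k (4 * e) M) + 3) ≤ 5806 * (R * Z) := by
    calc R * (runTime n k (budget k (4 * e) M) + 3) ≤ R * (5806 * Z) :=
          Nat.mul_le_mul le_rfl (by omega)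
      _ = 5806 * (R * Z) := by ring
  rw [h64, ← hZ]
  unfold totalTime
  omega

/-- The constant is `320 = 2 * 16 * 10`, from rounding up `R`, from `budget` and from `L + 1`. As `k
≥ 1`, it is absorbed by `2 ^ (9 * k)`, and `9 + 5 = 14`. -/
theorem queries_le_log {n k e M R : ℕ} {d : ℝ} (hk : k ≠ 0) (hn : 2 ≤ n)
    (he : 2 ^ e < 2 * n) (hne : n ≤ 2 ^ e) (hR : (R : ℝ) ≤ 2 * d) :
    ((R * budget k (4 * e) M : ℕ) : ℝ) ≤
      2 ^ (14 * k) * Real.logb 2 n ^ 2 * M * d := by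
  have hn0 : (0 : ℝ) < n := by exact_mod_cast (by omega : 0 < n)
  have hlog : 1 ≤ Real.logb 2 n := by
    rw [Real.le_logb_iff_rpow_le (by norm_num) hn0, Real.rpow_one]
    exact_mod_cast hn
  have he1 : 1 ≤ e := by
    by_contra h
    have : e = 0 := by omega
    subst this
    simp at hne
    omega
  have hle : (e : ℝ) ≤ 1 + Real.logb 2 n := by
    have h1 : ((2 : ℝ) ^ e) ≤ 2 * n := by exact_mod_cast he.le
    have h2 := Real.logb_le_logb_of_le (b := 2) (by norm_num) (by positivity) h1
    rw [Real.logb_mul (by norm_num) hn0.ne', Real.logb_self_eq_one (by norm_num),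
      Real.logb_pow, Real.logb_self_eq_one (by norm_num), mul_one] at h2
    exact h2
  -- Already `4 * e + 1 ≤ 5 * e ≤ 10 * logb 2 n`; the square is slack.
  have hL : (4 * e + 1 : ℝ) ≤ 10 * Real.logb 2 n ^ 2 := by
    have : (1 : ℝ) ≤ e := by exact_mod_cast he1
    nlinarith
  have hd : 0 ≤ d := by
    have : (0 : ℝ) ≤ R := Nat.cast_nonneg R
    linarith
  have hpow : (320 : ℝ) * 32 ^ k ≤ 2 ^ (14 * k) := by
    obtain ⟨j, rfl⟩ : ∃ j, k = j + 1 := ⟨k - 1, by omega⟩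
    calc (320 : ℝ) * 32 ^ (j + 1) ≤ 2 ^ 9 * (2 ^ 9) ^ j * 32 ^ (j + 1) := by
          have : (1 : ℝ) ≤ (2 ^ 9) ^ j := one_le_pow₀ (by norm_num)
          gcongr
          nlinarith
      _ = 2 ^ (14 * (j + 1)) := by
          rw [show (32 : ℝ) = 2 ^ 5 by norm_num, ← pow_mul, ← pow_mul, ← pow_add, ← pow_add]
          congr 1
          ring
  have hM : (0 : ℝ) ≤ M := Nat.cast_nonneg M
  unfold budget
  push_cast
  calc (R : ℝ) * (16 * 32 ^ k * ((4 * e + 1) * M))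
      ≤ 2 * d * (16 * 32 ^ k * (10 * Real.logb 2 n ^ 2 * M)) := by gcongr
    _ = (320 * 32 ^ k) * Real.logb 2 n ^ 2 * M * d := by ring
    _ ≤ 2 ^ (14 * k) * Real.logb 2 n ^ 2 * M * d := by gcongr

/-- Since `k` may be `0`, constants go into powers of `n ≥ 2` instead of `2 ^ (O(k))`: the factor `2
^ 15 ≤ n ^ 15` raises the exponent from `c + 2` to `c + 17`. -/
theorem time_le {α : Type} {n k M R g c st : ℕ} {d : ℝ} {qs : List α} {time : α → ℕ} (hn : 2 ≤ n)
    (hg : 1 ≤ g) (hR : (R : ℝ) ≤ 2 * d) (hst : st ≤ 2 ^ 13 * (R * (n ^ 2 * 64 ^ k * M)))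
    (hqs : qs.length ≤ R * (80 * (n * 32 ^ k * M))) (htime : ∀ X, time X ≤ g * n ^ c) :
    ((st + (qs.map time).sum : ℕ) : ℝ≥0∞) ≤
      ENNReal.ofReal (2 ^ ((c + 17) * k) * g * (n : ℝ) ^ (c + 17) * M * d) := by
  have hsum : (qs.map time).sum ≤ R * (80 * (n * 32 ^ k * M)) * (g * n ^ c) := by
    have h := List.sum_le_card_nsmul (qs.map time) (g * n ^ c) (by
      intro x hx
      obtain ⟨X, -, rfl⟩ := List.mem_map.1 hx
      exact htime X)
    rw [List.length_map, smul_eq_mul] at h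
    exact h.trans (Nat.mul_le_mul_right _ hqs)
  have hnc : 1 ≤ n ^ c := Nat.one_le_pow _ _ (by omega)
  have hZ : n ^ 2 * 64 ^ k * M ≤ n ^ (c + 2) * 64 ^ k * M * g := by
    calc n ^ 2 * 64 ^ k * M = 1 * n ^ 2 * 64 ^ k * M * 1 := by ring
      _ ≤ n ^ c * n ^ 2 * 64 ^ k * M * g := by gcongr
      _ = _ := by ring
  have hZ' : n * 32 ^ k * M * (g * n ^ c) ≤ n ^ (c + 2) * 64 ^ k * M * g := by
    calc n * 32 ^ k * M * (g * n ^ c) = 1 * n * 32 ^ k * M * g * n ^ c := by ring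
      _ ≤ n * n * 64 ^ k * M * g * n ^ c := by
          gcongr
          · omega
          · norm_num
      _ = _ := by ring
  have htot : st + (qs.map time).sum ≤ 2 ^ 14 * (R * (n ^ (c + 2) * 64 ^ k * M * g)) := by
    have h1 : R * (n ^ 2 * 64 ^ k * M) ≤ R * (n ^ (c + 2) * 64 ^ k * M * g) :=
      Nat.mul_le_mul_left _ hZ
    have h2 : R * (80 * (n * 32 ^ k * M)) * (g * n ^ c) ≤
        80 * (R * (n ^ (c + 2) * 64 ^ k * M * g)) := by
      calc _ = 80 * (R * (n * 32 ^ k * M * (g * n ^ c))) := by ring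
        _ ≤ _ := Nat.mul_le_mul_left _ (Nat.mul_le_mul_left _ hZ')
    omega
  have hn2 : (2 : ℝ) ≤ n := by exact_mod_cast hn
  have hd : 0 ≤ d := by
    have : (0 : ℝ) ≤ R := Nat.cast_nonneg R
    linarith
  have hreal : ((st + (qs.map time).sum : ℕ) : ℝ) ≤
      2 ^ ((c + 17) * k) * g * (n : ℝ) ^ (c + 17) * M * d := by
    calc ((st + (qs.map time).sum : ℕ) : ℝ)
        ≤ ((2 ^ 14 * (R * (n ^ (c + 2) * 64 ^ k * M * g)) : ℕ) : ℝ) := by exact_mod_cast htot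
      _ = 2 ^ 14 * R * ((n : ℝ) ^ (c + 2) * 64 ^ k * M * g) := by push_cast; ring
      _ ≤ 2 ^ 14 * (2 * d) * ((n : ℝ) ^ (c + 2) * 64 ^ k * M * g) := by gcongr
      _ = 2 ^ 15 * (64 ^ k * g * (n : ℝ) ^ (c + 2) * M * d) := by ring
      _ ≤ (n : ℝ) ^ 15 * (2 ^ ((c + 17) * k) * g * (n : ℝ) ^ (c + 2) * M * d) := by
          have : (64 : ℝ) ^ k ≤ 2 ^ ((c + 17) * k) := by
            rw [show (64 : ℝ) = 2 ^ 6 by norm_num, ← pow_mul]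
            exact pow_le_pow_right₀ (by norm_num) (Nat.mul_le_mul_right _ (by omega))
          gcongr
      _ = _ := by ring
  rw [← ENNReal.ofReal_natCast]
  exact ENNReal.ofReal_le_ofReal hreal

end WitnessCounting

end

open WitnessCounting in
theorem mainTheorem3 :
    ∃ (A : Prog OracleOp) (C : ℕ) (e : ℕ → ℕ),
      ∀ (P : WitnessProblem) (δ : ℝ) (M : ℕ), 0 < δ → δ ≤ 1 / 2 → 1 ≤ M →
        ∀ I : P.Inst, 2 ≤ P.univSize I →
          ∃ μ : PMF (Config (Finset (Fin (P.univSize I)))),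
            HasOutcome (oracleStep P I) A (countStart P I M δ) μ ∧
            (∀ s ∈ μ.support,
              (s.queries.length : ℝ) ≤
                2 ^ (C * P.param I) * Real.logb 2 (P.univSize I) ^ 2 * M * Real.logb 2 (1 / δ)) ∧
            ((P.witnesses I).card ≤ M →
              ENNReal.ofReal (1 - δ) ≤
                μ.toOuterMeasure {s | s.output = some (P.witnesses I).card}) ∧
            (M < (P.witnesses I).card → ∀ s ∈ μ.support, s.output = none) ∧
            (∀ (D : Prog ReadOp) (time : (J : P.Inst) → Finset (Fin (P.univSize J)) → ℕ)
                (g : ℕ → ℕ) (c : ℕ),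
              Decides P D time →
              (∀ J X, 2 ≤ P.univSize J → time J X ≤ g (P.param J) * P.univSize J ^ c) →
              expectedTime μ (time I) ≤
                ENNReal.ofReal
                  (2 ^ (e c * P.param I) * g (P.param I) * (P.univSize I : ℝ) ^ e c * M *
                    Real.logb 2 (1 / δ))) := by
  refine ⟨countProg, 14, fun c => c + 17, ?_⟩
  intro P δ M hδ hδ' hM I hn
  have hd : 1 ≤ Real.logb 2 (1 / δ) := by
    rw [Real.le_logb_iff_rpow_le (by norm_num) (by positivity), Real.rpow_one,
      le_div_iff₀ hδ]
    linarith
  have hn0 : (0 : ℝ) < P.univSize I := by exact_mod_cast (by omega : 0 < P.univSize I)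
  have hlog : 1 ≤ Real.logb 2 (P.univSize I) := by
    rw [Real.le_logb_iff_rpow_le (by norm_num) hn0, Real.rpow_one]
    exact_mod_cast hn
  have hMr : (1 : ℝ) ≤ M := by exact_mod_cast hM
  obtain ⟨R, hR⟩ : ∃ R, R = ⌈Real.logb 2 (1 / δ)⌉₊ := ⟨_, rfl⟩
  have hR1 : 1 ≤ R := by
    rw [hR, Nat.one_le_ceil_iff]
    linarith
  have hR2 : (R : ℝ) ≤ 2 * Real.logb 2 (1 / δ) := by
    -- Here `δ ≤ 1/2` matters: the logarithm is at least `1`, so rounding up at most doubles it.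
    have := Nat.ceil_lt_add_one (show 0 ≤ Real.logb 2 (1 / δ) by linarith)
    rw [← hR] at this
    linarith
  have htime : ∀ (μ : PMF (Config (Finset (Fin (P.univSize I))))),
      (∀ s ∈ μ.support,
        s.steps ≤ 2 ^ 13 * (R * (P.univSize I ^ 2 * 64 ^ P.param I * M)) ∧
        s.queries.length ≤ R * (80 * (P.univSize I * 32 ^ P.param I * M))) →
      ∀ (D : Prog ReadOp) (time : (J : P.Inst) → Finset (Fin (P.univSize J)) → ℕ)
        (g : ℕ → ℕ) (c : ℕ), Decides P D time →
        (∀ J X, 2 ≤ P.univSize J → time J X ≤ g (P.param J) * P.univSize J ^ c) →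
        expectedTime μ (time I) ≤ ENNReal.ofReal
          (2 ^ ((c + 17) * P.param I) * g (P.param I) * (P.univSize I : ℝ) ^ (c + 17) * M *
            Real.logb 2 (1 / δ)) := by
    intro μ hμ D time g c hD hg
    refine expectedTime_le fun s hs => ?_
    refine time_le hn ?_ hR2 (hμ s hs).1 (hμ s hs).2 fun X => hg I X hn
    have h1 := hD.time_pos I ∅
    have h2 := hg I ∅ hn
    by_contra h0
    have h3 : g (P.param I) = 0 := by omega
    rw [h3, zero_mul] at h2
    omega
  by_cases hk : P.param I = 0
  · obtain ⟨s, ho, hst, hq, hout, hc⟩ := countProg_outcome_zero hk M δ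
    refine ⟨PMF.pure s, ho, ?_, ?_, ?_, htime _ ?_⟩
    · intro s' hs'
      rw [PMF.support_pure, Set.mem_singleton_iff] at hs'
      subst hs'
      rw [hk, mul_zero, pow_zero, one_mul]
      have h1 : (s'.queries.length : ℝ) ≤ 1 := by exact_mod_cast hq
      have h2 : (1 : ℝ) ≤ Real.logb 2 (P.univSize I) ^ 2 := one_le_pow₀ hlog
      calc (s'.queries.length : ℝ) ≤ 1 * 1 * 1 := by linarith
        _ ≤ Real.logb 2 (P.univSize I) ^ 2 * M * Real.logb 2 (1 / δ) := by gcongr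
    · intro _
      rw [PMF.toOuterMeasure_pure_apply, Set.mem_ofPred_eq, if_pos hout]
      rw [← ENNReal.ofReal_one]
      exact ENNReal.ofReal_le_ofReal (by linarith)
    · intro h
      omega
    · intro s' hs'
      rw [PMF.support_pure, Set.mem_singleton_iff] at hs'
      subst hs'
      rw [hk, pow_zero, pow_zero, mul_one, mul_one]
      have h1 : 1 * P.univSize I ≤ R * (P.univSize I * M) := by
        refine Nat.mul_le_mul hR1 ?_
        exact Nat.le_mul_of_pos_right _ hM
      have h2 : R * (P.univSize I * M) ≤ R * (P.univSize I ^ 2 * M) := by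
        gcongr
        exact Nat.le_self_pow (by norm_num) _
      have h3 : R * (80 * (P.univSize I * M)) = 80 * (R * (P.univSize I * M)) := by ring
      constructor <;> omega
  · obtain ⟨L, e, F, rfl, hne, he, ho, hF⟩ := countProg_outcome_pos (M := M) hk hn hR hR1
    have hsupp : ∀ s ∈ ((PMF.uniformOfFintype
        (Fin (R * P.univSize I) → Fin (2 ^ (4 * e)))).map F).support, ∃ g, F g = s := by
      intro s hs
      rw [PMF.support_map] at hs
      obtain ⟨g, -, h⟩ := hs
      exact ⟨g, h⟩
    refine ⟨_, ho, ?_, ?_, ?_, htime _ ?_⟩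
    · intro s hs
      obtain ⟨g, rfl⟩ := hsupp s hs
      refine le_trans ?_ (queries_le_log (M := M) hk hn he hne hR2)
      exact_mod_cast (hF g).2.1
    · intro hcard
      classical
      rw [PMF.toOuterMeasure_map_apply]
      refine toOuterMeasure_uniform_ge _ R δ ?_ ?_
      · rw [div_le_iff₀ (by positivity)]
        have h1 : Real.logb 2 (1 / δ) ≤ R := by rw [hR]; exact Nat.le_ceil _
        rw [Real.logb_le_iff_le_rpow (by norm_num) (by positivity), Real.rpow_natCast,
          div_le_iff₀ hδ] at h1
        linarith
      · have hbig : 4 * P.univSize I ^ 2 ≤ 2 ^ (4 * e) := by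
          calc 4 * P.univSize I ^ 2 ≤ P.univSize I ^ 2 * P.univSize I ^ 2 := by
                refine Nat.mul_le_mul_right _ ?_
                nlinarith
            _ = P.univSize I ^ 4 := by ring
            _ ≤ (2 ^ e) ^ 4 := Nat.pow_le_pow_left hne 4
            _ = 2 ^ (4 * e) := by rw [← pow_mul, mul_comm]
        have hall := card_all_not_succeeds (R := R) (P.card_witness I) hM hcard hbig
        have hG : Fintype.card (Fin (R * P.univSize I) → Fin (2 ^ (4 * e))) =
            ((2 ^ (4 * e)) ^ P.univSize I) ^ R := by
          rw [Fintype.card_fun, Fintype.card_fin, Fintype.card_fin, ← pow_mul _ (P.univSize I) R,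
            mul_comm R]
        rw [hG]
        -- A vector with the wrong output fails in every run, and cutting a vector into its `R`
        -- labelings is injective.
        refine le_trans (Nat.mul_le_mul_left _ ?_) hall
        refine Finset.card_le_card_of_injOn
          (fun g i u => g (finProdFinEquiv (i, u))) ?_ ?_
        · intro g hg
          simp only [Finset.coe_filter, Finset.mem_univ, true_and, Set.mem_ofPred_eq,
            Set.mem_preimage] at hg ⊢
          intro i hs
          apply hg
          have h1 := (hF g).2.2.2 hcard ⟨i, hs⟩
          rcases (hF g).2.2.1 with h0 | ⟨h0, h2, -⟩
          · omega
          · rw [Config.output, if_neg (by omega), h2]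
        · intro g _ g' _ h
          funext x
          have := congrFun (congrFun h (finProdFinEquiv.symm x).1) (finProdFinEquiv.symm x).2
          simpa only [Prod.mk.eta, Equiv.apply_symm_apply] using this
    · intro hlt s hs
      obtain ⟨g, rfl⟩ := hsupp s hs
      rcases (hF g).2.2.1 with h | h
      · rw [Config.output, if_pos h]
      · omega
    · intro s hs
      obtain ⟨g, rfl⟩ := hsupp s hs
      exact ⟨(hF g).1.trans (totalTime_le (by omega) hM hR1 he),
        (hF g).2.1.trans (Nat.mul_le_mul_left _ (budget_le (by omega) he))⟩
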